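/- Let $\Lambda\subset\mathbb R^2$ be a lattice of rank two. Equip the torus $M=\mathbb R^2/\Lambda$ with its flat metric, the distance $d(x,y)$ and the Riemannian volume. A minimal geodesic is a nonconstant geodesic $\gamma:[0,s_0]\to M$ (the projection of a straight line segment traversed with constant velocity) whose length equals $d(\gamma(0),\gamma(s_0))$. A function $G:M\times M\to\mathbb R$ is called geodesically decreasing (respectively strictly geodesically decreasing) if for every $x\in M$ and every minimal geodesic $\gamma:[0,s_0]\to M$ with $\gamma(0)=x$, the function $s\mapsto G(x,\gamma(s))$ is non-increasing (respectively strictly decreasing) on $[0,s_0]$. The heat kernel of $M$ is the fundamental solution of the heat equation: a function $K_t(x,y)$ $(t>0,\ x,y\in M)$ such that for each $x$ the function $(t,y)\mapsto K_t(x,y)$ is of class $C^2$ and satisfies $\partial_tK_t(x,y)=\Delta_yK_t(x,y)$ for $t>0$, and $\int_MK_t(x,y)f(y)\,dy\to f(x)$ as $t\downarrow0$ for every continuous $f:M\to\mathbb R$. The lattice is called rectangular if it has a $\mathbb Z$-basis of two orthogonal vectors, and regular triangular if it has a $\mathbb Z$-basis of two vectors of equal length at an angle of $2\pi/3$. Then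 $M$ has a heat kernel, and for the heat kernel $K_t$ the following hold. 1. If $\Lambda$ is a regular triangular lattice, then $K_t$ is strictly geodesically decreasing for every $t>0$. 2. Conversely, if there is a sequence of times $t_k>0$ with $t_k\to\infty$ such that $K_{t_k}$ is geodesically decreasing for every $k$, then $\Lambda$ is a rectangular lattice or a regular triangular lattice. -/

import Mathlib

open Real Set Filter Topology MeasureTheory

open scoped InnerProductSpace Laplacian

noncomputable section

/-- The Euclidean plane. -/
abbrev Plane : Type := EuclideanSpace ℝ (Fin 2)

/-- The flat torus `ℝ² / Λ`. Its distance is the quotient distance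
`d(π p, π q) = inf {|p - q + ℓ| : ℓ ∈ Λ}`, the Riemannian distance of the flat metric. -/
abbrev FlatTorus (Λ : Submodule ℤ Plane) : Type := Plane ⧸ Λ.toAddSubgroup

/-- The covering map `π : ℝ² → ℝ² / Λ`, a local isometry. -/
def torusProj (Λ : Submodule ℤ Plane) (p : Plane) : FlatTorus Λ := QuotientAddGroup.mk p

/-- The Riemannian volume of `ℝ² / Λ`: the image under `π` of Lebesgue measure on a fundamental
parallelogram of `Λ` (the result does not depend on the lattice basis used). -/
def torusVolume (Λ : Submodule ℤ Plane) [DiscreteTopology Λ] [IsZLattice ℝ Λ] :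
    Measure (FlatTorus Λ) :=
  (volume.restrict (ZSpan.fundamentalDomain
    ((Module.Free.chooseBasis ℤ Λ).ofZLatticeBasis ℝ Λ))).map (torusProj Λ)

/-- `K` is the heat kernel of `ℝ² / Λ`, i.e. the fundamental solution of the heat equation
`∂ₜ u = Δ u`: for every pole `x`, the function `(t, y) ↦ K t x y` is a classical solution for
`t > 0`, and `K t x · → δₓ` weakly as `t ↓ 0`. Since `π` is a local isometry, smoothness and
the Laplace-Beltrami operator on the torus are those of the lift to the plane.
Only the values of `K` at positive times matter. -/
structure IsHeatKernel (Λ : Submodule ℤ Plane) [DiscreteTopology Λ] [IsZLattice ℝ Λ]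
    (K : ℝ → FlatTorus Λ → FlatTorus Λ → ℝ) : Prop where
  contDiffOn : ∀ x : FlatTorus Λ,
    ContDiffOn ℝ 2 (fun q : ℝ × Plane => K q.1 x (torusProj Λ q.2)) (Ioi 0 ×ˢ univ)
  heat_eq : ∀ x : FlatTorus Λ, ∀ t : ℝ, 0 < t → ∀ p : Plane,
    deriv (fun τ : ℝ => K τ x (torusProj Λ p)) t =
      (Δ (fun z : Plane => K t x (torusProj Λ z))) p
  initial : ∀ x : FlatTorus Λ, ∀ f : FlatTorus Λ → ℝ, Continuous f →
    Tendsto (fun t : ℝ => ∫ y, K t x y * f y ∂(torusVolume Λ)) (𝓝[>] 0) (𝓝 (f x))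

/-- `γ : [0, s₀] → ℝ² / Λ` is a (nonconstant) minimal geodesic: a geodesic of the flat metric,
that is, the projection of a straight line traversed with constant velocity `v ≠ 0`,
whose length `s₀ * ‖v‖` equals the distance between its endpoints. -/
def IsMinimalGeodesic (Λ : Submodule ℤ Plane) (γ : ℝ → FlatTorus Λ) (s₀ : ℝ) : Prop :=
  ∃ p v : Plane, v ≠ 0 ∧ (∀ s ∈ Icc 0 s₀, γ s = torusProj Λ (p + s • v)) ∧
    dist (γ 0) (γ s₀) = s₀ * ‖v‖

/-- `F` decreases geodesically about the point `x`. -/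
def DecreasesGeodesicallyAbout (Λ : Submodule ℤ Plane) (F : FlatTorus Λ → ℝ)
    (x : FlatTorus Λ) : Prop :=
  ∀ (γ : ℝ → FlatTorus Λ) (s₀ : ℝ), IsMinimalGeodesic Λ γ s₀ → γ 0 = x →
    AntitoneOn (fun s => F (γ s)) (Icc 0 s₀)

/-- `F` decreases strictly geodesically about the point `x`. -/
def StrictlyDecreasesGeodesicallyAbout (Λ : Submodule ℤ Plane) (F : FlatTorus Λ → ℝ)
    (x : FlatTorus Λ) : Prop :=
  ∀ (γ : ℝ → FlatTorus Λ) (s₀ : ℝ), IsMinimalGeodesic Λ γ s₀ → γ 0 = x →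
    StrictAntiOn (fun s => F (γ s)) (Icc 0 s₀)

/-- `G` is geodesically decreasing. -/
def GeodesicallyDecreasing (Λ : Submodule ℤ Plane)
    (G : FlatTorus Λ → FlatTorus Λ → ℝ) : Prop :=
  ∀ x, DecreasesGeodesicallyAbout Λ (G x) x

/-- `G` is strictly geodesically decreasing. -/
def StrictlyGeodesicallyDecreasing (Λ : Submodule ℤ Plane)
    (G : FlatTorus Λ → FlatTorus Λ → ℝ) : Prop :=
  ∀ x, StrictlyDecreasesGeodesicallyAbout Λ (G x) x

/-- `Λ` has a basis of two nonzero orthogonal vectors. -/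
def IsRectangularLattice (Λ : Submodule ℤ Plane) : Prop :=
  ∃ u v : Plane, u ≠ 0 ∧ v ≠ 0 ∧ ⟪u, v⟫_ℝ = 0 ∧ Λ = Submodule.span ℤ {u, v}

/-- `Λ` has a basis of two nonzero vectors of equal length at an angle of `2π/3`. -/
def IsRegularTriangularLattice (Λ : Submodule ℤ Plane) : Prop :=
  ∃ u v : Plane, u ≠ 0 ∧ ‖u‖ = ‖v‖ ∧ InnerProductGeometry.angle u v = 2 * π / 3 ∧
    Λ = Submodule.span ℤ {u, v}

end

set_option linter.unusedSectionVars false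

/-! The kernel is explicit: K_t(x, y) = V⁻¹ ∑ exp(-|ξ|² t) cos⟨ξ, x - y⟩, with V the area of the
torus and ξ running over 2π times the dual lattice (`heatFn`). Such series are smooth for t > 0 and
may be differentiated termwise. By Stone–Weierstrass two continuous functionals agreeing on plane
waves are equal; this gives the initial condition (the kernel integrates like a Gaussian of variance
2t, `setIntegral_heatFn_eq_gaussian`) and uniqueness (Green's formula forces the Fourier
coefficients of any heat kernel to be multiples of exp(-|ξ|² t), `IsHeatKernel.eq_heatFn`). Minimal
geodesics from a point are the segments from the centre of the Voronoi cell of the lattice, so only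
the behaviour of `heatFn` along these segments matters.

Triangular lattice. Up to scale, `heatFn` is the theta function of m² + mn + n². Its dihedral
symmetry reduces the hexagonal cell to a triangle, a twelfth of it. In the orthogonal coordinates x
= π(a + b), y = π(a - b) the function is P(x)Q(y) + P(x + π)Q(y + π), up to a factor 1/2, with P, Q
one-dimensional theta functions, and the triangle is 0 ≤ y ≤ x/3, x ≤ π. Both partial derivatives
are negative inside. For ∂_y (`hexProdY_neg`), monotonicity of P replaces x by π; at the vertex (π,
π/3) of the cell the derivative vanishes by symmetry, and Q'(y + π)/Q'(y) is monotone
(`deriv_thetaEven_mul_le`). For ∂_x (`hexProdX_neg`), the mirror line x = 3y identifies it with ∂_y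
there, and monotonicity of Q extends the sign to smaller y.

Monotonicity of Q'(y + π)/Q'(y) comes from a quadratic identity expressing Q(y₂)Q(y₁ + π) -
Q(y₁)Q(y₂ + π) through the odd theta function at y₁ ± y₂ (`thetaEven_identity`). Differentiating in
both variables leaves second derivatives of the odd theta function, which by its heat equation are
time derivatives; their sign is read off the Jacobi product factor by factor (`thetaOdd_mul_le`).

Converse. For large t the kernel minus its mean is governed by the first eigenfunctions. Take a
reduced obtuse basis u, v. If it is neither orthogonal nor at angle 2π/3 with equal lengths, the
leading term is 2 cos(2πy) + 2c cos(2πx) in coordinates xu + yv, with c equal to 0 or 1. The face of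
the Voronoi cell bisecting v contains points with y > 1/2, where cos(2πy) is already increasing
again; near the midpoint of the face this gain is linear in x while the loss from the second cosine
is quadratic (`not_leading_decreasing`). -/

/-! ### Series of damped plane waves -/

section TrigSeries

variable {ι E F : Type} [NormedAddCommGroup E] [NormedSpace ℝ E]
  [NormedAddCommGroup F] [NormedSpace ℝ F]

/-- The series `∑ i, exp (-λ i τ) cos (ω i z + θ i) c i` of damped plane waves. -/
noncomputable def trigSeries (lam : ι → ℝ) (om : ι → E →L[ℝ] ℝ) (c : ι → F) (th : ι → ℝ)
    (q : ℝ × E) : F :=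
  ∑' i, (Real.exp (-(lam i * q.1)) * Real.cos (om i q.2 + th i)) • c i

/-- The growth conditions under which a series of damped plane waves is smooth. -/
structure Damped (lam : ι → ℝ) (om : ι → E →L[ℝ] ℝ) (c : ι → F) : Prop where
  nonneg : ∀ i, 0 ≤ lam i
  norm_le : ∀ i, ‖om i‖ ≤ 1 + lam i
  summable : ∀ δ : ℝ, 0 < δ → Summable fun i => Real.exp (-(lam i * δ)) * ‖c i‖

lemma one_add_le_mul_exp {x δ : ℝ} (hδ : 0 < δ) : 1 + x ≤ (1 + δ⁻¹) * Real.exp (x * δ) ∨ x < 0 := by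
  by_cases hx : 0 ≤ x
  · left
    have h1 := Real.add_one_le_exp (x * δ)
    have h2 : 1 ≤ Real.exp (x * δ) := Real.one_le_exp (by positivity)
    have h3 : x = δ⁻¹ * (x * δ) := by field_simp
    have h4 : δ⁻¹ * (x * δ) ≤ δ⁻¹ * Real.exp (x * δ) :=
      mul_le_mul_of_nonneg_left (by linarith) (by positivity)
    nlinarith
  · right; linarith

variable {lam : ι → ℝ} {om : ι → E →L[ℝ] ℝ} {c : ι → F} {th : ι → ℝ}

/-- Half of the exponential damping absorbs the factor 1 + λ. A time derivative or a space
derivative costs at most such a factor, so differentiated series stay damped. -/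
lemma Damped.of_norm_le {G : Type} [NormedAddCommGroup G] {c' : ι → G}
    (h : Damped lam om c) {M : ℝ} (hc : ∀ i, ‖c' i‖ ≤ M * (1 + lam i) * ‖c i‖) :
    Damped lam om c' where
  nonneg := h.nonneg
  norm_le := h.norm_le
  summable δ hδ := by
    have hM : ∀ i, ‖c' i‖ ≤ |M| * (1 + lam i) * ‖c i‖ := fun i => by
      refine (hc i).trans ?_
      have := h.nonneg i
      gcongr
      exact le_abs_self M
    refine Summable.of_nonneg_of_le (fun i => by positivity) (fun i => ?_)
      ((h.summable (δ / 2) (by positivity)).mul_left (|M| * (1 + (δ / 2)⁻¹)))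
    have h0 := h.nonneg i
    have h1 : 1 + lam i ≤ (1 + (δ / 2)⁻¹) * Real.exp (lam i * (δ / 2)) :=
      (one_add_le_mul_exp (by positivity)).resolve_right (by linarith)
    have h2 : Real.exp (-(lam i * δ)) * Real.exp (lam i * (δ / 2))
        = Real.exp (-(lam i * (δ / 2))) := by
      rw [← Real.exp_add]; congr 1; ring
    calc Real.exp (-(lam i * δ)) * ‖c' i‖
        ≤ Real.exp (-(lam i * δ)) * (|M| * (1 + lam i) * ‖c i‖) := by gcongr; exact hM i
      _ ≤ Real.exp (-(lam i * δ)) *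
          (|M| * ((1 + (δ / 2)⁻¹) * Real.exp (lam i * (δ / 2))) * ‖c i‖) := by gcongr
      _ = |M| * (1 + (δ / 2)⁻¹) *
          ((Real.exp (-(lam i * δ)) * Real.exp (lam i * (δ / 2))) * ‖c i‖) := by ring
      _ = _ := by rw [h2]

lemma Damped.norm_term_le (h : Damped lam om c) {δ τ : ℝ} (hτ : δ ≤ τ) (z : E) (i : ι) :
    ‖(Real.exp (-(lam i * τ)) * Real.cos (om i z + th i)) • c i‖
      ≤ Real.exp (-(lam i * δ)) * ‖c i‖ := by
  rw [norm_smul, norm_mul, Real.norm_eq_abs, Real.norm_eq_abs, Real.abs_exp]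
  have h0 := h.nonneg i
  have h1 := Real.abs_cos_le_one (om i z + th i)
  have h2 : Real.exp (-(lam i * τ)) ≤ Real.exp (-(lam i * δ)) := by
    apply Real.exp_le_exp.2; nlinarith
  calc _ ≤ Real.exp (-(lam i * δ)) * 1 * ‖c i‖ := by gcongr
    _ = _ := by ring

variable [CompleteSpace F]

lemma Damped.summable_term (h : Damped lam om c) {τ : ℝ} (hτ : 0 < τ) (z : E) :
    Summable fun i => (Real.exp (-(lam i * τ)) * Real.cos (om i z + th i)) • c i :=
  Summable.of_norm_bounded (h.summable τ hτ) fun i => h.norm_term_le le_rfl z i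

/-- The coefficients of the derivative of `trigSeries`, first group. -/
noncomputable def timeCoeff (E : Type) [NormedAddCommGroup E] [NormedSpace ℝ E]
    (lam : ι → ℝ) (c : ι → F) (i : ι) : ℝ × E →L[ℝ] F :=
  (ContinuousLinearMap.fst ℝ ℝ E).smulRight (-(lam i) • c i)

/-- The coefficients of the derivative of `trigSeries`, second group. -/
noncomputable def spaceCoeff (om : ι → E →L[ℝ] ℝ) (c : ι → F) (i : ι) : ℝ × E →L[ℝ] F :=
  ((om i).comp (ContinuousLinearMap.snd ℝ ℝ E)).smulRight (c i)

lemma Damped.damped_timeCoeff (h : Damped lam om c) : Damped lam om (timeCoeff E lam c) := by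
  refine h.of_norm_le (M := 1) fun i => ?_
  have h0 := h.nonneg i
  rw [timeCoeff, ContinuousLinearMap.norm_smulRight_apply, norm_smul, norm_neg,
    Real.norm_of_nonneg h0, one_mul]
  have h1 := ContinuousLinearMap.norm_fst_le ℝ ℝ E
  calc _ ≤ 1 * (lam i * ‖c i‖) := by gcongr
    _ ≤ _ := by nlinarith [norm_nonneg (c i)]

lemma Damped.damped_spaceCoeff (h : Damped lam om c) : Damped lam om (spaceCoeff om c) := by
  refine h.of_norm_le (M := 1) fun i => ?_
  have h0 := h.norm_le i
  rw [spaceCoeff, ContinuousLinearMap.norm_smulRight_apply, one_mul]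
  gcongr
  refine (ContinuousLinearMap.opNorm_comp_le _ _).trans ?_
  have h1 := ContinuousLinearMap.norm_snd_le ℝ ℝ E
  nlinarith [norm_nonneg (om i), h.nonneg i]

/-- The phases are there for this: differentiating a cosine shifts its phase by π/2, so both parts
of the derivative are again series of the same type, with coefficients in a space of linear maps. -/
theorem Damped.hasFDerivAt (h : Damped lam om c) {q : ℝ × E} (hq : 0 < q.1) :
    HasFDerivAt (trigSeries lam om c th)
      (trigSeries lam om (timeCoeff E lam c) th q +
        trigSeries lam om (spaceCoeff om c) (fun i => th i + π / 2) q) q := by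
  -- Domination of the differentiated terms is uniform only for times bounded away from 0.
  set δ := q.1 / 2 with hδ
  have hδ0 : 0 < δ := by positivity
  have hs : IsOpen (Ioi δ ×ˢ (univ : Set E)) := isOpen_Ioi.prod isOpen_univ
  have hp : IsPreconnected (Ioi δ ×ˢ (univ : Set E)) := isPreconnected_Ioi.prod isPreconnected_univ
  have hqs : q ∈ Ioi δ ×ˢ (univ : Set E) := ⟨by simp only [hδ, mem_Ioi]; linarith, mem_univ _⟩
  have key := hasFDerivAt_tsum_of_isPreconnected
    (f := fun i (q : ℝ × E) => (Real.exp (-(lam i * q.1)) * Real.cos (om i q.2 + th i)) • c i)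
    (f' := fun i (q : ℝ × E) =>
      (Real.exp (-(lam i * q.1)) * Real.cos (om i q.2 + th i)) • timeCoeff E lam c i +
      (Real.exp (-(lam i * q.1)) * Real.cos (om i q.2 + (th i + π / 2))) • spaceCoeff om c i)
    ((h.damped_timeCoeff.summable δ hδ0).add (h.damped_spaceCoeff.summable δ hδ0)) hs hp ?_ ?_ hqs
    (h.summable_term hq q.2) hqs
  · refine key.congr_fderiv ?_
    exact (h.damped_timeCoeff.summable_term hq q.2).tsum_add (h.damped_spaceCoeff.summable_term hq q.2)
  · intro i x _
    have h1 : HasFDerivAt (fun q : ℝ × E => Real.exp (-(lam i * q.1)))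
        (Real.exp (-(lam i * x.1)) • (-(lam i • ContinuousLinearMap.fst ℝ ℝ E))) x :=
      ((hasFDerivAt_fst.const_mul (lam i)).neg).exp
    have h2 : HasFDerivAt (fun q : ℝ × E => Real.cos (om i q.2 + th i))
        (-Real.sin (om i x.2 + th i) • ((om i).comp (ContinuousLinearMap.snd ℝ ℝ E))) x :=
      (((om i).hasFDerivAt.comp x hasFDerivAt_snd).add_const (th i)).cos
    refine ((h1.mul h2).smul_const (c i)).congr_fderiv ?_
    rw [show om i x.2 + (th i + π / 2) = (om i x.2 + th i) + π / 2 by ring, Real.cos_add_pi_div_two]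
    ext v <;> simp [timeCoeff, spaceCoeff, smul_smul] <;> congr 1 <;> ring
  · intro i x hx
    have hx1 : δ ≤ x.1 := le_of_lt hx.1
    exact (norm_add_le _ _).trans (add_le_add
      (h.damped_timeCoeff.norm_term_le (th := th) hx1 x.2 i)
      (h.damped_spaceCoeff.norm_term_le (th := fun i => th i + π / 2) hx1 x.2 i))

theorem Damped.contDiffOn (n : ℕ) {F : Type} [NormedAddCommGroup F] [NormedSpace ℝ F]
    [CompleteSpace F] {c : ι → F} {th : ι → ℝ} (h : Damped lam om c) :
    ContDiffOn ℝ n (trigSeries lam om c th) (Ioi 0 ×ˢ univ) := by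
  -- The derivative takes values in another space and carries other phases, so both must vary in the
  -- induction.
  induction n generalizing F th with
  | zero =>
    refine contDiffOn_zero.2 fun q hq => ?_
    exact (h.hasFDerivAt hq.1).continuousAt.continuousWithinAt
  | succ n ih =>
    have hO : IsOpen (Ioi (0 : ℝ) ×ˢ (univ : Set E)) := isOpen_Ioi.prod isOpen_univ
    push_cast
    refine (contDiffOn_succ_iff_fderiv_of_isOpen hO).2
      ⟨fun q hq => (h.hasFDerivAt hq.1).differentiableAt.differentiableWithinAt, by simp, ?_⟩
    refine ((ih h.damped_timeCoeff (th := th)).add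
      (ih h.damped_spaceCoeff (th := fun i => th i + π / 2))).congr fun q hq => ?_
    exact (h.hasFDerivAt hq.1).fderiv

/-- The derivative of a damped series in time. -/
theorem Damped.hasDerivAt_time {c : ι → ℝ} (h : Damped lam om c) {t : ℝ} (ht : 0 < t) (z : E) :
    HasDerivAt (fun τ => trigSeries lam om c th (τ, z))
      (trigSeries lam om (fun i => -lam i * c i) th (t, z)) t := by
  have h1 : HasDerivAt (fun τ : ℝ => ((τ, z) : ℝ × E)) ((1 : ℝ), (0 : E)) t :=
    (hasDerivAt_id t).prodMk (hasDerivAt_const t z)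
  have h2 := (h.hasFDerivAt (th := th) (q := (t, z)) ht).comp_hasDerivAt t h1
  refine h2.congr_deriv ?_
  have e1 := (ContinuousLinearMap.apply ℝ ℝ ((1 : ℝ), (0 : E))).map_tsum
    (h.damped_timeCoeff.summable_term (th := th) ht z)
  have e2 := (ContinuousLinearMap.apply ℝ ℝ ((1 : ℝ), (0 : E))).map_tsum
    (h.damped_spaceCoeff.summable_term (th := fun i => th i + π / 2) ht z)
  simp only [ContinuousLinearMap.apply_apply] at e1 e2
  rw [add_apply]
  simp only [trigSeries]
  rw [e1, e2]
  simp [timeCoeff, spaceCoeff]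

/-- The derivative of a damped series in a direction of space. -/
theorem Damped.hasDerivAt_space {c : ι → ℝ} (h : Damped lam om c) {t : ℝ} (ht : 0 < t)
    {γ : ℝ → E} {w : E} {s : ℝ} (hγ : HasDerivAt γ w s) :
    HasDerivAt (fun x => trigSeries lam om c th (t, γ x))
      (trigSeries lam om (fun i => om i w * c i) (fun i => th i + π / 2) (t, γ s)) s := by
  have h1 : HasDerivAt (fun x : ℝ => ((t, γ x) : ℝ × E)) ((0 : ℝ), w) s :=
    (hasDerivAt_const s t).prodMk hγ
  have h2 := (h.hasFDerivAt (th := th) (q := (t, γ s)) ht).comp_hasDerivAt s h1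
  refine h2.congr_deriv ?_
  have e1 := (ContinuousLinearMap.apply ℝ ℝ ((0 : ℝ), w)).map_tsum
    (h.damped_timeCoeff.summable_term (th := th) ht (γ s))
  have e2 := (ContinuousLinearMap.apply ℝ ℝ ((0 : ℝ), w)).map_tsum
    (h.damped_spaceCoeff.summable_term (th := fun i => th i + π / 2) ht (γ s))
  simp only [ContinuousLinearMap.apply_apply] at e1 e2
  rw [add_apply]
  simp only [trigSeries]
  rw [e1, e2]
  simp [timeCoeff, spaceCoeff]

lemma Damped.space {c : ι → ℝ} (h : Damped lam om c) (w : E) :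
    Damped lam om fun i => om i w * c i := by
  refine h.of_norm_le (M := ‖w‖) fun i => ?_
  rw [norm_mul]
  have := h.norm_le i
  have h2 := (om i).le_opNorm w
  gcongr
  nlinarith [norm_nonneg w]

end TrigSeries

/-! ### The Jacobi triple product -/

section QBinomial

variable {K : Type} [Field K]

/-- The `q`-Pochhammer symbol `(1 - p) (1 - p ^ 2) ⋯ (1 - p ^ n)`. -/
def qPoch (p : K) (n : ℕ) : K := ∏ i ∈ Finset.range n, (1 - p ^ (i + 1))

lemma qPoch_succ (p : K) (n : ℕ) : qPoch p (n + 1) = qPoch p n * (1 - p ^ (n + 1)) :=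
  Finset.prod_range_succ _ _

/-- The Gaussian binomial coefficient. -/
def qBinom (p : K) (n j : ℕ) : K := qPoch p n / (qPoch p j * qPoch p (n - j))

lemma qBinom_zero {p : K} (hp : ∀ n, qPoch p n ≠ 0) (n : ℕ) : qBinom p n 0 = 1 := by
  have h0 : qPoch p 0 = 1 := by simp [qPoch]
  rw [qBinom, Nat.sub_zero, h0, one_mul, div_self (hp n)]

lemma qBinom_self {p : K} (hp : ∀ n, qPoch p n ≠ 0) (n : ℕ) : qBinom p n n = 1 := by
  have h0 : qPoch p 0 = 1 := by simp [qPoch]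
  rw [qBinom, Nat.sub_self, h0, mul_one, div_self (hp n)]

lemma qBinom_pascal {p : K} (hp : ∀ n, qPoch p n ≠ 0) {n i : ℕ} (h : i + 1 ≤ n) :
    qBinom p (n + 1) (i + 1) = qBinom p n (i + 1) + p ^ (n - i) * qBinom p n i := by
  obtain ⟨r, rfl⟩ := Nat.exists_eq_add_of_le h
  have e1 : i + 1 + r + 1 - (i + 1) = r + 1 := by omega
  have e2 : i + 1 + r - (i + 1) = r := by omega
  have e3 : i + 1 + r - i = r + 1 := by omega
  simp only [qBinom, e1, e2, e3]
  have h1 := hp (i + 1)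
  have h2 := hp (r + 1)
  have h3 := hp i
  have h4 := hp r
  rw [qPoch_succ p (i + 1 + r)]
  rw [qPoch_succ] at h1 h2 ⊢
  rw [qPoch_succ p r]
  have h5 := right_ne_zero_of_mul h1
  have h6 := right_ne_zero_of_mul h2
  field_simp
  ring

/-- The `q`-binomial theorem. -/
theorem prod_one_add_mul_pow {q : K} (hp : ∀ n, qPoch (q ^ 2) n ≠ 0) (x : K) (n : ℕ) :
    ∏ k ∈ Finset.range n, (1 + x * q ^ (2 * k)) =
      ∑ j ∈ Finset.range (n + 1), q ^ (j * (j - 1)) * qBinom (q ^ 2) n j * x ^ j := by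
  induction n with
  | zero => simp [qBinom_zero hp]
  | succ n ih =>
    rw [Finset.prod_range_succ, ih, mul_add, mul_one, Finset.sum_mul]
    rw [Finset.sum_range_succ' (n := n), Finset.sum_range_succ
      (f := fun j => q ^ (j * (j - 1)) * qBinom (q ^ 2) n j * x ^ j * (x * q ^ (2 * n))),
      Finset.sum_range_succ' (n := n + 1), Finset.sum_range_succ (n := n)]
    rw [qBinom_zero hp, qBinom_zero hp, qBinom_self hp, qBinom_self hp]
    have key : ∀ i ∈ Finset.range n,
        q ^ ((i + 1) * (i + 1 - 1)) * qBinom (q ^ 2) (n + 1) (i + 1) * x ^ (i + 1) =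
        q ^ ((i + 1) * (i + 1 - 1)) * qBinom (q ^ 2) n (i + 1) * x ^ (i + 1) +
        q ^ (i * (i - 1)) * qBinom (q ^ 2) n i * x ^ i * (x * q ^ (2 * n)) := by
      intro i hi
      have hi' := Finset.mem_range.1 hi
      rw [qBinom_pascal hp (by omega)]
      have : q ^ ((i + 1) * (i + 1 - 1)) * (q ^ 2) ^ (n - i) = q ^ (i * (i - 1)) * q ^ (2 * n) := by
        rw [← pow_mul, ← pow_add, ← pow_add]
        congr 1
        obtain ⟨r, rfl⟩ := Nat.exists_eq_add_of_le hi'.le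
        rw [Nat.add_sub_cancel_left, Nat.add_sub_cancel]
        cases i with
        | zero => simp
        | succ i => simp; ring
      linear_combination (qBinom (q ^ 2) n i * x ^ (i + 1)) * this
    rw [Finset.sum_congr rfl key, Finset.sum_add_distrib]
    have : q ^ ((n + 1) * (n + 1 - 1)) = q ^ (n * (n - 1)) * q ^ (2 * n) := by
      rw [← pow_add]
      congr 1
      cases n with
      | zero => simp
      | succ n => simp; ring
    rw [this]
    ring

/-- The finite form of the Jacobi triple product. -/
theorem prod_jacobi {q z : K} (hp : ∀ n, qPoch (q ^ 2) n ≠ 0) (hq : q ≠ 0) (hz : z ≠ 0) (N : ℕ) :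
    ∏ k ∈ Finset.range N, ((1 + q ^ (2 * k + 1) * z) * (1 + q ^ (2 * k + 1) * z⁻¹)) =
      ∑ j ∈ Finset.range (2 * N + 1),
        q ^ (((j : ℤ) - N) ^ 2) * qBinom (q ^ 2) (2 * N) j * z ^ ((j : ℤ) - N) := by
  -- This choice makes the 2N exponents of q the odd numbers from 1 - 2N to 2N - 1. The N factors
  -- with negative exponent are inverted into factors in z⁻¹ at the price of a monomial.
  have h := prod_one_add_mul_pow hp (z * q ^ (1 - 2 * N : ℤ)) (2 * N)
  have h1 : ∏ k ∈ Finset.range (2 * N), (1 + z * q ^ (1 - 2 * N : ℤ) * q ^ (2 * k)) =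
      (z ^ N * q ^ (-(N : ℤ) ^ 2)) *
      ∏ k ∈ Finset.range N, ((1 + q ^ (2 * k + 1) * z) * (1 + q ^ (2 * k + 1) * z⁻¹)) := by
    rw [two_mul, Finset.prod_range_add, ← Finset.prod_range_reflect, Finset.prod_mul_distrib]
    have e1 : ∀ k ∈ Finset.range N,
        1 + z * q ^ (1 - 2 * N : ℤ) * q ^ (2 * (N - 1 - k)) =
        (z * q ^ (-(2 * k + 1 : ℤ))) * (1 + q ^ (2 * k + 1) * z⁻¹) := by
      intro k hk
      have hk' := Finset.mem_range.1 hk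
      have : (q ^ (1 - 2 * N : ℤ) * q ^ (2 * (N - 1 - k)) : K) = q ^ (-(2 * k + 1 : ℤ)) := by
        rw [← zpow_natCast, ← zpow_add₀ hq]
        congr 1
        have : ((N - 1 - k : ℕ) : ℤ) = N - 1 - k := by omega
        push_cast [this]
        ring
      have h3 : (q ^ (-(2 * k + 1 : ℤ)) * q ^ (2 * k + 1) : K) = 1 := by
        rw [← zpow_natCast, ← zpow_add₀ hq]
        simp
      rw [mul_assoc, this, mul_add, mul_one]
      rw [show z * q ^ (-(2 * k + 1 : ℤ)) * (q ^ (2 * k + 1) * z⁻¹) =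
        (z * z⁻¹) * (q ^ (-(2 * k + 1 : ℤ)) * q ^ (2 * k + 1)) by ring, h3, mul_inv_cancel₀ hz]
      ring
    have e2 : ∀ k ∈ Finset.range N,
        1 + z * q ^ (1 - 2 * N : ℤ) * q ^ (2 * (N + k)) = 1 + q ^ (2 * k + 1) * z := by
      intro k _
      have : (q ^ (1 - 2 * N : ℤ) * q ^ (2 * (N + k)) : K) = q ^ (2 * k + 1) := by
        rw [← zpow_natCast, ← zpow_add₀ hq, ← zpow_natCast]
        congr 1
        push_cast
        ring
      rw [mul_assoc, this]
      ring
    have e3 : ∏ k ∈ Finset.range N, (z * q ^ (-(2 * k + 1 : ℤ))) = z ^ N * q ^ (-(N : ℤ) ^ 2) := by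
      rw [Finset.prod_mul_distrib, Finset.prod_const, Finset.card_range]
      congr 1
      induction N with
      | zero => simp
      | succ N ih =>
        rw [Finset.prod_range_succ, Finset.prod_congr rfl fun _ _ => rfl]
        have : ∏ x ∈ Finset.range N, (q ^ (-(2 * x + 1 : ℤ)) : K) = q ^ (-(N : ℤ) ^ 2) := by
          clear ih e1 e2 h
          induction N with
          | zero => simp
          | succ N ih =>
            rw [Finset.prod_range_succ, ih, ← zpow_add₀ hq]
            congr 1; push_cast; ring
        rw [this, ← zpow_add₀ hq]
        congr 1; push_cast; ring
    rw [Finset.prod_congr rfl e1, Finset.prod_congr rfl e2, Finset.prod_mul_distrib, e3]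
    ring
  rw [h1] at h
  have hne : z ^ N * q ^ (-(N : ℤ) ^ 2) ≠ 0 := mul_ne_zero (pow_ne_zero _ hz) (zpow_ne_zero _ hq)
  apply mul_left_cancel₀ hne
  rw [h, Finset.mul_sum]
  refine Finset.sum_congr rfl fun j _ => ?_
  have e1 : (z ^ N * z ^ ((j : ℤ) - N) : K) = z ^ j := by
    rw [← zpow_natCast, ← zpow_add₀ hz, ← zpow_natCast]
    congr 1; ring
  have e2 : (q ^ (-(N : ℤ) ^ 2) * q ^ (((j : ℤ) - N) ^ 2) : K) =
      q ^ (j * (j - 1)) * (q ^ (1 - 2 * N : ℤ)) ^ j := by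
    rw [← zpow_add₀ hq, ← zpow_natCast, ← zpow_natCast, ← zpow_mul, ← zpow_add₀ hq]
    congr 1
    cases j with
    | zero => simp
    | succ j => push_cast [Nat.add_sub_cancel]; ring
  rw [mul_pow]
  linear_combination (-(q ^ (j * (j - 1)) * (q ^ (1 - 2 * N : ℤ)) ^ j) * qBinom (q ^ 2) (2 * N) j) * e1
    - (qBinom (q ^ 2) (2 * N) j * z ^ N * z ^ ((j : ℤ) - N)) * e2

end QBinomial

/-! ### Infinite products and the limit form of the triple product. -/

lemma qPoch_pos {p : ℝ} (h0 : 0 < p) (h1 : p < 1) (n : ℕ) : 0 < qPoch p n :=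
  Finset.prod_pos fun i _ => sub_pos.2 (pow_lt_one₀ h0.le h1 (by omega))

lemma exp_neg_div_one_sub_le {x : ℝ} (hx : x < 1) : Real.exp (-(x / (1 - x))) ≤ 1 - x := by
  have h1 : 0 < 1 - x := by linarith
  have h2 := Real.add_one_le_exp (x / (1 - x))
  have h3 : x / (1 - x) + 1 = (1 - x)⁻¹ := by field_simp; ring
  rw [Real.exp_neg]
  rw [h3] at h2
  exact inv_le_of_inv_le₀ h1 h2

/-- By `exp_neg_div_one_sub_le` the product dominates the exponential of minus a convergent
geometric series. -/
lemma exists_qPoch_lower_bound {p : ℝ} (h0 : 0 < p) (h1 : p < 1) :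
    ∃ c : ℝ, 0 < c ∧ ∀ n, c ≤ qPoch p n := by
  refine ⟨Real.exp (-(∑' i : ℕ, p ^ (i + 1) / (1 - p))), Real.exp_pos _, fun n => ?_⟩
  have hs : Summable fun i : ℕ => p ^ (i + 1) / (1 - p) :=
    (((summable_geometric_of_lt_one h0.le h1).mul_left p).div_const (1 - p)).congr
      fun i => by rw [pow_succ, mul_comm]
  have hp : 0 < 1 - p := by linarith
  have h2 : ∑ i ∈ Finset.range n, p ^ (i + 1) / (1 - p) ≤ ∑' i : ℕ, p ^ (i + 1) / (1 - p) :=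
    hs.sum_le_tsum _ fun i _ => by positivity
  refine (Real.exp_le_exp.2 (neg_le_neg h2)).trans ?_
  rw [← Finset.sum_neg_distrib, Real.exp_sum, qPoch]
  refine Finset.prod_le_prod (fun i _ => (Real.exp_pos _).le) fun i _ => ?_
  have h3 : p ^ (i + 1) ≤ p := by
    rw [pow_succ]
    exact mul_le_of_le_one_left h0.le (pow_le_one₀ h0.le h1.le)
  refine le_trans (Real.exp_le_exp.2 (neg_le_neg ?_)) (exp_neg_div_one_sub_le (h3.trans_lt h1))
  have := pow_pos h0 (i + 1)
  gcongr

lemma exists_tendsto_qPoch {p : ℝ} (h0 : 0 < p) (h1 : p < 1) :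
    ∃ c : ℝ, 0 < c ∧ (∀ n, c ≤ qPoch p n) ∧ Tendsto (qPoch p) atTop (𝓝 c) := by
  obtain ⟨c, hc, hcn⟩ := exists_qPoch_lower_bound h0 h1
  have ha : Antitone (qPoch p) := antitone_nat_of_succ_le fun n => by
    rw [qPoch_succ]
    have := qPoch_pos h0 h1 n
    have := pow_pos h0 (n + 1)
    nlinarith
  have hb : BddBelow (range (qPoch p)) := ⟨c, by rintro _ ⟨n, rfl⟩; exact hcn n⟩
  have hle : c ≤ ⨅ n, qPoch p n := le_ciInf hcn
  exact ⟨_, hc.trans_le hle, fun n => ciInf_le hb n, tendsto_atTop_ciInf ha hb⟩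

lemma qPoch_le_one {p : ℝ} (h0 : 0 < p) (h1 : p < 1) (n : ℕ) : qPoch p n ≤ 1 :=
  Finset.prod_le_one (fun i _ => (sub_pos.2 (pow_lt_one₀ h0.le h1 (by omega))).le)
    fun i _ => by have := pow_pos h0 (i + 1); linarith

lemma ofReal_qPoch (p : ℝ) (n : ℕ) : ((qPoch p n : ℝ) : ℂ) = qPoch (p : ℂ) n := by
  simp [qPoch]

/-- **Jacobi triple product**, as a limit of finite products, up to a positive constant. -/
theorem exists_tendsto_prod_jacobi {q : ℝ} (h0 : 0 < q) (h1 : q < 1) :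
    ∃ C : ℝ, 0 < C ∧ ∀ z : ℂ, z ≠ 0 → (Summable fun m : ℤ => q ^ (m ^ 2) * ‖z‖ ^ m) →
      Tendsto (fun N : ℕ => ∏ k ∈ Finset.range N,
        ((1 + (q : ℂ) ^ (2 * k + 1) * z) * (1 + (q : ℂ) ^ (2 * k + 1) * z⁻¹))) atTop
        (𝓝 (C * ∑' m : ℤ, (q : ℂ) ^ (m ^ 2) * z ^ m)) := by
  have hp0 : 0 < q ^ 2 := by positivity
  have hp1 : q ^ 2 < 1 := pow_lt_one₀ h0.le h1 (by norm_num)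
  obtain ⟨c, hc, hcn, hlim⟩ := exists_tendsto_qPoch hp0 hp1
  refine ⟨c⁻¹, inv_pos.2 hc, fun z hz hs => ?_⟩
  have hpc : ∀ n, qPoch ((q : ℂ) ^ 2) n ≠ 0 := fun n => by
    rw [← Complex.ofReal_pow, ← ofReal_qPoch]
    exact_mod_cast (qPoch_pos hp0 hp1 n).ne'
  have hqc : (q : ℂ) ≠ 0 := by exact_mod_cast h0.ne'
  -- Extending the finite sums by zero to all of ℤ prepares for dominated convergence. The Gaussian
  -- binomials tend to c / (c * c) and are bounded by c⁻², because every `qPoch` lies between c and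
  -- 1.
  set f : ℕ → ℤ → ℂ := fun N m => if m ∈ Finset.Icc (-N : ℤ) N then
    (q : ℂ) ^ (m ^ 2) * qBinom ((q : ℂ) ^ 2) (2 * N) (m + N).toNat * z ^ m else 0 with hf
  have hprod : ∀ N : ℕ, ∏ k ∈ Finset.range N,
      ((1 + (q : ℂ) ^ (2 * k + 1) * z) * (1 + (q : ℂ) ^ (2 * k + 1) * z⁻¹)) = ∑' m, f N m := by
    intro N
    rw [prod_jacobi hpc hqc hz, tsum_eq_sum (s := Finset.Icc (-N : ℤ) N)
      (fun m hm => by simp only [hf, if_neg hm])]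
    refine Finset.sum_nbij' (fun j => (j : ℤ) - N) (fun m => (m + N).toNat) ?_ ?_ ?_ ?_ ?_
    · intro j hj
      simp only [Finset.mem_range, Finset.mem_Icc] at *
      omega
    · intro j hj
      simp only [Finset.mem_range, Finset.mem_Icc] at *
      omega
    · intro j hj
      simp
    · intro j hj
      simp only [Finset.mem_Icc] at *
      omega
    · intro j hj
      have : (j : ℤ) - N ∈ Finset.Icc (-N : ℤ) N := by
        simp only [Finset.mem_range, Finset.mem_Icc] at *
        omega
      simp only [hf, if_pos this]
      congr 3
      omega
  simp only [hprod]
  rw [← tsum_mul_left]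
  refine tendsto_tsum_of_dominated_convergence
    (bound := fun m : ℤ => (c⁻¹) ^ 2 * (q ^ (m ^ 2) * ‖z‖ ^ m)) (hs.mul_left _) ?_ ?_
  · intro m
    have hev : ∀ᶠ N : ℕ in atTop, f N m = (q : ℂ) ^ (m ^ 2) *
        ((qPoch (q ^ 2) (2 * N) / (qPoch (q ^ 2) (m + N).toNat * qPoch (q ^ 2) (N - m).toNat) : ℝ) : ℂ)
          * z ^ m := by
      filter_upwards [eventually_ge_atTop m.natAbs] with N hN
      have : m ∈ Finset.Icc (-N : ℤ) N := by
        simp only [Finset.mem_Icc]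
        omega
      simp only [hf, if_pos this, qBinom]
      rw [show 2 * N - (m + N).toNat = (N - m).toNat by omega]
      push_cast [ofReal_qPoch]
      rfl
    rw [tendsto_congr' hev]
    have e : ((c⁻¹ : ℝ) : ℂ) * ((q : ℂ) ^ (m ^ 2) * z ^ m) =
        (q : ℂ) ^ (m ^ 2) * ((c / (c * c) : ℝ) : ℂ) * z ^ m := by
      have : (c / (c * c) : ℝ) = c⁻¹ := by field_simp
      rw [this]
      ring
    rw [e]
    refine Tendsto.mul_const _ (Tendsto.const_mul _ ?_)
    refine (Complex.continuous_ofReal.tendsto _).comp ?_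
    have t1 : Tendsto (fun N : ℕ => 2 * N) atTop atTop := tendsto_id.const_mul_atTop' (by norm_num)
    have t2 : Tendsto (fun N : ℕ => (m + N : ℤ).toNat) atTop atTop := by
      refine tendsto_atTop.2 fun b => ?_
      filter_upwards [eventually_ge_atTop (b + m.natAbs)] with N hN
      omega
    have t3 : Tendsto (fun N : ℕ => (N - m : ℤ).toNat) atTop atTop := by
      refine tendsto_atTop.2 fun b => ?_
      filter_upwards [eventually_ge_atTop (b + m.natAbs)] with N hN
      omega
    exact (hlim.comp t1).div ((hlim.comp t2).mul (hlim.comp t3)) (by positivity)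
  · refine Eventually.of_forall fun N m => ?_
    by_cases hm : m ∈ Finset.Icc (-N : ℤ) N
    · simp only [hf, if_pos hm]
      rw [norm_mul, norm_mul, norm_zpow, norm_zpow, Complex.norm_real, Real.norm_of_nonneg h0.le]
      have hb : ‖qBinom ((q : ℂ) ^ 2) (2 * N) (m + N).toNat‖ ≤ (c⁻¹) ^ 2 := by
        rw [qBinom, ← Complex.ofReal_pow, ← ofReal_qPoch, ← ofReal_qPoch, ← ofReal_qPoch,
          ← Complex.ofReal_mul, ← Complex.ofReal_div, Complex.norm_real]
        have p1 := qPoch_pos hp0 hp1 (2 * N)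
        have p2 := hcn (m + N).toNat
        have p3 := hcn (2 * N - (m + N).toNat)
        have p4 := qPoch_le_one hp0 hp1 (2 * N)
        have p5 : 0 < qPoch (q ^ 2) (m + N).toNat := hc.trans_le p2
        have p6 : 0 < qPoch (q ^ 2) (2 * N - (m + N).toNat) := hc.trans_le p3
        rw [Real.norm_of_nonneg (by positivity)]
        calc _ ≤ 1 / (c * c) := by gcongr
          _ = _ := by field_simp
      have : 0 ≤ q ^ (m ^ 2) := by positivity
      calc _ ≤ q ^ (m ^ 2) * (c⁻¹) ^ 2 * ‖z‖ ^ m := by gcongr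
        _ = _ := by ring
    · simp only [hf, if_neg hm, norm_zero]
      positivity

/-! ### One-dimensional theta functions -/

lemma summable_exp_quadratic {τ : ℝ} (hτ : 0 < τ) (w : ℝ) :
    Summable fun m : ℤ => Real.exp (-(τ * m ^ 2) + w * m) := by
  -- Both arguments are purely imaginary, so the Jacobi terms are exactly the real exponentials
  -- wanted.
  have h := (summable_jacobiTheta₂_term_iff (w / (2 * π * Complex.I)) (τ / π * Complex.I)).2
    (by rw [← Complex.ofReal_div, Complex.im_ofReal_mul, Complex.I_im]; positivity)
  refine (h.norm).congr fun m => ?_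
  rw [jacobiTheta₂_term]
  have hπ : (π : ℂ) ≠ 0 := by exact_mod_cast Real.pi_ne_zero
  rw [show 2 * (π : ℂ) * Complex.I * m * (w / (2 * π * Complex.I)) +
    π * Complex.I * m ^ 2 * (τ / π * Complex.I) = ((-(τ * m ^ 2) + w * m : ℝ) : ℂ) by
      push_cast
      field_simp
      rw [Complex.I_sq]; ring]
  rw [Complex.norm_exp, Complex.ofReal_re]

/-- Multiplication by `r` as a linear form on `ℝ`. -/
noncomputable def mulForm (r : ℝ) : ℝ →L[ℝ] ℝ := r • ContinuousLinearMap.id ℝ ℝ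

@[simp] lemma mulForm_apply (r x : ℝ) : mulForm r x = r * x := by simp [mulForm]

lemma norm_mulForm_le (r : ℝ) : ‖mulForm r‖ ≤ 1 + r ^ 2 := by
  refine ContinuousLinearMap.opNorm_le_bound _ (by positivity) fun x => ?_
  rw [mulForm_apply, norm_mul]
  gcongr
  rw [Real.norm_eq_abs]
  nlinarith [sq_abs r, abs_nonneg r]

/-- The even theta function `∑ exp (-τ m²) cos (m y)`. -/
noncomputable def thetaEven (τ y : ℝ) : ℝ :=
  trigSeries (fun m : ℤ => (m : ℝ) ^ 2) (fun m => mulForm m) (fun _ => (1 : ℝ)) (fun _ => 0) (τ, y)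

/-- The odd theta function `∑ (-1) ^ m exp (-τ (m + 1/2)²) sin ((m + 1/2) s)`. -/
noncomputable def thetaOdd (τ s : ℝ) : ℝ :=
  trigSeries (fun m : ℤ => ((m : ℝ) + 1 / 2) ^ 2) (fun m => mulForm (m + 1 / 2))
    (fun m => (-1 : ℝ) ^ m) (fun _ => -(π / 2)) (τ, s)

lemma damped_thetaEven :
    Damped (fun m : ℤ => (m : ℝ) ^ 2) (fun m => mulForm m) (fun _ => (1 : ℝ)) where
  nonneg _ := sq_nonneg _
  norm_le _ := norm_mulForm_le _
  summable δ hδ := (summable_exp_quadratic hδ 0).congr fun m => by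
    simp [mul_comm]

lemma damped_thetaOdd :
    Damped (fun m : ℤ => ((m : ℝ) + 1 / 2) ^ 2) (fun m => mulForm (m + 1 / 2))
      (fun m => (-1 : ℝ) ^ m) where
  nonneg _ := sq_nonneg _
  norm_le _ := norm_mulForm_le _
  summable δ hδ := ((summable_exp_quadratic hδ (-δ)).mul_left (Real.exp (-(δ / 4)))).congr
    fun m => by
      rw [norm_zpow, norm_neg, norm_one, one_zpow, mul_one, ← Real.exp_add]
      congr 1; ring

lemma thetaEven_eq (τ y : ℝ) :
    thetaEven τ y = ∑' m : ℤ, Real.exp (-(τ * m ^ 2)) * Real.cos (m * y) := by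
  rw [thetaEven, trigSeries]
  exact tsum_congr fun m => by simp [mul_comm]

lemma thetaOdd_eq (τ s : ℝ) : thetaOdd τ s =
    ∑' m : ℤ, (-1 : ℝ) ^ m * Real.exp (-(τ * (m + 1 / 2) ^ 2)) * Real.sin ((m + 1 / 2) * s) := by
  rw [thetaOdd, trigSeries]
  refine tsum_congr fun m => ?_
  rw [mulForm_apply, ← sub_eq_add_neg, Real.cos_sub_pi_div_two, smul_eq_mul, mul_comm τ]
  ring

lemma summable_thetaEven {τ : ℝ} (hτ : 0 < τ) (y : ℝ) :
    Summable fun m : ℤ => Real.exp (-(τ * m ^ 2)) * Real.cos (m * y) :=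
  (damped_thetaEven.summable_term (th := fun _ => 0) hτ y).congr fun m => by simp [mul_comm]

lemma exp_neg_zpow (τ : ℝ) (m : ℤ) : Real.exp (-τ) ^ m = Real.exp (-(τ * m)) := by
  rw [← Real.rpow_intCast, ← Real.exp_mul]; congr 1; ring

/-- The triple product at z = exp(iy), conjugate factors being paired. The constant need not be
identified, since only signs and ratios of theta values are used later. -/
theorem exists_tendsto_thetaEven {τ : ℝ} (hτ : 0 < τ) : ∃ C : ℝ, 0 < C ∧ ∀ y : ℝ,
    Tendsto (fun N : ℕ => ∏ k ∈ Finset.range N,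
      (1 + 2 * Real.exp (-τ) ^ (2 * k + 1) * Real.cos y + (Real.exp (-τ) ^ (2 * k + 1)) ^ 2))
      atTop (𝓝 (C * thetaEven τ y)) := by
  set q := Real.exp (-τ) with hq
  obtain ⟨C, hC, h⟩ := exists_tendsto_prod_jacobi (Real.exp_pos (-τ))
    (by simpa using hτ)
  rw [← hq] at h
  refine ⟨C, hC, fun y => ?_⟩
  set z := Complex.exp (y * Complex.I) with hz
  have hz1 : ‖z‖ = 1 := Complex.norm_exp_ofReal_mul_I y
  have hqm : ∀ m : ℤ, q ^ (m ^ 2) = Real.exp (-(τ * m ^ 2)) := fun m => by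
    rw [hq, exp_neg_zpow]; push_cast; rfl
  have hsum : Summable fun m : ℤ => q ^ (m ^ 2) * ‖z‖ ^ m :=
    (summable_exp_quadratic hτ 0).congr fun m => by rw [hz1, hqm]; simp
  have hlim := (Complex.continuous_re.tendsto _).comp (h z (Complex.exp_ne_zero _) hsum)
  have hS : Summable fun m : ℤ => (q : ℂ) ^ (m ^ 2) * z ^ m := by
    refine Summable.of_norm (hsum.congr fun m => ?_)
    rw [norm_mul, norm_zpow, norm_zpow, Complex.norm_real, Real.norm_of_nonneg (Real.exp_pos _).le]
  have e1 : (C * ∑' m : ℤ, (q : ℂ) ^ (m ^ 2) * z ^ m : ℂ).re = C * thetaEven τ y := by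
    rw [Complex.re_ofReal_mul, Complex.re_tsum hS, thetaEven_eq]
    congr 1
    refine tsum_congr fun m => ?_
    rw [← hqm, ← Complex.ofReal_zpow, Complex.re_ofReal_mul, hz, ← Complex.exp_int_mul,
      show (m : ℂ) * (y * Complex.I) = ((m * y : ℝ) : ℂ) * Complex.I by push_cast; ring,
      Complex.exp_ofReal_mul_I_re]
  rw [← e1]
  refine hlim.congr fun N => ?_
  have e2 : ∀ k : ℕ, (1 + (q : ℂ) ^ (2 * k + 1) * z) * (1 + (q : ℂ) ^ (2 * k + 1) * z⁻¹) =
      ((1 + 2 * q ^ (2 * k + 1) * Real.cos y + (q ^ (2 * k + 1)) ^ 2 : ℝ) : ℂ) := by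
    intro k
    have h1 : z * z⁻¹ = 1 := mul_inv_cancel₀ (Complex.exp_ne_zero _)
    have h2 : z + z⁻¹ = 2 * Complex.cos y := by
      rw [Complex.two_cos, hz, ← Complex.exp_neg, neg_mul]
    push_cast
    linear_combination (q : ℂ) ^ (2 * k + 1) * h2 + ((q : ℂ) ^ (2 * k + 1)) ^ 2 * h1
  simp only [Function.comp_apply, e2]
  rw [← Complex.ofReal_prod, Complex.ofReal_re]

/-- The triple product at z = -q exp(is): multiplying by exp(is/2) turns m² + m into (m + 1/2)² -
1/4, whence the factor exp(τ/4) in the constant. -/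
theorem exists_tendsto_thetaOdd {τ : ℝ} (hτ : 0 < τ) : ∃ C : ℝ, 0 < C ∧ ∀ s : ℝ,
    Tendsto (fun N : ℕ => Real.sin (s / 2) * ∏ k ∈ Finset.range N,
      (1 - 2 * Real.exp (-τ) ^ (2 * (k + 1)) * Real.cos s + (Real.exp (-τ) ^ (2 * (k + 1))) ^ 2))
      atTop (𝓝 (C * thetaOdd τ s)) := by
  set q := Real.exp (-τ) with hq
  have hq0 : 0 < q := Real.exp_pos _
  have hq1 : q < 1 := by simpa [hq] using hτ
  obtain ⟨C, hC, h⟩ := exists_tendsto_prod_jacobi hq0 hq1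
  refine ⟨C * (Real.exp (τ / 4) / 2), by positivity, fun s => ?_⟩
  set e := Complex.exp (s * Complex.I) with he
  set z := -(q : ℂ) * e with hz
  have he0 : e ≠ 0 := Complex.exp_ne_zero _
  have he1 : ‖e‖ = 1 := Complex.norm_exp_ofReal_mul_I s
  have hqc : (q : ℂ) ≠ 0 := by exact_mod_cast hq0.ne'
  have hz0 : z ≠ 0 := mul_ne_zero (neg_ne_zero.2 hqc) he0
  have hz1 : ‖z‖ = q := by
    rw [hz, norm_mul, norm_neg, he1, mul_one, Complex.norm_real, Real.norm_of_nonneg hq0.le]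
  have hqm : ∀ m : ℤ, q ^ (m ^ 2) = Real.exp (-(τ * m ^ 2)) := fun m => by
    rw [hq, exp_neg_zpow]; push_cast; rfl
  have hqm' : ∀ m : ℤ, q ^ m = Real.exp (-(τ * m)) := fun m => by rw [hq, exp_neg_zpow]
  have hsum : Summable fun m : ℤ => q ^ (m ^ 2) * ‖z‖ ^ m :=
    (summable_exp_quadratic hτ (-τ)).congr fun m => by
      rw [hz1, hqm, hqm', ← Real.exp_add]; congr 1; ring
  -- With N + 1 factors the products in z and z⁻¹ are offset by one. Two factors remain unpaired: 1
  -- - e⁻¹, which produces sin(s/2), and 1 - q^(2N+2) e, which tends to 1 and is divided out through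
  -- `hden`.
  have hlim := (h z hz0 hsum).comp (tendsto_add_atTop_nat 1)
  have hS : Summable fun m : ℤ => (q : ℂ) ^ (m ^ 2) * z ^ m := by
    refine Summable.of_norm (hsum.congr fun m => ?_)
    rw [norm_mul ((q : ℂ) ^ (m ^ 2)), norm_zpow, norm_zpow, Complex.norm_real,
      Real.norm_of_nonneg hq0.le]
  set g := Complex.exp ((s / 2 : ℝ) * Complex.I) with hg
  have hgg : g * g = e := by
    rw [hg, ← Complex.exp_add, he]; congr 1; push_cast; ring
  have hsin : g - g⁻¹ = 2 * Complex.I * Complex.sin (s / 2 : ℝ) := by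
    have := Complex.two_sin ((s / 2 : ℝ) : ℂ)
    rw [hg, ← Complex.exp_neg, show 2 * Complex.I * Complex.sin (s / 2 : ℝ) =
      Complex.I * (2 * Complex.sin (s / 2 : ℝ)) by ring, this, ← neg_mul]
    linear_combination (Complex.exp (((s / 2 : ℝ) : ℂ) * Complex.I) -
      Complex.exp (-((s / 2 : ℝ) : ℂ) * Complex.I)) * Complex.I_sq
  have hden : Tendsto (fun N : ℕ => 2 * Complex.I * (1 - (q : ℂ) ^ (2 * N + 2) * e)) atTop
      (𝓝 (2 * Complex.I)) := by
    have t1 : Tendsto (fun n : ℕ => (q : ℂ) ^ n) atTop (𝓝 0) :=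
      tendsto_pow_atTop_nhds_zero_of_norm_lt_one (by
        rw [Complex.norm_real, Real.norm_of_nonneg hq0.le]; exact hq1)
    have t2 : Tendsto (fun N : ℕ => 2 * N + 2) atTop atTop :=
      tendsto_atTop_mono (fun N => by simp only [id]; omega) tendsto_id
    have := ((t1.comp t2).mul_const e).const_sub 1 |>.const_mul (2 * Complex.I)
    simpa using this
  have hne : ∀ N : ℕ, (1 - (q : ℂ) ^ (2 * N + 2) * e) ≠ 0 := fun N h0 => by
    have h1 : ‖(q : ℂ) ^ (2 * N + 2) * e‖ < 1 := by
      rw [norm_mul, he1, mul_one, norm_pow, Complex.norm_real, Real.norm_of_nonneg hq0.le]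
      exact pow_lt_one₀ hq0.le hq1 (by omega)
    rw [← sub_eq_zero.1 h0] at h1
    simp at h1
  have hlim2 := (Complex.continuous_re.tendsto _).comp
    ((hlim.const_mul g).div hden (by simp))
  have e1 : (g * (C * ∑' m : ℤ, (q : ℂ) ^ (m ^ 2) * z ^ m) / (2 * Complex.I) : ℂ).re =
      C * (Real.exp (τ / 4) / 2) * thetaOdd τ s := by
    rw [thetaOdd_eq, show (g * (C * ∑' m : ℤ, (q : ℂ) ^ (m ^ 2) * z ^ m) / (2 * Complex.I) : ℂ) =
      C * ((g / (2 * Complex.I)) * ∑' m : ℤ, (q : ℂ) ^ (m ^ 2) * z ^ m) by ring,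
      Complex.re_ofReal_mul, ← tsum_mul_left, Complex.re_tsum (hS.mul_left _), mul_assoc C]
    rw [← tsum_mul_left (a := Real.exp (τ / 4) / 2)]
    refine congrArg (fun x : ℝ => C * x) (tsum_congr fun m => ?_)
    have e3 : g / (2 * Complex.I) * ((q : ℂ) ^ (m ^ 2) * z ^ m) =
        ((((-1 : ℝ) ^ m * q ^ (m ^ 2) * q ^ m / 2 : ℝ)) : ℂ) *
          (-Complex.I * Complex.exp (((m + 1 / 2) * s : ℝ) * Complex.I)) := by
      have : Complex.exp (((m + 1 / 2) * s : ℝ) * Complex.I) = g * e ^ m := by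
        rw [hg, he, ← Complex.exp_int_mul, ← Complex.exp_add]
        congr 1; push_cast; ring
      rw [this, hz, mul_zpow, show -(q : ℂ) = (-1) * q by ring, mul_zpow]
      push_cast
      rw [div_eq_mul_inv, mul_inv, Complex.inv_I]
      ring
    rw [e3, Complex.re_ofReal_mul, Complex.exp_mul_I]
    simp only [← Complex.ofReal_cos, ← Complex.ofReal_sin]
    simp only [Complex.mul_re, Complex.neg_re, Complex.neg_im, Complex.I_re, Complex.I_im,
      Complex.add_re, Complex.add_im, Complex.ofReal_re, Complex.ofReal_im, Complex.mul_im]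
    rw [hqm, hqm', show Real.exp (-(τ * (m + 1 / 2) ^ 2)) =
      Real.exp (-(τ * m ^ 2)) * Real.exp (-(τ * m)) * (Real.exp (τ / 4))⁻¹ by
        rw [← Real.exp_neg, ← Real.exp_add, ← Real.exp_add]; congr 1; ring]
    have := (Real.exp_pos (τ / 4)).ne'
    field_simp
    ring
  rw [← e1]
  refine hlim2.congr fun N => ?_
  have e2 : ∀ k : ℕ, (1 - (q : ℂ) ^ (2 * k + 2) * e) * (1 - (q : ℂ) ^ (2 * k + 2) * e⁻¹) =
      ((1 - 2 * q ^ (2 * (k + 1)) * Real.cos s + (q ^ (2 * (k + 1))) ^ 2 : ℝ) : ℂ) := by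
    intro k
    have h1 : e * e⁻¹ = 1 := mul_inv_cancel₀ he0
    have h2 : e + e⁻¹ = 2 * Complex.cos s := by
      rw [Complex.two_cos, he, ← Complex.exp_neg, neg_mul]
    push_cast
    linear_combination -(q : ℂ) ^ (2 * k + 2) * h2 + ((q : ℂ) ^ (2 * k + 2)) ^ 2 * h1
  have e4 : ∏ k ∈ Finset.range (N + 1),
      ((1 + (q : ℂ) ^ (2 * k + 1) * z) * (1 + (q : ℂ) ^ (2 * k + 1) * z⁻¹)) =
      (1 - e⁻¹) * (1 - (q : ℂ) ^ (2 * N + 2) * e) *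
      ((∏ k ∈ Finset.range N,
        (1 - 2 * q ^ (2 * (k + 1)) * Real.cos s + (q ^ (2 * (k + 1))) ^ 2) : ℝ) : ℂ) := by
    have a1 : ∀ k : ℕ, 1 + (q : ℂ) ^ (2 * k + 1) * z = 1 - (q : ℂ) ^ (2 * k + 2) * e := fun k => by
      rw [hz]; ring
    have a2 : ∀ k : ℕ, 1 + (q : ℂ) ^ (2 * k + 1) * z⁻¹ = 1 - (q : ℂ) ^ (2 * k) * e⁻¹ := fun k => by
      rw [hz, mul_inv, inv_neg, pow_succ]
      have : (q : ℂ) * (q : ℂ)⁻¹ = 1 := mul_inv_cancel₀ hqc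
      linear_combination (-(q : ℂ) ^ (2 * k) * e⁻¹) * this
    simp only [a1, a2]
    rw [Finset.prod_mul_distrib, Finset.prod_range_succ, Finset.prod_range_succ',
      Complex.ofReal_prod]
    simp only [← e2]
    rw [Finset.prod_mul_distrib]
    simp only [mul_add, mul_one, mul_zero, pow_zero, one_mul]
    ring
  have e5 : g * (1 - e⁻¹) = 2 * Complex.I * Complex.sin (s / 2 : ℝ) := by
    rw [← hsin, ← hgg]
    have : g * g⁻¹ = 1 := mul_inv_cancel₀ (Complex.exp_ne_zero _)
    rw [mul_inv]
    linear_combination (-g⁻¹) * this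
  have hI : (2 * Complex.I : ℂ) ≠ 0 := by simp
  have e6 : g * (∏ k ∈ Finset.range (N + 1),
      ((1 + (q : ℂ) ^ (2 * k + 1) * z) * (1 + (q : ℂ) ^ (2 * k + 1) * z⁻¹))) /
      (2 * Complex.I * (1 - (q : ℂ) ^ (2 * N + 2) * e)) =
      ((Real.sin (s / 2) * ∏ k ∈ Finset.range N,
        (1 - 2 * q ^ (2 * (k + 1)) * Real.cos s + (q ^ (2 * (k + 1))) ^ 2) : ℝ) : ℂ) := by
    rw [e4, div_eq_iff (mul_ne_zero hI (hne N)), Complex.ofReal_mul,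
      Complex.ofReal_sin, ← mul_assoc, ← mul_assoc, e5]
    ring
  exact (congrArg Complex.re e6).trans (Complex.ofReal_re _)

/-! ### Positivity and monotonicity of theta functions from their products. -/

lemma hasDerivAt_nonneg_of_right {g : ℝ → ℝ} {g' x b : ℝ} (h : HasDerivAt g g' x) (hx : g x = 0)
    (hb : x < b) (hg : ∀ y, x < y → y < b → 0 ≤ g y) : 0 ≤ g' := by
  have h1 := (hasDerivAt_iff_tendsto_slope.1 h).mono_left
    (nhdsWithin_mono x (fun y (hy : x < y) => hy.ne') : 𝓝[>] x ≤ 𝓝[≠] x)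
  refine ge_of_tendsto h1 ?_
  filter_upwards [Ioo_mem_nhdsGT hb] with y hy
  rw [slope_def_field, hx, sub_zero]
  exact div_nonneg (hg y hy.1 hy.2) (sub_nonneg.2 hy.1.le)

/-- Positive factors alone give only a nonnegative limit; comparison of each factor with (1 -
q^(k+1))² keeps the products away from 0. -/
lemma thetaEven_pos {τ : ℝ} (hτ : 0 < τ) (y : ℝ) : 0 < thetaEven τ y := by
  obtain ⟨C, hC, h⟩ := exists_tendsto_thetaEven hτ
  have hq0 : 0 < Real.exp (-τ) := Real.exp_pos _
  have hq1 : Real.exp (-τ) < 1 := by simpa using hτ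
  set q := Real.exp (-τ)
  obtain ⟨c, hc, hcn⟩ := exists_qPoch_lower_bound hq0 hq1
  have : c ^ 2 ≤ C * thetaEven τ y := by
    refine ge_of_tendsto' (h y) fun N => ?_
    calc c ^ 2 ≤ (qPoch q N) ^ 2 := by gcongr; exact hcn N
      _ = ∏ k ∈ Finset.range N, (1 - q ^ (k + 1)) ^ 2 := by rw [qPoch, Finset.prod_pow]
      _ ≤ _ := by
        refine Finset.prod_le_prod (fun k _ => sq_nonneg _) fun k _ => ?_
        have h1 : q ^ (2 * k + 1) ≤ q ^ (k + 1) := pow_le_pow_of_le_one hq0.le hq1.le (by omega)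
        have h2 : q ^ (k + 1) ≤ 1 := pow_le_one₀ hq0.le hq1.le
        have h3 := Real.neg_one_le_cos y
        have h4 : 0 < q ^ (2 * k + 1) := pow_pos hq0 _
        nlinarith
  exact pos_of_mul_pos_right ((by positivity : (0 : ℝ) < c ^ 2).trans_le this) hC.le

/-- Every factor of the product decreases on [0, π], but strict inequalities are lost in the limit.
Hence the first factor is kept aside: theta divided by it is still non-increasing, and its own
strict decrease makes the derivative of theta negative. -/
lemma thetaEven_mul_le {τ : ℝ} (hτ : 0 < τ) {y₁ y₂ : ℝ} (h0 : 0 ≤ y₁) (h12 : y₁ ≤ y₂)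
    (h2 : y₂ ≤ π) :
    thetaEven τ y₂ * (1 + 2 * Real.exp (-τ) * Real.cos y₁ + Real.exp (-τ) ^ 2) ≤
      thetaEven τ y₁ * (1 + 2 * Real.exp (-τ) * Real.cos y₂ + Real.exp (-τ) ^ 2) := by
  obtain ⟨C, hC, h⟩ := exists_tendsto_thetaEven hτ
  have hq0 : 0 < Real.exp (-τ) := Real.exp_pos _
  have hq1 : Real.exp (-τ) < 1 := by simpa using hτ
  set q := Real.exp (-τ)
  have hcos : Real.cos y₂ ≤ Real.cos y₁ := Real.cos_le_cos_of_nonneg_of_le_pi h0 h2 h12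
  have pos : ∀ x y : ℝ, 0 ≤ 1 + 2 * x * Real.cos y + x ^ 2 := fun x y => by
    nlinarith [sq_nonneg (x + Real.cos y), Real.cos_sq_le_one y]
  set f : ℕ → ℝ → ℝ := fun N y => ∏ k ∈ Finset.range N,
    (1 + 2 * q ^ (2 * (k + 1) + 1) * Real.cos y + (q ^ (2 * (k + 1) + 1)) ^ 2) with hf
  have hs : ∀ y, Tendsto (fun N => f N y * (1 + 2 * q * Real.cos y + q ^ 2)) atTop
      (𝓝 (C * thetaEven τ y)) := fun y => by
    refine ((h y).comp (tendsto_add_atTop_nat 1)).congr fun N => ?_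
    simp only [Function.comp_apply, hf]
    rw [Finset.prod_range_succ']
    simp
  have hle : ∀ N, f N y₂ ≤ f N y₁ := fun N =>
    Finset.prod_le_prod (fun k _ => pos _ _) fun k _ => by
      have := pow_pos hq0 (2 * (k + 1) + 1)
      nlinarith
  have h3 := le_of_tendsto_of_tendsto' ((hs y₂).mul_const (1 + 2 * q * Real.cos y₁ + q ^ 2))
    ((hs y₁).mul_const (1 + 2 * q * Real.cos y₂ + q ^ 2)) fun N => by
      have := mul_nonneg (pos q y₁) (pos q y₂)
      nlinarith [hle N]
  refine le_of_mul_le_mul_left ?_ hC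
  linarith

lemma hasDerivAt_thetaEven {τ : ℝ} (hτ : 0 < τ) (y : ℝ) :
    HasDerivAt (thetaEven τ) (deriv (thetaEven τ) y) y :=
  (damped_thetaEven.hasDerivAt_space (th := fun _ => 0) hτ
    (hasDerivAt_id y)).differentiableAt.hasDerivAt

lemma thetaEven_neg (τ y : ℝ) : thetaEven τ (-y) = thetaEven τ y := by
  simp only [thetaEven_eq, mul_neg, Real.cos_neg]

lemma thetaEven_add_two_pi (τ y : ℝ) : thetaEven τ (y + 2 * π) = thetaEven τ y := by
  simp only [thetaEven_eq, mul_add, Real.cos_add_int_mul_two_pi]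

lemma deriv_thetaEven_neg (τ y : ℝ) : deriv (thetaEven τ) (-y) = -deriv (thetaEven τ) y := by
  have h : (fun x => thetaEven τ (-x)) = thetaEven τ := funext fun x => thetaEven_neg τ x
  have h2 := deriv_comp_neg (thetaEven τ) y
  rw [h] at h2
  linarith

lemma deriv_thetaEven_add_two_pi (τ y : ℝ) :
    deriv (thetaEven τ) (y + 2 * π) = deriv (thetaEven τ) y := by
  rw [← deriv_comp_add_const]
  simp only [thetaEven_add_two_pi]

lemma deriv_thetaEven_lt_zero {τ : ℝ} (hτ : 0 < τ) {y : ℝ} (h0 : 0 < y) (hπ : y < π) :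
    deriv (thetaEven τ) y < 0 := by
  have hq0 : 0 < Real.exp (-τ) := Real.exp_pos _
  have hq1 : Real.exp (-τ) < 1 := by simpa using hτ
  have hm := fun z h1 h2 => thetaEven_mul_le hτ (y₁ := y) (y₂ := z) h0.le h1 h2
  set q := Real.exp (-τ)
  have hsin := Real.sin_pos_of_pos_of_lt_pi h0 hπ
  have hd : HasDerivAt (fun z => thetaEven τ y * (1 + 2 * q * Real.cos z + q ^ 2) -
      thetaEven τ z * (1 + 2 * q * Real.cos y + q ^ 2))
      (thetaEven τ y * (2 * q * (-Real.sin y)) -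
        deriv (thetaEven τ) y * (1 + 2 * q * Real.cos y + q ^ 2)) y :=
    (((((Real.hasDerivAt_cos y).const_mul (2 * q)).const_add 1).add_const (q ^ 2)).const_mul _).sub
      ((hasDerivAt_thetaEven hτ y).mul_const _)
  -- The difference vanishes at z = y and is nonnegative to its right, so the logarithmic derivative
  -- of theta is at most that of the first factor.
  have h1 := hasDerivAt_nonneg_of_right hd (by ring) hπ fun z h1 h2 => by
    linarith [hm z h1.le h2.le]
  have h2 : 0 < 1 + 2 * q * Real.cos y + q ^ 2 := by
    nlinarith [Real.neg_one_le_cos y]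
  have h3 := mul_pos (thetaEven_pos hτ y) (mul_pos hq0 hsin)
  by_contra hc
  nlinarith [mul_nonneg (not_lt.1 hc) h2.le]

lemma strictAntiOn_thetaEven {τ : ℝ} (hτ : 0 < τ) : StrictAntiOn (thetaEven τ) (Icc 0 π) := by
  refine strictAntiOn_of_deriv_neg (convex_Icc 0 π)
    (fun y _ => (hasDerivAt_thetaEven hτ y).continuousAt.continuousWithinAt) fun y hy => ?_
  rw [interior_Icc] at hy
  exact deriv_thetaEven_lt_zero hτ hy.1 hy.2

/-- In the product, the ratio of the factors at s and at d increases with the nome, that is,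
decreases with time. -/
lemma thetaOdd_mul_le {t t' : ℝ} (ht : 0 < t) (htt : t < t') {d s : ℝ} (hd : 0 ≤ d) (hds : d ≤ s)
    (hs : s ≤ π) : thetaOdd t' s * thetaOdd t d ≤ thetaOdd t s * thetaOdd t' d := by
  obtain ⟨C, hC, h⟩ := exists_tendsto_thetaOdd ht
  obtain ⟨C', hC', h'⟩ := exists_tendsto_thetaOdd (ht.trans htt)
  have hq0 : 0 < Real.exp (-t') := Real.exp_pos _
  have hq1 : Real.exp (-t) < 1 := by simpa using ht
  have hqq : Real.exp (-t') < Real.exp (-t) := by simpa using htt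
  set q := Real.exp (-t)
  set q' := Real.exp (-t')
  have hcos : Real.cos s ≤ Real.cos d := Real.cos_le_cos_of_nonneg_of_le_pi hd hs hds
  have pos : ∀ x y : ℝ, 0 ≤ 1 - 2 * x * Real.cos y + x ^ 2 := fun x y => by
    nlinarith [sq_nonneg (x - Real.cos y), Real.cos_sq_le_one y]
  have s1 : 0 ≤ Real.sin (s / 2) := Real.sin_nonneg_of_nonneg_of_le_pi (by linarith) (by linarith)
  have s2 : 0 ≤ Real.sin (d / 2) := Real.sin_nonneg_of_nonneg_of_le_pi (by linarith) (by linarith)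
  have key := le_of_tendsto_of_tendsto' ((h' s).mul (h d)) ((h s).mul (h' d)) fun N => by
    have : (∏ k ∈ Finset.range N,
        (1 - 2 * q' ^ (2 * (k + 1)) * Real.cos s + (q' ^ (2 * (k + 1))) ^ 2)) *
        (∏ k ∈ Finset.range N,
        (1 - 2 * q ^ (2 * (k + 1)) * Real.cos d + (q ^ (2 * (k + 1))) ^ 2)) ≤
        (∏ k ∈ Finset.range N,
        (1 - 2 * q ^ (2 * (k + 1)) * Real.cos s + (q ^ (2 * (k + 1))) ^ 2)) *
        (∏ k ∈ Finset.range N,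
        (1 - 2 * q' ^ (2 * (k + 1)) * Real.cos d + (q' ^ (2 * (k + 1))) ^ 2)) := by
      rw [← Finset.prod_mul_distrib, ← Finset.prod_mul_distrib]
      refine Finset.prod_le_prod (fun k _ => mul_nonneg (pos _ _) (pos _ _)) fun k _ => ?_
      set a := q ^ (2 * (k + 1))
      set b := q' ^ (2 * (k + 1))
      have hb : 0 ≤ b := by positivity
      have hab : b ≤ a := pow_le_pow_left₀ hq0.le hqq.le _
      have ha : a ≤ 1 := pow_le_one₀ (hq0.trans hqq).le hq1.le
      -- Twice this quantity is the difference of the two cross products of factors.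
      have : 0 ≤ (Real.cos d - Real.cos s) * ((a - b) * (1 - a * b)) :=
        mul_nonneg (by linarith) (mul_nonneg (by linarith) (by nlinarith))
      nlinarith
    nlinarith [mul_le_mul_of_nonneg_left this (mul_nonneg s1 s2)]
  have hCC : 0 < C * C' := mul_pos hC hC'
  refine le_of_mul_le_mul_left ?_ hCC
  linarith

lemma thetaOdd_neg (τ y : ℝ) : thetaOdd τ (-y) = -thetaOdd τ y := by
  simp only [thetaOdd_eq, mul_neg, Real.sin_neg, tsum_neg]

lemma hasDerivAt_thetaOdd {τ : ℝ} (hτ : 0 < τ) (y : ℝ) :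
    HasDerivAt (thetaOdd τ) (deriv (thetaOdd τ) y) y :=
  (damped_thetaOdd.hasDerivAt_space (th := fun _ => -(π / 2)) hτ
    (hasDerivAt_id y)).differentiableAt.hasDerivAt

/-- The heat equation for `thetaOdd`. -/
lemma exists_hasDerivAt_deriv_thetaOdd {τ : ℝ} (hτ : 0 < τ) (y : ℝ) : ∃ D : ℝ,
    HasDerivAt (deriv (thetaOdd τ)) D y ∧ HasDerivAt (fun t => thetaOdd t y) D τ := by
  have h1 : deriv (thetaOdd τ) = fun y => trigSeries (fun m : ℤ => ((m : ℝ) + 1 / 2) ^ 2)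
      (fun m => mulForm (m + 1 / 2)) (fun m => mulForm ((m : ℝ) + 1 / 2) 1 * (-1 : ℝ) ^ m)
      (fun _ => -(π / 2) + π / 2) (τ, y) := funext fun y =>
    (damped_thetaOdd.hasDerivAt_space (th := fun _ => -(π / 2)) hτ (hasDerivAt_id y)).deriv
  refine ⟨_, ?_, damped_thetaOdd.hasDerivAt_time hτ y⟩
  rw [h1]
  refine ((damped_thetaOdd.space 1).hasDerivAt_space hτ (hasDerivAt_id y)).congr_deriv ?_
  refine tsum_congr fun m => ?_
  simp only [mulForm_apply, smul_eq_mul, id]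
  rw [show ((m : ℝ) + 1 / 2) * y + (-(π / 2) + π / 2 + π / 2) =
    (((m : ℝ) + 1 / 2) * y + -(π / 2)) + π by ring, Real.cos_add_pi]
  ring

/-- By the heat equation the second space derivatives are time derivatives, so the expression is the
right derivative, at the time where it vanishes, of the difference in `thetaOdd_mul_le`. -/
lemma thetaOdd_wronskian {τ : ℝ} (hτ : 0 < τ) {d s Dd Ds : ℝ} (hd : 0 ≤ d) (hds : d ≤ s)
    (hs : s ≤ π) (h1 : HasDerivAt (deriv (thetaOdd τ)) Dd d)
    (h2 : HasDerivAt (deriv (thetaOdd τ)) Ds s) : 0 ≤ thetaOdd τ s * Dd - Ds * thetaOdd τ d := by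
  obtain ⟨D1, a1, b1⟩ := exists_hasDerivAt_deriv_thetaOdd hτ d
  obtain ⟨D2, a2, b2⟩ := exists_hasDerivAt_deriv_thetaOdd hτ s
  rw [h1.unique a1, h2.unique a2]
  refine hasDerivAt_nonneg_of_right ((b1.const_mul (thetaOdd τ s)).sub
    (b2.mul_const (thetaOdd τ d))) (by simp) (lt_add_one τ) fun t ht _ => ?_
  have := thetaOdd_mul_le hτ ht hd hds hs
  simp only [Pi.sub_apply]
  linarith

/-! ### The quadratic theta identity and its differentiated form. -/

lemma cos_mul_add_pi (n : ℤ) (y : ℝ) : Real.cos (n * (y + π)) = (-1 : ℝ) ^ n * Real.cos (n * y) := by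
  rw [mul_add, Real.cos_add_int_mul_pi]

lemma neg_one_zpow_add_one_add (j k : ℤ) : (-1 : ℝ) ^ (j + k + 1) = -((-1) ^ j * (-1) ^ k) := by
  rw [zpow_add₀ (by norm_num), zpow_add₀ (by norm_num), zpow_one]; ring

lemma neg_one_zpow_sub (j k : ℤ) : (-1 : ℝ) ^ (j - k) = (-1) ^ j * (-1) ^ k := by
  rw [zpow_sub₀ (by norm_num)]
  rcases Int.even_or_odd k with h | h
  · rw [h.neg_one_zpow]; ring
  · rw [h.neg_one_zpow]; ring

lemma tsum_eq_tsum_symmetrized {α : Type} {g : α → ℝ} (hg : Summable g) (σ : α ≃ α) :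
    ∑' p, g p = ∑' p, (1 / 2 * g p + 1 / 2 * g (σ p)) := by
  have h : Summable fun p => g (σ p) := (σ.summable_iff (f := g)).2 hg
  rw [Summable.tsum_add (hg.mul_left _) (h.mul_left _), tsum_mul_left, tsum_mul_left,
    σ.tsum_eq g]
  ring

/-- A quadratic identity between theta functions. -/
theorem thetaEven_identity {τ : ℝ} (hτ : 0 < τ) (y₁ y₂ : ℝ) :
    thetaEven τ y₂ * thetaEven τ (y₁ + π) - thetaEven τ y₁ * thetaEven τ (y₂ + π) =
      2 * (thetaOdd (2 * τ) (y₁ + y₂) * thetaOdd (2 * τ) (y₁ - y₂)) := by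
  set e : ℤ → ℝ := fun n => Real.exp (-(τ * n ^ 2)) with he
  have hs : ∀ y, Summable fun m : ℤ => ‖e m * Real.cos (m * y)‖ := fun y =>
    (summable_thetaEven hτ y).norm
  have hse : Summable e := by simpa using summable_thetaEven hτ 0
  set W : ℤ × ℤ → ℝ := fun p => e p.1 * e p.2 * ((-1) ^ p.1 - (-1) ^ p.2) with hW
  set g : ℤ × ℤ → ℝ := fun p => W p * Real.cos (p.1 * y₁ + p.2 * y₂) with hg
  have hse2 : Summable fun p : ℤ × ℤ => e p.1 * e p.2 :=
    hse.mul_of_nonneg hse (fun _ => (Real.exp_pos _).le) (fun _ => (Real.exp_pos _).le)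
  have hgs : Summable g := by
    refine Summable.of_norm_bounded (hse2.mul_left 2) fun p => ?_
    simp only [hg, hW, norm_mul]
    have h1 : ‖((-1 : ℝ) ^ p.1 - (-1) ^ p.2)‖ ≤ 2 := by
      refine (norm_sub_le _ _).trans ?_
      simp; norm_num
    have h2 := Real.abs_cos_le_one (p.1 * y₁ + p.2 * y₂)
    rw [← Real.norm_eq_abs] at h2
    rw [Real.norm_of_nonneg (Real.exp_pos _).le, Real.norm_of_nonneg (Real.exp_pos _).le]
    have h3 : 0 ≤ e p.1 * e p.2 := mul_nonneg (Real.exp_pos _).le (Real.exp_pos _).le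
    calc _ ≤ e p.1 * e p.2 * 2 * 1 := by gcongr
      _ = _ := by ring
  have hT : ∀ y, thetaEven τ y = ∑' m : ℤ, e m * Real.cos (m * y) := thetaEven_eq τ
  have hL : thetaEven τ y₂ * thetaEven τ (y₁ + π) - thetaEven τ y₁ * thetaEven τ (y₂ + π) =
      ∑' p, g p := by
    have hm : ∀ a b, thetaEven τ a * thetaEven τ b =
        ∑' p : ℤ × ℤ, (e p.1 * Real.cos (p.1 * a)) * (e p.2 * Real.cos (p.2 * b)) := fun a b => by
      rw [hT, hT, tsum_mul_tsum_of_summable_norm (hs a) (hs b)]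
    have hms : ∀ a b, Summable fun p : ℤ × ℤ =>
        (e p.1 * Real.cos (p.1 * a)) * (e p.2 * Real.cos (p.2 * b)) := fun a b =>
      summable_mul_of_summable_norm (hs a) (hs b)
    rw [mul_comm (thetaEven τ y₂), hm, hm, ← Summable.tsum_sub (hms _ _) (hms _ _)]
    -- Averaging over the sign of the second index turns the cosine of a sum into a product of
    -- cosines.
    set σ : ℤ × ℤ ≃ ℤ × ℤ := Equiv.prodCongr (Equiv.refl ℤ) (Equiv.neg ℤ) with hσ
    rw [tsum_eq_tsum_symmetrized hgs σ]
    refine tsum_congr fun p => ?_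
    have hσ1 : σ p = (p.1, -p.2) := rfl
    rw [cos_mul_add_pi, cos_mul_add_pi, hσ1]
    simp only [hg, hW, he]
    have h2 : (-1 : ℝ) ^ (-p.2) = (-1) ^ p.2 := by
      rw [zpow_neg]
      rcases Int.even_or_odd p.2 with h | h <;> rw [h.neg_one_zpow] <;> norm_num
    rw [h2]
    push_cast
    rw [neg_mul, ← sub_eq_add_neg, Real.cos_add, Real.cos_sub, neg_sq]
    ring
  -- The weight W is supported on pairs of opposite parity, which φ parametrises. The exponents
  -- match because (j + k + 1)² + (j - k)² = 2(j + 1/2)² + 2(k + 1/2)², which is why the right side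
  -- has time 2τ.
  set φ : ℤ × ℤ → ℤ × ℤ := fun p => (p.1 + p.2 + 1, p.1 - p.2) with hφ
  have hφi : Function.Injective φ := by
    rintro ⟨a, b⟩ ⟨c, d⟩ h
    simp only [hφ, Prod.mk.injEq] at h ⊢
    omega
  have hW0 : ∀ p, p ∉ range φ → W p = 0 := by
    rintro ⟨n, m⟩ hp
    have : Even (n - m) := by
      by_contra hodd
      rw [Int.not_even_iff_odd] at hodd
      obtain ⟨k, hk⟩ := hodd
      exact hp ⟨(m + k, k), by simp only [hφ, Prod.mk.injEq]; omega⟩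
    have h1 := this.neg_one_zpow (α := ℝ)
    rw [neg_one_zpow_sub] at h1
    simp only [hW]
    rcases Int.even_or_odd n with h | h <;> rcases Int.even_or_odd m with h' | h' <;>
      rw [h.neg_one_zpow, h'.neg_one_zpow] at h1 ⊢ <;> first | (norm_num at h1; done) | norm_num
  have hR : 2 * (thetaOdd (2 * τ) (y₁ + y₂) * thetaOdd (2 * τ) (y₁ - y₂)) = ∑' p, g p := by
    have h2τ : 0 < 2 * τ := by positivity
    have hso : ∀ s, Summable fun m : ℤ =>
        ‖(-1 : ℝ) ^ m * Real.exp (-(2 * τ * (m + 1 / 2) ^ 2)) * Real.sin ((m + 1 / 2) * s)‖ :=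
      fun s => ((damped_thetaOdd.summable_term (th := fun _ => -(π / 2)) h2τ s).congr fun m => by
        rw [mulForm_apply, ← sub_eq_add_neg, Real.cos_sub_pi_div_two, smul_eq_mul, mul_comm (2 * τ)]
        ring).norm
    rw [thetaOdd_eq, thetaOdd_eq, tsum_mul_tsum_of_summable_norm (hso _) (hso _), ← tsum_mul_left]
    -- W is antisymmetric, so averaging over the swap gives a difference of cosines, hence a product
    -- of sines.
    set σ : ℤ × ℤ ≃ ℤ × ℤ := Equiv.prodComm ℤ ℤ with hσ
    have e2 : ∀ p, 1 / 2 * g p + 1 / 2 * g (σ p) = 1 / 2 * W p *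
        (Real.cos (p.1 * y₁ + p.2 * y₂) - Real.cos (p.2 * y₁ + p.1 * y₂)) := fun p => by
      have hσ1 : σ p = (p.2, p.1) := rfl
      simp only [hg, hW, hσ1]
      ring
    rw [tsum_eq_tsum_symmetrized hgs σ]
    simp only [e2]
    refine Eq.trans ?_ (hφi.tsum_eq (f := fun p => 1 / 2 * W p *
      (Real.cos (p.1 * y₁ + p.2 * y₂) - Real.cos (p.2 * y₁ + p.1 * y₂))) ?_)
    · refine tsum_congr fun p => ?_
      simp only [hφ, hW, he]
      rw [neg_one_zpow_add_one_add, neg_one_zpow_sub]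
      have c1 : Real.exp (-(2 * τ * ((p.1 : ℝ) + 1 / 2) ^ 2)) *
          Real.exp (-(2 * τ * ((p.2 : ℝ) + 1 / 2) ^ 2)) =
          Real.exp (-(τ * ((p.1 + p.2 + 1 : ℤ) : ℝ) ^ 2)) *
          Real.exp (-(τ * ((p.1 - p.2 : ℤ) : ℝ) ^ 2)) := by
        rw [← Real.exp_add, ← Real.exp_add]
        congr 1; push_cast; ring
      have c2 : Real.cos (((p.1 + p.2 + 1 : ℤ) : ℝ) * y₁ + ((p.1 - p.2 : ℤ) : ℝ) * y₂) -
          Real.cos (((p.1 - p.2 : ℤ) : ℝ) * y₁ + ((p.1 + p.2 + 1 : ℤ) : ℝ) * y₂) =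
          -2 * (Real.sin (((p.1 : ℝ) + 1 / 2) * (y₁ + y₂)) *
            Real.sin (((p.2 : ℝ) + 1 / 2) * (y₁ - y₂))) := by
        rw [Real.cos_sub_cos]
        push_cast
        rw [mul_assoc]
        congr 3 <;> ring
      rw [c2, ← c1]
      ring
    · intro p hp
      by_contra h
      exact hp (by simp [hW0 p h])
  rw [hL, hR]

/-- A monotonicity property of the logarithmic derivative of `thetaEven`. -/
theorem deriv_thetaEven_mul_le {τ : ℝ} (hτ : 0 < τ) {y₁ y₂ : ℝ} (h1 : 0 ≤ y₁) (h12 : y₁ ≤ y₂)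
    (h2 : y₁ + y₂ ≤ π) :
    deriv (thetaEven τ) y₁ * deriv (thetaEven τ) (y₂ + π) ≤
      deriv (thetaEven τ) y₂ * deriv (thetaEven τ) (y₁ + π) := by
  have h2τ : 0 < 2 * τ := by positivity
  -- The identity is differentiated in the first variable here and in the second one in `k2`; the
  -- products of first derivatives cancel and a Wronskian-type expression remains.
  have k1 : ∀ b a, thetaEven τ b * deriv (thetaEven τ) (a + π) -
      deriv (thetaEven τ) a * thetaEven τ (b + π) =
      2 * (deriv (thetaOdd (2 * τ)) (a + b) * thetaOdd (2 * τ) (a - b) +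
        thetaOdd (2 * τ) (a + b) * deriv (thetaOdd (2 * τ)) (a - b)) := fun b a => by
    have d1 := (((hasDerivAt_thetaEven hτ (a + π)).comp_add_const a π).const_mul
      (thetaEven τ b)).sub ((hasDerivAt_thetaEven hτ a).mul_const (thetaEven τ (b + π)))
    have d2 := (((hasDerivAt_thetaOdd h2τ (a + b)).comp_add_const a b).mul
      ((hasDerivAt_thetaOdd h2τ (a - b)).comp_sub_const a b)).const_mul 2
    refine d1.unique (d2.congr_of_eventuallyEq (Eventually.of_forall fun x => ?_))
    exact thetaEven_identity hτ x b
  obtain ⟨D1, a1, -⟩ := exists_hasDerivAt_deriv_thetaOdd h2τ (y₁ + y₂)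
  obtain ⟨D2, a2, -⟩ := exists_hasDerivAt_deriv_thetaOdd h2τ (y₁ - y₂)
  have k2 : deriv (thetaEven τ) y₂ * deriv (thetaEven τ) (y₁ + π) -
      deriv (thetaEven τ) y₁ * deriv (thetaEven τ) (y₂ + π) =
      2 * (D1 * thetaOdd (2 * τ) (y₁ - y₂) - thetaOdd (2 * τ) (y₁ + y₂) * D2) := by
    have d1 := ((hasDerivAt_thetaEven hτ y₂).mul_const (deriv (thetaEven τ) (y₁ + π))).sub
      (((hasDerivAt_thetaEven hτ (y₂ + π)).comp_add_const y₂ π).const_mul (deriv (thetaEven τ) y₁))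
    have d2 := (((a1.comp_const_add y₁ y₂).mul
      ((hasDerivAt_thetaOdd h2τ (y₁ - y₂)).comp_const_sub y₁ y₂)).add
      (((hasDerivAt_thetaOdd h2τ (y₁ + y₂)).comp_const_add y₁ y₂).mul
        (a2.comp_const_sub y₁ y₂))).const_mul 2
    have d3 := d1.unique (d2.congr_of_eventuallyEq (Eventually.of_forall fun x => k1 x y₁))
    rw [d3]
    ring
  have hd' : HasDerivAt (deriv (thetaOdd (2 * τ))) (-D2) (y₂ - y₁) := by
    have hodd : ∀ x, deriv (thetaOdd (2 * τ)) (-x) = deriv (thetaOdd (2 * τ)) x := fun x => by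
      have h : (fun x => thetaOdd (2 * τ) (-x)) = fun x => -thetaOdd (2 * τ) x :=
        funext fun x => thetaOdd_neg _ x
      have h3 := deriv_comp_neg (thetaOdd (2 * τ)) x
      rw [h, deriv.fun_neg] at h3
      linarith
    have d := HasDerivAt.scomp (y₂ - y₁) (h := fun x : ℝ => -x)
      (by rw [neg_sub]; exact a2) (hasDerivAt_neg (y₂ - y₁))
    refine (d.congr_of_eventuallyEq (Eventually.of_forall fun x => ?_)).congr_deriv (by simp)
    exact (hodd x).symm
  have hw := thetaOdd_wronskian h2τ (by linarith) (by linarith) (by linarith) hd' a1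
  have hn : thetaOdd (2 * τ) (y₁ - y₂) = -thetaOdd (2 * τ) (y₂ - y₁) := by
    rw [← thetaOdd_neg, neg_sub]
  rw [hn] at k2
  nlinarith

/-! ### The hexagonal theta function -/

/-- The theta function of the hexagonal form `m² + m n + n²`. -/
noncomputable def hexTheta (τ a b : ℝ) : ℝ :=
  ∑' p : ℤ × ℤ, Real.exp (-(τ * ((p.1 : ℝ) ^ 2 + p.1 * p.2 + (p.2 : ℝ) ^ 2))) *
    Real.cos (2 * π * (p.1 * a + p.2 * b))

lemma hexTheta_swap (τ a b : ℝ) : hexTheta τ b a = hexTheta τ a b := by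
  rw [hexTheta, ← (Equiv.prodComm ℤ ℤ).tsum_eq]
  refine tsum_congr fun p => ?_
  simp only [Equiv.prodComm_apply, Prod.fst_swap, Prod.snd_swap]
  congr 2 <;> ring

lemma hexTheta_neg (τ a b : ℝ) : hexTheta τ (-a) (-b) = hexTheta τ a b := by
  refine tsum_congr fun p => ?_
  rw [← Real.cos_neg]
  congr 2; ring

/-- A reflection of the integer lattice. -/
def shearEquiv : ℤ × ℤ ≃ ℤ × ℤ where
  toFun p := (p.1 + p.2, -p.2)
  invFun p := (p.1 + p.2, -p.2)
  left_inv p := by simp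
  right_inv p := by simp

/-- The form m² + mn + n² is invariant under (m, n) ↦ (m + n, -n). Together with the swap this
reflection generates the dihedral group of order 12. -/
lemma hexTheta_shear (τ a b : ℝ) : hexTheta τ a (a - b) = hexTheta τ a b := by
  rw [hexTheta, ← shearEquiv.tsum_eq]
  refine tsum_congr fun p => ?_
  simp only [shearEquiv, Equiv.coe_fn_mk]
  push_cast
  congr 2 <;> ring

/-- The hexagonal theta function in orthogonal coordinates. -/
noncomputable def hexProd (τ x y : ℝ) : ℝ :=
  thetaEven (3 * τ / 4) x * thetaEven (τ / 4) y +
    thetaEven (3 * τ / 4) (x + π) * thetaEven (τ / 4) (y + π)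

/-- Diagonalisation: m² + mn + n² = 3/4 (m + n)² + 1/4 (m - n)². The pairs (m + n, m - n) are those
of equal parity, and the two products in `hexProd` implement the parity projector (1 + (-1)^(i -
j))/2. -/
lemma hexTheta_eq {τ : ℝ} (hτ : 0 < τ) (a b : ℝ) :
    hexTheta τ a b = 1 / 2 * hexProd τ (π * (a + b)) (π * (a - b)) := by
  set x := π * (a + b) with hx
  set y := π * (a - b) with hy
  have h3 : 0 < 3 * τ / 4 := by positivity
  have h4 : 0 < τ / 4 := by positivity
  set e : ℤ → ℝ := fun n => Real.exp (-(3 * τ / 4 * n ^ 2)) with he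
  set f : ℤ → ℝ := fun n => Real.exp (-(τ / 4 * n ^ 2)) with hf
  have hes : Summable e := by simpa using summable_thetaEven h3 0
  have hfs : Summable f := by simpa using summable_thetaEven h4 0
  have hT1 : ∀ y, thetaEven (3 * τ / 4) y = ∑' m : ℤ, e m * Real.cos (m * y) := thetaEven_eq _
  have hT2 : ∀ y, thetaEven (τ / 4) y = ∑' m : ℤ, f m * Real.cos (m * y) := thetaEven_eq _
  have hs1 : ∀ y, Summable fun m : ℤ => ‖e m * Real.cos (m * y)‖ := fun y =>
    (summable_thetaEven h3 y).norm
  have hs2 : ∀ y, Summable fun m : ℤ => ‖f m * Real.cos (m * y)‖ := fun y =>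
    (summable_thetaEven h4 y).norm
  have hef : Summable fun p : ℤ × ℤ => e p.1 * f p.2 :=
    hes.mul_of_nonneg hfs (fun _ => (Real.exp_pos _).le) (fun _ => (Real.exp_pos _).le)
  set W : ℤ × ℤ → ℝ := fun p => e p.1 * f p.2 * (1 / 2 * (1 + (-1) ^ (p.1 - p.2))) with hW
  set g : ℤ × ℤ → ℝ := fun p => W p * Real.cos (p.1 * x + p.2 * y) with hg
  have hgs : Summable g := by
    refine Summable.of_norm_bounded hef fun p => ?_
    simp only [hg, hW, norm_mul]
    have h1 : ‖(1 + (-1 : ℝ) ^ (p.1 - p.2))‖ ≤ 2 := by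
      refine (norm_add_le _ _).trans ?_
      simp; norm_num
    have h2 := Real.abs_cos_le_one (p.1 * x + p.2 * y)
    rw [← Real.norm_eq_abs] at h2
    rw [Real.norm_of_nonneg (Real.exp_pos _).le, Real.norm_of_nonneg (Real.exp_pos _).le]
    have h3 : 0 ≤ e p.1 * f p.2 := mul_nonneg (Real.exp_pos _).le (Real.exp_pos _).le
    have h5 : ‖(1 / 2 : ℝ)‖ = 1 / 2 := by norm_num
    rw [h5]
    calc _ ≤ e p.1 * f p.2 * (1 / 2 * 2) * 1 := by gcongr
      _ = _ := by ring
  have hm : ∀ a b, thetaEven (3 * τ / 4) a * thetaEven (τ / 4) b =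
      ∑' p : ℤ × ℤ, (e p.1 * Real.cos (p.1 * a)) * (f p.2 * Real.cos (p.2 * b)) := fun a b => by
    rw [hT1, hT2, tsum_mul_tsum_of_summable_norm (hs1 a) (hs2 b)]
  have hms : ∀ a b, Summable fun p : ℤ × ℤ =>
      (e p.1 * Real.cos (p.1 * a)) * (f p.2 * Real.cos (p.2 * b)) := fun a b =>
    summable_mul_of_summable_norm (hs1 a) (hs2 b)
  have hL : 1 / 2 * hexProd τ x y = ∑' p, g p := by
    rw [hexProd, hm, hm, ← Summable.tsum_add (hms _ _) (hms _ _), ← tsum_mul_left]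
    set σ : ℤ × ℤ ≃ ℤ × ℤ := Equiv.prodCongr (Equiv.refl ℤ) (Equiv.neg ℤ) with hσ
    rw [tsum_eq_tsum_symmetrized hgs σ]
    refine tsum_congr fun p => ?_
    have hσ1 : σ p = (p.1, -p.2) := rfl
    rw [cos_mul_add_pi, cos_mul_add_pi, hσ1]
    simp only [hg, hW, he, hf]
    have h2 : (-1 : ℝ) ^ (-p.2) = (-1) ^ p.2 := by
      rw [zpow_neg]
      rcases Int.even_or_odd p.2 with h | h <;> rw [h.neg_one_zpow] <;> norm_num
    rw [neg_one_zpow_sub, neg_one_zpow_sub, h2]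
    push_cast
    rw [neg_mul, ← sub_eq_add_neg, Real.cos_add, Real.cos_sub, neg_sq]
    ring
  set φ : ℤ × ℤ → ℤ × ℤ := fun p => (p.1 + p.2, p.1 - p.2) with hφ
  have hφi : Function.Injective φ := by
    rintro ⟨a, b⟩ ⟨c, d⟩ h
    simp only [hφ, Prod.mk.injEq] at h ⊢
    omega
  have hW0 : ∀ p, p ∉ range φ → W p = 0 := by
    rintro ⟨n, m⟩ hp
    have : Odd (n - m) := by
      by_contra hodd
      rw [Int.not_odd_iff_even] at hodd
      obtain ⟨k, hk⟩ := hodd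
      exact hp ⟨(m + k, k), by simp only [hφ, Prod.mk.injEq]; omega⟩
    simp only [hW, this.neg_one_zpow]
    norm_num
  rw [hL]
  refine Eq.trans ?_ (hφi.tsum_eq (f := g) ?_)
  · refine tsum_congr fun p => ?_
    simp only [hφ, hg, hW, he, hf]
    have hev : Even (p.1 + p.2 - (p.1 - p.2)) := ⟨p.2, by ring⟩
    rw [hev.neg_one_zpow, ← Real.exp_add]
    push_cast
    rw [show (1 / 2 * (1 + 1) : ℝ) = 1 by norm_num, mul_one]
    congr 2 <;> (try simp only [hx, hy]) <;> ring
  · intro p hp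
    by_contra h
    exact hp (by simp only [hg, hW0 p h, zero_mul])

/-- `hexTheta_shear` in orthogonal coordinates: the reflection fixes the line x = 3y, and δ measures
the displacement off it. -/
lemma hexProd_shear {τ : ℝ} (hτ : 0 < τ) (y δ : ℝ) :
    hexProd τ (3 * y + δ) (y - δ) = hexProd τ (3 * y - δ) (y + δ) := by
  have hπ := Real.pi_ne_zero
  have h := hexTheta_shear τ (2 * y / π) ((y + δ) / π)
  rw [hexTheta_eq hτ, hexTheta_eq hτ] at h
  have e1 : π * (2 * y / π + (2 * y / π - (y + δ) / π)) = 3 * y - δ := by field_simp; ring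
  have e2 : π * (2 * y / π - (2 * y / π - (y + δ) / π)) = y + δ := by field_simp; ring
  have e3 : π * (2 * y / π + (y + δ) / π) = 3 * y + δ := by field_simp; ring
  have e4 : π * (2 * y / π - (y + δ) / π) = y - δ := by field_simp; ring
  rw [e1, e2, e3, e4] at h
  linarith

/-! ### Signs of the partial derivatives on a twelfth of the hexagon. -/

section Monotone

variable {τ : ℝ}

/-- The partial derivative of `hexProd` in the first orthogonal coordinate. -/
noncomputable def hexProdX (τ x y : ℝ) : ℝ :=
  deriv (thetaEven (3 * τ / 4)) x * thetaEven (τ / 4) y +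
    deriv (thetaEven (3 * τ / 4)) (x + π) * thetaEven (τ / 4) (y + π)

/-- The partial derivative of `hexProd` in the second orthogonal coordinate. -/
noncomputable def hexProdY (τ x y : ℝ) : ℝ :=
  thetaEven (3 * τ / 4) x * deriv (thetaEven (τ / 4)) y +
    thetaEven (3 * τ / 4) (x + π) * deriv (thetaEven (τ / 4)) (y + π)

lemma hasDerivAt_hexProd (hτ : 0 < τ) {γ₁ γ₂ : ℝ → ℝ} {v₁ v₂ s : ℝ} (h₁ : HasDerivAt γ₁ v₁ s)
    (h₂ : HasDerivAt γ₂ v₂ s) : HasDerivAt (fun s => hexProd τ (γ₁ s) (γ₂ s))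
      (v₁ * hexProdX τ (γ₁ s) (γ₂ s) + v₂ * hexProdY τ (γ₁ s) (γ₂ s)) s := by
  have h3 : 0 < 3 * τ / 4 := by positivity
  have h4 : 0 < τ / 4 := by positivity
  have a1 := (hasDerivAt_thetaEven h3 (γ₁ s)).comp s h₁
  have a2 := (hasDerivAt_thetaEven h4 (γ₂ s)).comp s h₂
  have b1 := (hasDerivAt_thetaEven h3 (γ₁ s + π)).comp s (h₁.add_const π)
  have b2 := (hasDerivAt_thetaEven h4 (γ₂ s + π)).comp s (h₂.add_const π)
  refine ((a1.mul a2).add (b1.mul b2)).congr_deriv ?_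
  simp only [hexProdX, hexProdY, Function.comp_apply]
  ring

/-- On the mirror line the derivative across it, in direction (1, -1), vanishes. -/
lemma hexProdX_eq_hexProdY (hτ : 0 < τ) (y : ℝ) : hexProdX τ (3 * y) y = hexProdY τ (3 * y) y := by
  have d1 := hasDerivAt_hexProd hτ (s := 0) ((hasDerivAt_id (0 : ℝ)).const_add (3 * y))
    ((hasDerivAt_id (0 : ℝ)).const_sub y)
  have d2 := hasDerivAt_hexProd hτ (s := 0) ((hasDerivAt_id (0 : ℝ)).const_sub (3 * y))
    ((hasDerivAt_id (0 : ℝ)).const_add y)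
  have h := d1.unique (d2.congr_of_eventuallyEq
    (Eventually.of_forall fun δ => hexProd_shear hτ y δ))
  simp only [id, add_zero, sub_zero] at h
  linarith

lemma deriv_thetaEven_zero (τ : ℝ) : deriv (thetaEven τ) 0 = 0 := by
  have := deriv_thetaEven_neg τ 0
  rw [neg_zero] at this
  linarith

lemma thetaEven_add_pi (τ y : ℝ) : thetaEven τ (y + π) = thetaEven τ (π - y) := by
  rw [← thetaEven_add_two_pi τ (-(π - y)) |>.trans (thetaEven_neg τ _)]
  congr 1; ring

lemma deriv_thetaEven_add_pi (τ y : ℝ) :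
    deriv (thetaEven τ) (y + π) = -deriv (thetaEven τ) (π - y) := by
  rw [← deriv_thetaEven_neg, ← deriv_thetaEven_add_two_pi τ (-(π - y))]
  congr 1; ring

lemma deriv_thetaEven_pi (τ : ℝ) : deriv (thetaEven τ) π = 0 := by
  have := deriv_thetaEven_add_pi τ 0
  rw [zero_add, sub_zero] at this
  linarith

/-- The point (π, π/3) is a vertex of the Voronoi cell, where the mirror lines x = π and x = 3y
meet; hence it is critical. -/
lemma hexProdY_corner (hτ : 0 < τ) : hexProdY τ π (π / 3) = 0 := by
  have h := hexProdX_eq_hexProdY hτ (π / 3)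
  rw [show 3 * (π / 3) = π by ring] at h
  rw [← h, hexProdX, deriv_thetaEven_pi, deriv_thetaEven_add_pi, sub_self, deriv_thetaEven_zero]
  ring

/-- Since P decreases, the derivative is strictly below its value P(π)Q'(y) + P(0)Q'(y + π) at x =
π. That value vanishes at y = π/3, and monotonicity of Q'(y + π)/Q'(y) makes it nonpositive for
smaller y. -/
lemma hexProdY_neg (hτ : 0 < τ) {x y : ℝ} (hx0 : 0 ≤ x) (hx : x < π) (hy0 : 0 < y)
    (hy : y ≤ π / 3) : hexProdY τ x y < 0 := by
  have hπ := Real.pi_pos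
  have h3 : 0 < 3 * τ / 4 := by positivity
  have h4 : 0 < τ / 4 := by positivity
  have hc := hexProdY_corner hτ
  rw [hexProdY, thetaEven_add_pi _ π, sub_self] at hc
  have hw := deriv_thetaEven_mul_le h4 hy0.le hy (by linarith)
  have hA := deriv_thetaEven_lt_zero h4 (y := π / 3) (by positivity) (by linarith)
  have hy1 := deriv_thetaEven_lt_zero h4 hy0 (by linarith)
  have hy2 := deriv_thetaEven_lt_zero h4 (y := π - y) (by linarith) (by linarith)
  have hyp := deriv_thetaEven_add_pi (τ / 4) y
  have hP0 := thetaEven_pos h3 0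
  have hanti := strictAntiOn_thetaEven h3
  have hP1 := hanti (a := x) (b := π) ⟨hx0, hx.le⟩ ⟨hπ.le, le_rfl⟩ hx
  have hP2 := hanti.antitoneOn (a := 0) (b := π - x) ⟨le_rfl, hπ.le⟩
    ⟨by linarith, by linarith⟩ (by linarith)
  rw [hexProdY, thetaEven_add_pi _ x]
  set Q := deriv (thetaEven (τ / 4))
  set P := thetaEven (3 * τ / 4)
  have key : P π * Q y + P 0 * Q (y + π) ≤ 0 := by
    have : 0 ≤ Q (π / 3) * (P π * Q y + P 0 * Q (y + π)) := by
      have h1 : Q (π / 3) * (P π * Q y + P 0 * Q (y + π)) =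
          P 0 * (Q (π / 3) * Q (y + π) - Q y * Q (π / 3 + π)) := by
        linear_combination (Q y) * hc
      rw [h1]
      exact mul_nonneg hP0.le (by linarith)
    by_contra hcon
    nlinarith [mul_pos (not_le.1 hcon) (neg_pos.2 hA)]
  have k1 : P x * Q y < P π * Q y := mul_lt_mul_of_neg_right hP1 hy1
  have k2 : P (π - x) * Q (y + π) ≤ P 0 * Q (y + π) :=
    mul_le_mul_of_nonneg_right hP2 (by linarith)
  linarith

/-- On y = x/3 this is `hexProdY_neg` through the mirror line. Lowering y raises Q(y) and lowers Q(y
+ π), and both changes push the derivative down. -/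
lemma hexProdX_neg (hτ : 0 < τ) {x y : ℝ} (hx0 : 0 < x) (hx : x < π) (hy0 : 0 ≤ y)
    (hy : y ≤ x / 3) : hexProdX τ x y < 0 := by
  have h3 : 0 < 3 * τ / 4 := by positivity
  have h4 : 0 < τ / 4 := by positivity
  have h1 := hexProdY_neg hτ (y := x / 3) hx0.le hx (by positivity) (by linarith)
  have h2 := hexProdX_eq_hexProdY hτ (x / 3)
  rw [show 3 * (x / 3) = x by ring] at h2
  rw [← h2, hexProdX] at h1
  refine lt_of_le_of_lt ?_ h1
  have hx1 := deriv_thetaEven_lt_zero h3 hx0 hx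
  have hx2 := deriv_thetaEven_lt_zero h3 (y := π - x) (by linarith) (by linarith)
  have hanti := (strictAntiOn_thetaEven h4).antitoneOn
  have q1 := hanti (a := y) (b := x / 3) ⟨hy0, by linarith⟩ ⟨by linarith, by linarith⟩ hy
  have q2 := hanti (a := π - x / 3) (b := π - y) ⟨by linarith, by linarith⟩
    ⟨by linarith, by linarith⟩ (by linarith)
  rw [hexProdX, deriv_thetaEven_add_pi, thetaEven_add_pi, thetaEven_add_pi]
  exact add_le_add (mul_le_mul_of_nonpos_left q1 hx1.le)
    (mul_le_mul_of_nonneg_left q2 (by linarith))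

lemma hexTheta_strictAntiOn_sector (hτ : 0 < τ) {a b : ℝ} (hb : 0 < b) (hba : b ≤ a)
    (hab : a ≤ 2 * b) (h1 : a + b ≤ 1) :
    StrictAntiOn (fun s => hexTheta τ (s * a) (s * b)) (Icc 0 1) := by
  have hπ := Real.pi_pos
  have hd : ∀ s, HasDerivAt (fun s => hexTheta τ (s * a) (s * b))
      (1 / 2 * (π * (a + b) * hexProdX τ (s * (π * (a + b))) (s * (π * (a - b))) +
        π * (a - b) * hexProdY τ (s * (π * (a + b))) (s * (π * (a - b))))) s := fun s => by
    have := (hasDerivAt_hexProd hτ (hasDerivAt_mul_const (x := s) (π * (a + b)))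
      (hasDerivAt_mul_const (π * (a - b)))).const_mul (1 / 2)
    refine this.congr_of_eventuallyEq (Eventually.of_forall fun s => ?_)
    simp only [hexTheta_eq hτ]
    congr 2 <;> ring
  refine strictAntiOn_of_deriv_neg (convex_Icc 0 1)
    (fun s _ => (hd s).continuousAt.continuousWithinAt) fun s hs => ?_
  rw [interior_Icc] at hs
  rw [(hd s).deriv]
  have hX : 0 < π * (a + b) := by nlinarith
  have hX1 : π * (a + b) ≤ π := by nlinarith
  have hY : 0 ≤ π * (a - b) := mul_nonneg hπ.le (by linarith)
  have hYX : π * (a - b) ≤ π * (a + b) / 3 := by nlinarith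
  set X := π * (a + b)
  set Y := π * (a - b)
  have sX : 0 < s * X := mul_pos hs.1 hX
  have sX1 : s * X < π := by nlinarith [hs.2]
  have sY : 0 ≤ s * Y := mul_nonneg hs.1.le hY
  have sYX : s * Y ≤ s * X / 3 := by nlinarith [hs.1]
  have k1 := mul_neg_of_pos_of_neg hX (hexProdX_neg hτ sX sX1 sY sYX)
  have k2 : Y * hexProdY τ (s * X) (s * Y) ≤ 0 := by
    rcases hY.eq_or_lt with h | h
    · rw [← h]; simp
    · exact (mul_neg_of_pos_of_neg h
        (hexProdY_neg hτ sX.le sX1 (mul_pos hs.1 h) (by linarith))).le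
  linarith

/-- The hexagonal theta function decreases along segments in the Voronoi cell of the hexagonal
lattice. -/
theorem hexTheta_strictAntiOn (hτ : 0 < τ) {a b : ℝ} (h0 : a ≠ 0 ∨ b ≠ 0) (h1 : |a + b| ≤ 1)
    (h2 : |2 * a - b| ≤ 1) (h3 : |2 * b - a| ≤ 1) :
    StrictAntiOn (fun s => hexTheta τ (s * a) (s * b)) (Icc 0 1) := by
  -- The cell is folded onto the sector b ≤ a ≤ 2b by the symmetries, one wall at a time; the three
  -- bounds are permuted among themselves.
  have main : ∀ a b : ℝ, (a ≠ 0 ∨ b ≠ 0) → |a + b| ≤ 1 → |2 * a - b| ≤ 1 → |2 * b - a| ≤ 1 →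
      b ≤ a → 0 ≤ b → StrictAntiOn (fun s => hexTheta τ (s * a) (s * b)) (Icc 0 1) := by
    intro a b h0 h1 h2 h3 hba hb
    have ha : 0 < a := (hb.trans hba).lt_of_ne' fun h => by
      rcases h0 with h0 | h0
      · exact h0 h
      · exact h0 (le_antisymm (hba.trans h.le) hb)
    by_cases hab : a ≤ 2 * b
    · exact hexTheta_strictAntiOn_sector hτ (by linarith) hba hab (le_of_abs_le h1)
    · have := hexTheta_strictAntiOn_sector hτ (a := a) (b := a - b) (by linarith) (by linarith)
        (by linarith) (by linarith [le_of_abs_le h2])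
      simpa only [mul_sub, hexTheta_shear] using this
  have main2 : ∀ a b : ℝ, (a ≠ 0 ∨ b ≠ 0) → |a + b| ≤ 1 → |2 * a - b| ≤ 1 → |2 * b - a| ≤ 1 →
      b ≤ a → 0 ≤ a + b → StrictAntiOn (fun s => hexTheta τ (s * a) (s * b)) (Icc 0 1) := by
    intro a b h0 h1 h2 h3 hba hab
    by_cases hb : 0 ≤ b
    · exact main a b h0 h1 h2 h3 hba hb
    · have := main (a - b) a (Or.inl (by linarith)) (by rw [abs_le] at *; constructor <;> linarith)
        (by rw [abs_le] at *; constructor <;> linarith)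
        (by rw [abs_le] at *; constructor <;> linarith) (by linarith) (by linarith)
      simp only [mul_sub] at this
      simpa only [hexTheta_swap, hexTheta_shear] using this
  have main3 : ∀ a b : ℝ, (a ≠ 0 ∨ b ≠ 0) → |a + b| ≤ 1 → |2 * a - b| ≤ 1 → |2 * b - a| ≤ 1 →
      0 ≤ a + b → StrictAntiOn (fun s => hexTheta τ (s * a) (s * b)) (Icc 0 1) := by
    intro a b h0 h1 h2 h3 hab
    rcases le_total b a with hba | hba
    · exact main2 a b h0 h1 h2 h3 hba hab
    · have := main2 b a h0.symm (by rwa [add_comm]) h3 h2 hba (by linarith)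
      refine this.congr fun s _ => hexTheta_swap _ _ _
  rcases le_total 0 (a + b) with hab | hab
  · exact main3 a b h0 h1 h2 h3 hab
  · have := main3 (-a) (-b) (by simpa using h0) (by rwa [← neg_add, abs_neg])
      (by rwa [show 2 * -a - -b = -(2 * a - b) by ring, abs_neg])
      (by rwa [show 2 * -b - -a = -(2 * b - a) by ring, abs_neg]) (by linarith)
    simpa only [mul_neg, hexTheta_neg] using this

end Monotone

/-! ### Integration of periodic functions -/

section Periodic

open scoped Pointwise

variable (Λ : Submodule ℤ Plane)

/-- Functions on the plane that are invariant under translations by the lattice. -/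
def LatticePeriodic (g : Plane → ℝ) : Prop := ∀ p, ∀ l ∈ Λ, g (p + l) = g p

lemma continuous_torusProj : Continuous (torusProj Λ) := continuous_quot_mk

variable {Λ}

lemma torusProj_surjective (x : FlatTorus Λ) : ∃ p, torusProj Λ p = x := Quotient.exists_rep x

lemma torusProj_eq_iff {p q : Plane} : torusProj Λ p = torusProj Λ q ↔ q - p ∈ Λ := by
  rw [torusProj, torusProj, QuotientAddGroup.eq, neg_add_eq_sub]
  exact Iff.rfl

lemma torusProj_add {p l : Plane} (hl : l ∈ Λ) : torusProj Λ (p + l) = torusProj Λ p := by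
  rw [eq_comm, torusProj_eq_iff, add_sub_cancel_left]
  exact hl

lemma LatticePeriodic.comp_torusProj (f : FlatTorus Λ → ℝ) :
    LatticePeriodic Λ fun p => f (torusProj Λ p) := fun _ _ hl => congrArg f (torusProj_add hl)

/-- A lattice-periodic function, as a function on the torus. -/
noncomputable def onTorus (Λ : Submodule ℤ Plane) (g : Plane → ℝ) (x : FlatTorus Λ) : ℝ :=
  g (Quotient.out x)

lemma exists_out_torusProj (p : Plane) :
    ∃ l ∈ Λ, Quotient.out (torusProj Λ p) = p + l := by
  obtain ⟨h, hh⟩ := QuotientAddGroup.mk_out_eq_add Λ.toAddSubgroup p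
  exact ⟨h, h.2, hh⟩

lemma onTorus_torusProj {g : Plane → ℝ} (hg : LatticePeriodic Λ g) (p : Plane) :
    onTorus Λ g (torusProj Λ p) = g p := by
  obtain ⟨l, hl, h⟩ := exists_out_torusProj (Λ := Λ) p
  rw [onTorus, h, hg p l hl]

lemma continuous_of_comp_torusProj {f : FlatTorus Λ → ℝ}
    (hf : Continuous fun p => f (torusProj Λ p)) : Continuous f :=
  (QuotientAddGroup.isQuotientMap_mk (N := Λ.toAddSubgroup)).continuous_iff.2 hf

lemma continuous_onTorus {g : Plane → ℝ} (hg : LatticePeriodic Λ g) (hc : Continuous g) :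
    Continuous (onTorus Λ g) :=
  continuous_of_comp_torusProj (by simpa only [onTorus_torusProj hg] using hc)

variable (Λ) [DiscreteTopology Λ] [IsZLattice ℝ Λ]

/-- The fundamental parallelogram used to define the volume of the torus. -/
def latticeCell : Set Plane :=
  ZSpan.fundamentalDomain ((Module.Free.chooseBasis ℤ Λ).ofZLatticeBasis ℝ Λ)

lemma isAddFundamentalDomain_latticeCell : IsAddFundamentalDomain Λ (latticeCell Λ) volume :=
  ZLattice.isAddFundamentalDomain _ _

instance vaddInvariantMeasure_lattice : VAddInvariantMeasure Λ Plane volume :=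
  ⟨fun c s _ => measure_preimage_add volume (c : Plane) s⟩

lemma measurableSet_latticeCell : MeasurableSet (latticeCell Λ) :=
  ZSpan.fundamentalDomain_measurableSet _

lemma isCompact_closure_latticeCell : IsCompact (closure (latticeCell Λ)) :=
  (ZSpan.fundamentalDomain_isBounded _).isCompact_closure

instance isFiniteMeasure_latticeCell :
    IsFiniteMeasure ((volume : Measure Plane).restrict (latticeCell Λ)) :=
  ⟨by
    rw [Measure.restrict_apply_univ]
    exact (measure_mono subset_closure).trans_lt (isCompact_closure_latticeCell Λ).measure_lt_top⟩

lemma volume_latticeCell_pos : 0 < (volume : Measure Plane).real (latticeCell Λ) := by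
  rw [Measure.real, ENNReal.toReal_pos_iff]
  refine ⟨pos_iff_ne_zero.2 (ZSpan.measure_fundamentalDomain_ne_zero _), ?_⟩
  exact (measure_mono subset_closure).trans_lt (isCompact_closure_latticeCell Λ).measure_lt_top

variable {Λ}

lemma integrableOn_latticeCell {g : Plane → ℝ} (hg : Continuous g) :
    IntegrableOn g (latticeCell Λ) :=
  (hg.continuousOn.integrableOn_compact (isCompact_closure_latticeCell Λ)).mono_set subset_closure

lemma exists_mem_latticeCell (p : Plane) : ∃ l ∈ Λ, p + l ∈ latticeCell Λ := by
  set b := (Module.Free.chooseBasis ℤ Λ).ofZLatticeBasis ℝ Λ with hb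
  refine ⟨-(ZSpan.floor b p : Plane), neg_mem ?_, ?_⟩
  · have h : ∀ x ∈ Submodule.span ℤ (range b), x ∈ Λ := fun x hx => by
      rwa [hb, Module.Basis.ofZLatticeBasis_span] at hx
    exact h _ (ZSpan.floor b p).2
  · have := ZSpan.fract_mem_fundamentalDomain b p
    rwa [ZSpan.fract_apply, sub_eq_add_neg] at this

instance compactSpace_flatTorus : CompactSpace (FlatTorus Λ) := by
  refine ⟨?_⟩
  have : (univ : Set (FlatTorus Λ)) = torusProj Λ '' closure (latticeCell Λ) := by
    refine (eq_univ_of_forall fun x => ?_).symm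
    obtain ⟨p, rfl⟩ := torusProj_surjective x
    obtain ⟨l, hl, h⟩ := exists_mem_latticeCell (Λ := Λ) p
    exact ⟨p + l, subset_closure h, torusProj_add hl⟩
  rw [this]
  exact (isCompact_closure_latticeCell Λ).image (continuous_torusProj Λ)

lemma integral_torusVolume {f : FlatTorus Λ → ℝ} (hf : Continuous f) :
    ∫ y, f y ∂(torusVolume Λ) = ∫ p in latticeCell Λ, f (torusProj Λ p) := by
  have hm : Measurable (torusProj Λ) := measurable_quotient_mk''
  have hfm : Measurable f :=
    measurable_from_quotient.2 (hf.comp (continuous_torusProj Λ)).measurable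
  exact integral_map hm.aemeasurable hfm.aestronglyMeasurable

/-- A translate of the cell is again a fundamental domain. -/
lemma setIntegral_latticeCell_add {g : Plane → ℝ} (hg : LatticePeriodic Λ g) (w : Plane) :
    ∫ p in latticeCell Λ, g (p + w) = ∫ p in latticeCell Λ, g p := by
  have hD := isAddFundamentalDomain_latticeCell Λ
  have hD' : IsAddFundamentalDomain Λ (w +ᵥ latticeCell Λ) volume := hD.vadd_of_comm w
  have h1 := hD'.setIntegral_eq hD (f := g) fun l x => by
    rw [Submodule.vadd_def, vadd_eq_add, add_comm]
    exact hg x l l.2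
  rw [← h1]
  have h2 := (measurePreserving_add_right (volume : Measure Plane) w).setIntegral_image_emb
    (measurableEmbedding_addRight w) g (latticeCell Λ)
  have h3 : (fun x => x + w) '' latticeCell Λ = w +ᵥ latticeCell Λ := by
    ext x
    simp only [mem_image, mem_vadd_set, vadd_eq_add, add_comm]
  rw [← h2, h3]

/-- Differentiation under the integral sign over the fundamental parallelogram. -/
theorem hasDerivAt_setIntegral_latticeCell {G G' : ℝ → Plane → ℝ} {I : Set ℝ} (hI : IsOpen I)
    {t : ℝ} (ht : t ∈ I) (hG : ∀ τ ∈ I, ∀ y, HasDerivAt (fun τ => G τ y) (G' τ y) τ)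
    (hc : ∀ τ ∈ I, Continuous (G τ)) (hG' : ContinuousOn (fun q : ℝ × Plane => G' q.1 q.2)
      (I ×ˢ univ)) :
    HasDerivAt (fun τ => ∫ y in latticeCell Λ, G τ y) (∫ y in latticeCell Λ, G' t y) t := by
  obtain ⟨ε, hε, hb⟩ := Metric.nhds_basis_closedBall.mem_iff.1 (hI.mem_nhds ht)
  have hK : IsCompact (Metric.closedBall t ε ×ˢ closure (latticeCell Λ)) :=
    (isCompact_closedBall t ε).prod (isCompact_closure_latticeCell Λ)
  obtain ⟨M, hM⟩ := hK.exists_bound_of_continuousOn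
    (hG'.mono (prod_mono hb (subset_univ _)))
  have hcont : Continuous (G' t) := by
    rw [← continuousOn_univ]
    exact hG'.comp (f := fun y => (t, y)) (by fun_prop) fun y _ => ⟨ht, mem_univ _⟩
  refine (hasDerivAt_integral_of_dominated_loc_of_deriv_le (bound := fun _ => M)
    (Metric.closedBall_mem_nhds t hε) ?_ (integrableOn_latticeCell (hc t ht))
    hcont.aestronglyMeasurable ?_ (integrable_const M) ?_).2
  · filter_upwards [hI.mem_nhds ht] with τ hτ
    exact (hc τ hτ).aestronglyMeasurable
  · rw [ae_restrict_iff' (measurableSet_latticeCell Λ)]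
    exact Eventually.of_forall fun y hy τ hτ => hM (τ, y) ⟨hτ, subset_closure hy⟩
  · exact Eventually.of_forall fun y τ hτ => hG τ (hb hτ) y

/-- Substitute for the divergence theorem: the integral of a translate does not depend on the
translation, so its derivative vanishes. -/
lemma setIntegral_latticeCell_deriv {g g' : Plane → ℝ} {e : Plane} (hg : LatticePeriodic Λ g)
    (hc : Continuous g) (hc' : Continuous g')
    (hd : ∀ y, HasDerivAt (fun s : ℝ => g (y + s • e)) (g' y) 0) :
    ∫ y in latticeCell Λ, g' y = 0 := by
  have hd' : ∀ τ y, HasDerivAt (fun s : ℝ => g (y + s • e)) (g' (y + τ • e)) τ := fun τ y => by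
    have h1 : HasDerivAt (fun s : ℝ => g (y + τ • e + s • e)) (g' (y + τ • e)) (τ - τ) := by
      rw [sub_self]; exact hd _
    refine (h1.comp_sub_const τ τ).congr_of_eventuallyEq (Eventually.of_forall fun s => ?_)
    simp only [add_assoc, ← add_smul, add_sub_cancel]
  have h := hasDerivAt_setIntegral_latticeCell (Λ := Λ) isOpen_univ (mem_univ (0 : ℝ))
    (G := fun τ y => g (y + τ • e)) (G' := fun τ y => g' (y + τ • e))
    (fun τ _ y => hd' τ y) (fun τ _ => by fun_prop) (by fun_prop)
  simp only [setIntegral_latticeCell_add hg, zero_smul, add_zero] at h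
  exact h.unique (hasDerivAt_const _ _)

lemma eq_zero_of_setIntegral_sq_eq_zero {g : Plane → ℝ} (hg : LatticePeriodic Λ g)
    (hc : Continuous g) (h : ∫ y in latticeCell Λ, g y * g y = 0) (p : Plane) : g p = 0 := by
  have h1 := (setIntegral_eq_zero_iff_of_nonneg_ae (Eventually.of_forall fun y => mul_self_nonneg (g y))
    (integrableOn_latticeCell (Λ := Λ) (hc.mul hc))).1 h
  have h2 : volume ({y | g y ≠ 0} ∩ latticeCell Λ) = 0 := by
    rw [← Measure.restrict_apply (isOpen_ne_fun hc continuous_const).measurableSet]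
    rw [← ae_iff (p := fun y => g y = 0)]
    filter_upwards [h1] with y hy
    exact mul_self_eq_zero.1 hy
  have h3 : volume {y | g y ≠ 0} = 0 := by
    refine (isAddFundamentalDomain_latticeCell Λ).measure_zero_of_invariant _ (fun l => ?_) h2
    ext x
    rw [mem_vadd_set_iff_neg_vadd_mem, Submodule.vadd_def, vadd_eq_add, add_comm, mem_ofPred_eq,
      mem_ofPred_eq, hg x _ (-l).2]
  have h4 : g =ᵐ[volume] fun _ => 0 := by
    rw [Filter.EventuallyEq, ae_iff]
    exact h3
  exact congrFun ((hc.ae_eq_iff_eq volume continuous_const).1 h4) p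

end Periodic

/-! ### Dual lattice and characters -/

/-- The Gram determinant of two vectors. -/
noncomputable def gramDet (u v : Plane) : ℝ := ‖u‖ ^ 2 * ‖v‖ ^ 2 - ⟪u, v⟫_ℝ ^ 2

/-- The vector pairing with `a u + b v` to `2 π (m a + n b)`. -/
noncomputable def dualVec (u v : Plane) (p : ℤ × ℤ) : Plane :=
  (2 * π / gramDet u v) •
    ((p.1 * ‖v‖ ^ 2 - p.2 * ⟪u, v⟫_ℝ) • u + (p.2 * ‖u‖ ^ 2 - p.1 * ⟪u, v⟫_ℝ) • v)

/-- The plane waves. -/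
noncomputable def planeWave (ξ : Plane) (θ : ℝ) (z : Plane) : ℝ := Real.cos (⟪ξ, z⟫_ℝ + θ)

lemma continuous_planeWave (ξ : Plane) (θ : ℝ) : Continuous (planeWave ξ θ) := by
  unfold planeWave; fun_prop

lemma abs_planeWave_le (ξ : Plane) (θ : ℝ) (z : Plane) : |planeWave ξ θ z| ≤ 1 :=
  Real.abs_cos_le_one _

lemma hasDerivAt_planeWave (ξ : Plane) (θ : ℝ) (y e : Plane) :
    HasDerivAt (fun s : ℝ => planeWave ξ θ (y + s • e))
      (⟪ξ, e⟫_ℝ * planeWave ξ (θ + π / 2) y) 0 := by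
  have h : HasDerivAt (fun s : ℝ => ⟪ξ, y⟫_ℝ + s * ⟪ξ, e⟫_ℝ + θ) ⟪ξ, e⟫_ℝ 0 :=
    ((hasDerivAt_mul_const _).const_add _).add_const _
  refine (h.cos.congr_of_eventuallyEq (Eventually.of_forall fun s => ?_)).congr_deriv ?_
  · simp only [planeWave, inner_add_right, real_inner_smul_right]
  · rw [planeWave, ← add_assoc, Real.cos_add_pi_div_two]
    simp; ring

lemma planeWave_mul (ξ η : Plane) (θ φ : ℝ) (z : Plane) :
    planeWave ξ θ z * planeWave η φ z =
      1 / 2 * planeWave (ξ + η) (θ + φ) z + 1 / 2 * planeWave (ξ - η) (θ - φ) z := by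
  simp only [planeWave, inner_add_left, inner_sub_left]
  rw [show ⟪ξ, z⟫_ℝ + ⟪η, z⟫_ℝ + (θ + φ) = (⟪ξ, z⟫_ℝ + θ) + (⟪η, z⟫_ℝ + φ) by ring,
    show ⟪ξ, z⟫_ℝ - ⟪η, z⟫_ℝ + (θ - φ) = (⟪ξ, z⟫_ℝ + θ) - (⟪η, z⟫_ℝ + φ) by ring,
    Real.cos_add (⟪ξ, z⟫_ℝ + θ), Real.cos_sub (⟪ξ, z⟫_ℝ + θ)]
  ring

lemma dualVec_add (u v : Plane) (p q : ℤ × ℤ) :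
    dualVec u v (p + q) = dualVec u v p + dualVec u v q := by
  simp only [dualVec, Prod.fst_add, Prod.snd_add, Int.cast_add]
  module

lemma dualVec_neg (u v : Plane) (p : ℤ × ℤ) : dualVec u v (-p) = -dualVec u v p := by
  simp only [dualVec, Prod.fst_neg, Prod.snd_neg, Int.cast_neg]
  module

lemma dualVec_sub (u v : Plane) (p q : ℤ × ℤ) :
    dualVec u v (p - q) = dualVec u v p - dualVec u v q := by
  rw [sub_eq_add_neg, dualVec_add, dualVec_neg, sub_eq_add_neg]

section Dual

variable {u v : Plane} (hD : 0 < gramDet u v)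
include hD

lemma inner_dualVec (p : ℤ × ℤ) (a b : ℝ) :
    ⟪dualVec u v p, a • u + b • v⟫_ℝ = 2 * π * (p.1 * a + p.2 * b) := by
  simp only [dualVec, inner_add_right, inner_add_left, real_inner_smul_left, real_inner_smul_right,
    real_inner_self_eq_norm_sq, real_inner_comm u v]
  have h := hD.ne'
  rw [show ∀ x : ℝ, 2 * π / gramDet u v * x = 2 * π * (x / gramDet u v) by intro x; ring]
  field_simp
  rw [gramDet]
  ring

lemma norm_sq_dualVec (p : ℤ × ℤ) : ‖dualVec u v p‖ ^ 2 = 4 * π ^ 2 / gramDet u v *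
    (‖v‖ ^ 2 * p.1 ^ 2 - 2 * ⟪u, v⟫_ℝ * p.1 * p.2 + ‖u‖ ^ 2 * p.2 ^ 2) := by
  rw [← real_inner_self_eq_norm_sq]
  nth_rewrite 2 [dualVec]
  rw [smul_add, smul_smul, smul_smul, inner_dualVec hD]
  ring

/-- For a symmetric 2 × 2 matrix M, Cayley–Hamilton gives tr(M) pᵀMp - det(M)|p|² = |Mp|² ≥ 0. This
bound makes the series damped. -/
lemma le_norm_sq_dualVec (p : ℤ × ℤ) :
    4 * π ^ 2 / (‖u‖ ^ 2 + ‖v‖ ^ 2) * ((p.1 : ℝ) ^ 2 + (p.2 : ℝ) ^ 2) ≤ ‖dualVec u v p‖ ^ 2 := by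
  have hs : 0 < ‖u‖ ^ 2 + ‖v‖ ^ 2 := by
    by_contra h
    have h1 : ‖u‖ ^ 2 = 0 := by nlinarith [sq_nonneg ‖u‖, sq_nonneg ‖v‖]
    rw [gramDet, h1] at hD
    nlinarith [sq_nonneg ⟪u, v⟫_ℝ]
  rw [norm_sq_dualVec hD, div_mul_eq_mul_div, div_mul_eq_mul_div, div_le_div_iff₀ hs hD]
  rw [gramDet]
  have h1 := mul_nonneg (by positivity : 0 ≤ 4 * π ^ 2)
    (add_nonneg (sq_nonneg (‖v‖ ^ 2 * p.1 - ⟪u, v⟫_ℝ * p.2))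
      (sq_nonneg (‖u‖ ^ 2 * p.2 - ⟪u, v⟫_ℝ * p.1)))
  nlinarith

lemma damped_dualVec : Damped (fun p => ‖dualVec u v p‖ ^ 2) (fun p => innerSL ℝ (dualVec u v p))
    (fun _ => (1 : ℝ)) where
  nonneg _ := sq_nonneg _
  norm_le p := by
    rw [innerSL_apply_norm]
    nlinarith [sq_nonneg (‖dualVec u v p‖ - 1)]
  summable δ hδ := by
    have hs : 0 < ‖u‖ ^ 2 + ‖v‖ ^ 2 := by
      by_contra h
      have h1 : ‖u‖ ^ 2 = 0 := by nlinarith [sq_nonneg ‖u‖, sq_nonneg ‖v‖]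
      rw [gramDet, h1] at hD
      nlinarith [sq_nonneg ⟪u, v⟫_ℝ]
    set c := 4 * π ^ 2 / (‖u‖ ^ 2 + ‖v‖ ^ 2) * δ with hc
    have hc0 : 0 < c := by positivity
    have h1 := (summable_exp_quadratic hc0 0).mul_of_nonneg (summable_exp_quadratic hc0 0)
      (fun _ => (Real.exp_pos _).le) (fun _ => (Real.exp_pos _).le)
    refine Summable.of_nonneg_of_le (fun p => by positivity) (fun p => ?_) h1
    rw [norm_one, mul_one, ← Real.exp_add]
    refine Real.exp_le_exp.2 ?_
    have := mul_le_mul_of_nonneg_right (le_norm_sq_dualVec hD p) hδ.le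
    simp only [hc]
    nlinarith

lemma dualVec_eq_zero {p : ℤ × ℤ} (h : dualVec u v p = 0) : p = 0 := by
  have h1 := inner_dualVec hD p 1 0
  have h2 := inner_dualVec hD p 0 1
  rw [h, inner_zero_left] at h1 h2
  have hπ := Real.pi_ne_zero
  ext
  · have : (p.1 : ℝ) = 0 := by
      by_contra hne
      simp [hπ, hne] at h1
    exact_mod_cast this
  · have : (p.2 : ℝ) = 0 := by
      by_contra hne
      simp [hπ, hne] at h2
    exact_mod_cast this

end Dual

section Lattice

variable {Λ : Submodule ℤ Plane} {u v : Plane} (hΛ : Λ = Submodule.span ℤ {u, v})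
include hΛ

lemma mem_lattice_iff {l : Plane} : l ∈ Λ ↔ ∃ m n : ℤ, l = (m : ℝ) • u + (n : ℝ) • v := by
  rw [hΛ, Submodule.mem_span_pair]
  constructor
  · rintro ⟨m, n, h⟩
    exact ⟨m, n, by rw [← h, Int.cast_smul_eq_zsmul, Int.cast_smul_eq_zsmul]⟩
  · rintro ⟨m, n, h⟩
    exact ⟨m, n, by rw [h, Int.cast_smul_eq_zsmul, Int.cast_smul_eq_zsmul]⟩

lemma planeWave_periodic (hD : 0 < gramDet u v) (p : ℤ × ℤ) (θ : ℝ) :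
    LatticePeriodic Λ (planeWave (dualVec u v p) θ) := by
  intro z l hl
  obtain ⟨m, n, rfl⟩ := (mem_lattice_iff hΛ).1 hl
  rw [planeWave, inner_add_right, inner_dualVec hD,
    show ⟪dualVec u v p, z⟫_ℝ + 2 * π * (p.1 * m + p.2 * n) + θ =
      ⟪dualVec u v p, z⟫_ℝ + θ + ((p.1 * m + p.2 * n : ℤ) : ℝ) * (2 * π) by push_cast; ring,
    Real.cos_add_int_mul_two_pi]
  rfl

variable [DiscreteTopology Λ] [IsZLattice ℝ Λ]

lemma span_real_pair : Submodule.span ℝ ({u, v} : Set Plane) = ⊤ := by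
  have h := IsZLattice.span_top (K := ℝ) (L := Λ)
  rw [hΛ, Submodule.span_span_of_tower] at h
  exact h

lemma exists_coords (z : Plane) : ∃ a b : ℝ, z = a • u + b • v := by
  have h : z ∈ Submodule.span ℝ ({u, v} : Set Plane) := by rw [span_real_pair hΛ]; trivial
  obtain ⟨a, b, h⟩ := Submodule.mem_span_pair.1 h
  exact ⟨a, b, h.symm⟩

lemma gramDet_pos : 0 < gramDet u v := by
  have hli : LinearIndependent ℝ ![u, v] := by
    refine linearIndependent_of_top_le_span_of_card_eq_finrank ?_ (by simp)
    rw [Matrix.range_cons, Matrix.range_cons, Matrix.range_empty, union_empty, singleton_union,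
      span_real_pair hΛ]
  have hv : v ≠ 0 := hli.ne_zero 1
  have hvp : 0 < ‖v‖ ^ 2 := by positivity
  have h0 : (‖v‖ ^ 2) • u + (-⟪u, v⟫_ℝ) • v ≠ 0 := fun h =>
    hvp.ne' (LinearIndependent.pair_iff.1 hli _ _ h).1
  have h1 : ‖(‖v‖ ^ 2) • u + (-⟪u, v⟫_ℝ) • v‖ ^ 2 = ‖v‖ ^ 2 * gramDet u v := by
    rw [norm_add_sq_real, norm_smul, norm_smul, real_inner_smul_left, real_inner_smul_right,
      Real.norm_eq_abs, Real.norm_eq_abs, mul_pow, mul_pow, sq_abs, sq_abs, gramDet]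
    ring
  have h2 : 0 < ‖v‖ ^ 2 * gramDet u v := by rw [← h1]; positivity
  exact pos_of_mul_pos_right h2 hvp.le

/-- The plane waves on the torus. -/
noncomputable def torusWave (p : ℤ × ℤ) (θ : ℝ) : C(FlatTorus Λ, ℝ) :=
  ⟨onTorus Λ (planeWave (dualVec u v p) θ), continuous_onTorus
    (planeWave_periodic hΛ (gramDet_pos hΛ) p θ) (continuous_planeWave _ _)⟩

lemma torusWave_torusProj (p : ℤ × ℤ) (θ : ℝ) (z : Plane) :
    torusWave hΛ p θ (torusProj Λ z) = planeWave (dualVec u v p) θ z :=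
  onTorus_torusProj (planeWave_periodic hΛ (gramDet_pos hΛ) p θ) z

/-- Stone–Weierstrass: product-to-sum formulas make the span an algebra, and the waves determine
lattice coordinates modulo 1. -/
lemma dense_span_torusWave :
    Dense (Submodule.span ℝ (range fun q : (ℤ × ℤ) × ℝ => torusWave hΛ q.1 q.2) :
      Set C(FlatTorus Λ, ℝ)) := by
  set S := Submodule.span ℝ (range fun q : (ℤ × ℤ) × ℝ => torusWave hΛ q.1 q.2) with hS
  have hmem : ∀ p θ, torusWave hΛ p θ ∈ S := fun p θ => Submodule.subset_span ⟨(p, θ), rfl⟩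
  have hone : (1 : C(FlatTorus Λ, ℝ)) ∈ S := by
    have : (1 : C(FlatTorus Λ, ℝ)) = torusWave hΛ 0 0 := by
      ext x
      obtain ⟨z, rfl⟩ := torusProj_surjective x
      rw [torusWave_torusProj]
      simp [planeWave, dualVec]
    rw [this]
    exact hmem 0 0
  have hmul : ∀ f g, f ∈ S → g ∈ S → f * g ∈ S := by
    intro f g hf hg
    have h : S * S ≤ S := by
      rw [hS, Submodule.span_mul_span, Submodule.span_le]
      rintro _ ⟨_, ⟨⟨p, θ⟩, rfl⟩, _, ⟨⟨q, φ⟩, rfl⟩, rfl⟩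
      have : torusWave hΛ p θ * torusWave hΛ q φ =
          (1 / 2 : ℝ) • torusWave hΛ (p + q) (θ + φ) + (1 / 2 : ℝ) • torusWave hΛ (p - q) (θ - φ) := by
        ext x
        obtain ⟨z, rfl⟩ := torusProj_surjective x
        simp only [ContinuousMap.mul_apply, ContinuousMap.add_apply, ContinuousMap.smul_apply,
          torusWave_torusProj, dualVec_add, dualVec_sub, planeWave_mul, smul_eq_mul]
      show torusWave hΛ p θ * torusWave hΛ q φ ∈ S
      rw [this]
      exact S.add_mem (S.smul_mem _ (hmem _ _)) (S.smul_mem _ (hmem _ _))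
    exact h (Submodule.mul_mem_mul hf hg)
  set A : Subalgebra ℝ C(FlatTorus Λ, ℝ) := S.toSubalgebra hone hmul with hA
  have hsep : A.SeparatesPoints := by
    intro x y hxy
    by_contra hcon
    push Not at hcon
    obtain ⟨z, rfl⟩ := torusProj_surjective x
    obtain ⟨w, rfl⟩ := torusProj_surjective y
    refine hxy (torusProj_eq_iff.2 ((mem_lattice_iff hΛ).2 ?_))
    obtain ⟨a, b, hab⟩ := exists_coords hΛ (w - z)
    have key : ∀ p : ℤ × ℤ, Real.cos (2 * π * (p.1 * a + p.2 * b)) = 1 := fun p => by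
      -- With this phase the wave equals 1 at z, so it equals 1 at w.
      have h1 := hcon (torusWave hΛ p (-⟪dualVec u v p, z⟫_ℝ)) ⟨_, hmem _ _, rfl⟩
      rw [torusWave_torusProj, torusWave_torusProj, planeWave, planeWave, add_neg_cancel,
        Real.cos_zero, ← sub_eq_add_neg, ← inner_sub_right, hab, inner_dualVec (gramDet_pos hΛ)] at h1
      exact h1.symm
    obtain ⟨m, hm⟩ := (Real.cos_eq_one_iff _).1 (key (1, 0))
    obtain ⟨n, hn⟩ := (Real.cos_eq_one_iff _).1 (key (0, 1))
    have hπ := Real.pi_pos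
    refine ⟨m, n, ?_⟩
    have e1 : (m : ℝ) = a := by
      have : (m : ℝ) * (2 * π) = a * (2 * π) := by rw [hm]; push_cast; ring
      exact mul_right_cancel₀ (by positivity) this
    have e2 : (n : ℝ) = b := by
      have : (n : ℝ) * (2 * π) = b * (2 * π) := by rw [hn]; push_cast; ring
      exact mul_right_cancel₀ (by positivity) this
    rw [hab, e1, e2]
  have := ContinuousMap.subalgebra_topologicalClosure_eq_top_of_separatesPoints A hsep
  intro f
  have hf : f ∈ A.topologicalClosure := by rw [this]; trivial
  exact hf

/-- A continuous linear functional vanishing on plane waves vanishes. -/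
lemma eq_zero_of_torusWave (L : C(FlatTorus Λ, ℝ) →L[ℝ] ℝ) (h : ∀ p θ, L (torusWave hΛ p θ) = 0)
    (f : C(FlatTorus Λ, ℝ)) : L f = 0 := by
  have h1 : Submodule.span ℝ (range fun q : (ℤ × ℤ) × ℝ => torusWave hΛ q.1 q.2) ≤
      LinearMap.ker (L : C(FlatTorus Λ, ℝ) →ₗ[ℝ] ℝ) := by
    rw [Submodule.span_le]
    rintro _ ⟨q, rfl⟩
    exact h q.1 q.2
  have h2 : IsClosed {f | L f = 0} := isClosed_eq L.continuous continuous_const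
  have h3 := (dense_span_torusWave hΛ).closure_eq
  have h4 : closure (Submodule.span ℝ (range fun q : (ℤ × ℤ) × ℝ => torusWave hΛ q.1 q.2) :
      Set C(FlatTorus Λ, ℝ)) ⊆ {f | L f = 0} := closure_minimal (fun g hg => h1 hg) h2
  rw [h3] at h4
  exact h4 (mem_univ f)

end Lattice

/-- The functional `f ↦ ∫ D f(φ w) dν(w)`. -/
noncomputable def pullbackIntegral {Λ : Submodule ℤ Plane} [DiscreteTopology Λ] [IsZLattice ℝ Λ]
    {ν : Measure Plane} {D : Plane → ℝ} (hD : Integrable D ν) {φ : Plane → FlatTorus Λ}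
    (hφ : Continuous φ) : C(FlatTorus Λ, ℝ) →L[ℝ] ℝ :=
  have hi : ∀ f : C(FlatTorus Λ, ℝ), Integrable (fun w => D w * f (φ w)) ν := fun f =>
    hD.mul_bdd (c := ‖f‖) (f.continuous.comp hφ).aestronglyMeasurable
      (Eventually.of_forall fun w => f.norm_coe_le_norm _)
  LinearMap.mkContinuous
    { toFun := fun f => ∫ w, D w * f (φ w) ∂ν
      map_add' := fun f g => by
        rw [← integral_add (hi f) (hi g)]
        exact integral_congr_ae (Eventually.of_forall fun w => mul_add _ _ _)
      map_smul' := fun c f => by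
        rw [RingHom.id_apply, smul_eq_mul, ← integral_const_mul]
        exact integral_congr_ae (Eventually.of_forall fun w => mul_left_comm _ _ _) }
    (∫ w, ‖D w‖ ∂ν) fun f => by
      rw [← integral_mul_const]
      refine (norm_integral_le_integral_norm _).trans (integral_mono (hi f).norm
        (hD.norm.mul_const _) fun w => ?_)
      simp only [norm_mul]
      gcongr
      exact f.norm_coe_le_norm _

lemma pullbackIntegral_apply {Λ : Submodule ℤ Plane} [DiscreteTopology Λ] [IsZLattice ℝ Λ]
    {ν : Measure Plane} {D : Plane → ℝ} (hD : Integrable D ν) {φ : Plane → FlatTorus Λ}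
    (hφ : Continuous φ) (f : C(FlatTorus Λ, ℝ)) :
    pullbackIntegral hD hφ f = ∫ w, D w * f (φ w) ∂ν := rfl

/-! ### The heat kernel -/

section Heat

variable {Λ : Submodule ℤ Plane} [DiscreteTopology Λ] [IsZLattice ℝ Λ] {u v : Plane}

variable (Λ u v) in
/-- The heat kernel of the torus, as a function of time and of the difference of the arguments. -/
noncomputable def heatFn (t : ℝ) (w : Plane) : ℝ :=
  ((volume : Measure Plane).real (latticeCell Λ))⁻¹ *
    trigSeries (fun p => ‖dualVec u v p‖ ^ 2) (fun p => innerSL ℝ (dualVec u v p))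
      (fun _ => (1 : ℝ)) (fun _ => 0) (t, w)

lemma heatFn_eq (t : ℝ) (w : Plane) : heatFn Λ u v t w =
    ((volume : Measure Plane).real (latticeCell Λ))⁻¹ *
      ∑' p, Real.exp (-(‖dualVec u v p‖ ^ 2 * t)) * planeWave (dualVec u v p) 0 w := by
  simp [heatFn, trigSeries, planeWave]

variable (hΛ : Λ = Submodule.span ℤ {u, v})
include hΛ

lemma setIntegral_planeWave (p : ℤ × ℤ) (θ : ℝ) :
    ∫ y in latticeCell Λ, planeWave (dualVec u v p) θ y =
      if p = 0 then (volume : Measure Plane).real (latticeCell Λ) * Real.cos θ else 0 := by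
  have hD := gramDet_pos hΛ
  split_ifs with hp
  · subst hp
    have : dualVec u v 0 = 0 := by simp [dualVec]
    simp [this, planeWave]
  · have hξ : dualVec u v p ≠ 0 := fun h => hp (dualVec_eq_zero hD h)
    -- A wave of nonzero frequency ξ is, up to the factor |ξ|², the derivative along ξ of the wave
    -- with phase shifted by -π/2.
    have h := setIntegral_latticeCell_deriv (e := dualVec u v p)
      (planeWave_periodic hΛ hD p (θ - π / 2)) (continuous_planeWave _ _)
      ((continuous_planeWave _ _).const_mul _) fun y => hasDerivAt_planeWave _ _ y _
    rw [integral_const_mul, sub_add_cancel, real_inner_self_eq_norm_sq] at h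
    exact (mul_eq_zero.1 h).resolve_left (by positivity)

lemma heatFn_periodic (t : ℝ) : LatticePeriodic Λ (heatFn Λ u v t) := by
  intro p l hl
  simp only [heatFn_eq]
  congr 1
  exact tsum_congr fun q => by rw [planeWave_periodic hΛ (gramDet_pos hΛ) q 0 p l hl]

lemma contDiffOn_heatFn (n : ℕ) :
    ContDiffOn ℝ n (fun q : ℝ × Plane => heatFn Λ u v q.1 q.2) (Ioi 0 ×ˢ univ) :=
  contDiffOn_const.mul ((damped_dualVec (gramDet_pos hΛ)).contDiffOn n)

lemma contDiff_heatFn (n : ℕ) {t : ℝ} (ht : 0 < t) : ContDiff ℝ n (heatFn Λ u v t) := by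
  rw [← contDiffOn_univ]
  exact (contDiffOn_heatFn hΛ n).comp (f := fun z => (t, z)) (by fun_prop)
    fun z _ => ⟨ht, mem_univ _⟩

/-- The Fourier coefficients of the heat kernel. -/
lemma setIntegral_heatFn_mul {t : ℝ} (ht : 0 < t) (x : Plane) (q : ℤ × ℤ) (θ : ℝ) :
    ∫ y in latticeCell Λ, heatFn Λ u v t (x - y) * planeWave (dualVec u v q) θ y =
      Real.exp (-(‖dualVec u v q‖ ^ 2 * t)) * planeWave (dualVec u v q) θ x := by
  have hD := gramDet_pos hΛ
  have hV := volume_latticeCell_pos Λ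
  set V := (volume : Measure Plane).real (latticeCell Λ) with hVdef
  set ξ := dualVec u v
  set E : ℤ × ℤ → ℝ := fun p => Real.exp (-(‖ξ p‖ ^ 2 * t)) with hE
  have hEs : Summable E := by simpa using (damped_dualVec hD).summable t ht
  have e1 : ∀ y, heatFn Λ u v t (x - y) * planeWave (ξ q) θ y =
      ∑' p, V⁻¹ * (E p * (planeWave (ξ p) 0 (x - y) * planeWave (ξ q) θ y)) := fun y => by
    rw [heatFn_eq, tsum_mul_left, mul_assoc, ← tsum_mul_right]
    simp only [mul_assoc, hE, ξ, V]
  have hb : ∀ p y, ‖V⁻¹ * (E p * (planeWave (ξ p) 0 (x - y) * planeWave (ξ q) θ y))‖ ≤ V⁻¹ * E p := by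
    intro p y
    have h1 := abs_planeWave_le (ξ p) 0 (x - y)
    have h2 := abs_planeWave_le (ξ q) θ y
    rw [norm_mul, norm_mul, norm_mul, Real.norm_of_nonneg (inv_nonneg.2 hV.le),
      Real.norm_of_nonneg (Real.exp_pos _).le, Real.norm_eq_abs, Real.norm_eq_abs]
    have h3 : 0 ≤ E p := (Real.exp_pos _).le
    have h4 : 0 ≤ V⁻¹ := inv_nonneg.2 hV.le
    calc _ ≤ V⁻¹ * (E p * (1 * 1)) := by gcongr
      _ = _ := by ring
  have hc : ∀ p, Continuous fun y =>
      V⁻¹ * (E p * (planeWave (ξ p) 0 (x - y) * planeWave (ξ q) θ y)) := fun p => by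
    have h1 := continuous_planeWave (ξ p) 0
    have h2 := continuous_planeWave (ξ q) θ
    fun_prop
  simp only [e1]
  rw [← integral_tsum_of_summable_integral_norm (fun p => integrableOn_latticeCell (hc p))]
  · have e2 : ∀ p, ∫ y in latticeCell Λ,
        V⁻¹ * (E p * (planeWave (ξ p) 0 (x - y) * planeWave (ξ q) θ y)) =
        (if p = q then 1 / 2 * (E q * planeWave (ξ q) θ x) else 0) +
        (if p = -q then 1 / 2 * (E q * planeWave (ξ q) θ x) else 0) := fun p => by
      have e3 : ∀ y, planeWave (ξ p) 0 (x - y) * planeWave (ξ q) θ y =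
          1 / 2 * planeWave (ξ (q - p)) (θ + ⟪ξ p, x⟫_ℝ) y +
          1 / 2 * planeWave (ξ (q + p)) (θ - ⟪ξ p, x⟫_ℝ) y := fun y => by
        have h1 : planeWave (ξ p) 0 (x - y) = planeWave (ξ p) (-⟪ξ p, x⟫_ℝ) y := by
          rw [planeWave, planeWave, ← Real.cos_neg, inner_sub_right]
          congr 1; ring
        rw [h1, mul_comm, planeWave_mul, ← dualVec_add, ← dualVec_sub, sub_neg_eq_add,
          ← sub_eq_add_neg, add_comm]
      simp only [e3]
      rw [integral_const_mul, integral_const_mul, integral_add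
        (integrableOn_latticeCell ((continuous_planeWave _ _).const_mul _))
        (integrableOn_latticeCell ((continuous_planeWave _ _).const_mul _)),
        integral_const_mul, integral_const_mul, setIntegral_planeWave hΛ,
        setIntegral_planeWave hΛ, ← hVdef]
      have c1 : q - p = 0 ↔ p = q := by rw [sub_eq_zero, eq_comm]
      have c2 : q + p = 0 ↔ p = -q := by rw [add_comm, add_eq_zero_iff_eq_neg]
      simp only [c1, c2]
      have hV0 := hV.ne'
      have f1 : p = q → V⁻¹ * (E p * (1 / 2 * (V * Real.cos (θ + ⟪ξ p, x⟫_ℝ)))) =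
          1 / 2 * (E q * planeWave (ξ q) θ x) := by
        rintro rfl
        rw [planeWave, add_comm θ]; field_simp
      have f2 : p = -q → V⁻¹ * (E p * (1 / 2 * (V * Real.cos (θ - ⟪ξ p, x⟫_ℝ)))) =
          1 / 2 * (E q * planeWave (ξ q) θ x) := by
        rintro rfl
        have : ξ (-q) = -ξ q := dualVec_neg u v q
        simp only [hE, this, norm_neg, inner_neg_left]
        rw [planeWave, sub_neg_eq_add, add_comm θ]; field_simp
      rw [mul_add, mul_add]
      congr 1
      · split_ifs with h
        · exact f1 h
        · simp
      · split_ifs with h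
        · exact f2 h
        · simp
    simp only [e2]
    rw [Summable.tsum_add (hasSum_ite_eq _ _).summable (hasSum_ite_eq _ _).summable,
      tsum_ite_eq, tsum_ite_eq]
    ring
  · refine Summable.of_nonneg_of_le (fun p => integral_nonneg fun _ => norm_nonneg _) (fun p => ?_)
      ((hEs.mul_left V⁻¹).mul_right V)
    refine (integral_mono (integrableOn_latticeCell (hc p)).norm (integrable_const (V⁻¹ * E p))
      (hb p)).trans (le_of_eq ?_)
    simp [hVdef, mul_comm]

/-- Green's formula against a plane wave. -/
lemma setIntegral_laplacian_mul {f : Plane → ℝ} (hf : ContDiff ℝ 2 f) (hp : LatticePeriodic Λ f)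
    (q : ℤ × ℤ) (θ : ℝ) :
    ∫ y in latticeCell Λ, (Δ f) y * planeWave (dualVec u v q) θ y =
      -‖dualVec u v q‖ ^ 2 * ∫ y in latticeCell Λ, f y * planeWave (dualVec u v q) θ y := by
  have hD := gramDet_pos hΛ
  set ξ := dualVec u v q
  have hf1 : ContDiff ℝ 1 (fderiv ℝ f) := hf.fderiv_right (by norm_num)
  have hc0 : Continuous f := hf.continuous
  have hc1 : Continuous (fderiv ℝ f) := hf1.continuous
  have hc2 : Continuous (fderiv ℝ (fderiv ℝ f)) := hf1.continuous_fderiv (by norm_num)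
  have hw := fun φ => continuous_planeWave ξ φ
  have key : ∀ e : Plane, ∫ y in latticeCell Λ, fderiv ℝ (fderiv ℝ f) y e e * planeWave ξ θ y =
      -⟪ξ, e⟫_ℝ ^ 2 * ∫ y in latticeCell Λ, f y * planeWave ξ θ y := fun e => by
    have hline : ∀ y : Plane, HasDerivAt (fun s : ℝ => y + s • e) e 0 := fun y => by
      simpa using ((hasDerivAt_id (0 : ℝ)).smul_const e).const_add y
    have d1 : ∀ y, HasDerivAt (fun s : ℝ => f (y + s • e)) (fderiv ℝ f y e) 0 := fun y => by
      have h := (hf.differentiable (by norm_num) y).hasFDerivAt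
      exact HasFDerivAt.comp_hasDerivAt (0 : ℝ) (by simpa using h) (hline y)
    have d2 : ∀ y, HasDerivAt (fun s : ℝ => fderiv ℝ f (y + s • e) e)
        (fderiv ℝ (fderiv ℝ f) y e e) 0 := fun y => by
      have h := (hf1.differentiable (by norm_num) y).hasFDerivAt
      have h2 := HasFDerivAt.comp_hasDerivAt (0 : ℝ) (l := fderiv ℝ f)
        (by simpa using h) (hline y)
      simpa using h2.clm_apply (hasDerivAt_const (0 : ℝ) e)
    have hper : ∀ y, ∀ l ∈ Λ, fderiv ℝ f (y + l) = fderiv ℝ f y := fun y l hl => by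
      rw [← fderiv_comp_add_right]
      congr 1
      exact funext fun z => hp z l hl
    -- Two integrations by parts at once: differentiating g along e, the mixed terms cancel and g'
    -- remains.
    have h := setIntegral_latticeCell_deriv (Λ := Λ) (e := e)
      (g := fun y => fderiv ℝ f y e * planeWave ξ θ y -
        f y * (⟪ξ, e⟫_ℝ * planeWave ξ (θ + π / 2) y))
      (g' := fun y => fderiv ℝ (fderiv ℝ f) y e e * planeWave ξ θ y +
        ⟪ξ, e⟫_ℝ ^ 2 * (f y * planeWave ξ θ y)) ?_ ?_ ?_ ?_
    · rw [integral_add (integrableOn_latticeCell (by have := hw θ; fun_prop))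
        (integrableOn_latticeCell (by have := hw θ; fun_prop)), integral_const_mul] at h
      linarith
    · intro y l hl
      simp only [hper y l hl, hp y l hl, planeWave_periodic hΛ hD q _ y l hl, ξ]
    · have := hw θ
      have := hw (θ + π / 2)
      fun_prop
    · have := hw θ
      fun_prop
    · intro y
      refine (((d2 y).mul (hasDerivAt_planeWave ξ θ y e)).sub
        ((d1 y).mul ((hasDerivAt_planeWave ξ (θ + π / 2) y e).const_mul ⟪ξ, e⟫_ℝ))).congr_deriv ?_
      simp only [zero_smul, add_zero]
      have : planeWave ξ (θ + π / 2 + π / 2) y = -planeWave ξ θ y := by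
        rw [planeWave, planeWave, ← Real.cos_add_pi]
        congr 1; ring
      rw [this]
      ring
  set b := stdOrthonormalBasis ℝ Plane with hb
  rw [InnerProductSpace.laplacian_eq_iteratedFDeriv_orthonormalBasis f b]
  simp only [iteratedFDeriv_two_apply, Matrix.cons_val_zero, Matrix.cons_val_one,
    Finset.sum_mul]
  rw [integral_finsetSum _ fun i _ => integrableOn_latticeCell (by have := hw θ; fun_prop)]
  simp only [key]
  rw [← Finset.sum_mul, Finset.sum_neg_distrib]
  congr 2
  have := b.sum_sq_norm_inner_left ξ
  rw [← this]
  exact Finset.sum_congr rfl fun i _ => by rw [Real.norm_eq_abs, sq_abs]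

end Heat

/-! ### Existence and uniqueness of the heat kernel -/

section Uniqueness

variable {Λ : Submodule ℤ Plane} [DiscreteTopology Λ] [IsZLattice ℝ Λ]
  {K : ℝ → FlatTorus Λ → FlatTorus Λ → ℝ}

lemma IsHeatKernel.contDiff (hK : IsHeatKernel Λ K) (x : FlatTorus Λ) {t : ℝ} (ht : 0 < t) :
    ContDiff ℝ 2 fun z => K t x (torusProj Λ z) := by
  rw [← contDiffOn_univ]
  exact (hK.contDiffOn x).comp (f := fun z : Plane => (t, z)) (by fun_prop)
    fun z _ => ⟨ht, mem_univ _⟩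

lemma isOpen_Ioi_prod_univ : IsOpen (Ioi (0 : ℝ) ×ˢ (univ : Set Plane)) := isOpen_Ioi.prod isOpen_univ

lemma IsHeatKernel.hasDerivAt (hK : IsHeatKernel Λ K) (x : FlatTorus Λ) {t : ℝ} (ht : 0 < t)
    (z : Plane) : HasDerivAt (fun τ => K τ x (torusProj Λ z))
      (fderiv ℝ (fun q : ℝ × Plane => K q.1 x (torusProj Λ q.2)) (t, z) (1, 0)) t := by
  have h1 : HasFDerivAt (fun q : ℝ × Plane => K q.1 x (torusProj Λ q.2)) _ (t, z) :=
    (((hK.contDiffOn x).contDiffAt (isOpen_Ioi_prod_univ.mem_nhds (mk_mem_prod ht (mem_univ z)))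
      ).differentiableAt (by norm_num)).hasFDerivAt
  exact h1.comp_hasDerivAt t ((hasDerivAt_id t).prodMk (hasDerivAt_const t z))

lemma IsHeatKernel.continuousOn_deriv (hK : IsHeatKernel Λ K) (x : FlatTorus Λ) :
    ContinuousOn (fun q : ℝ × Plane =>
      fderiv ℝ (fun q : ℝ × Plane => K q.1 x (torusProj Λ q.2)) q (1, 0)) (Ioi 0 ×ˢ univ) :=
  ((hK.contDiffOn x).continuousOn_fderiv_of_isOpen isOpen_Ioi_prod_univ (by norm_num)).clm_apply
    continuousOn_const

variable {u v : Plane} (hΛ : Λ = Submodule.span ℤ {u, v})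
include hΛ

/-- The Fourier coefficients of any heat kernel. -/
lemma IsHeatKernel.setIntegral_mul (hK : IsHeatKernel Λ K) {t : ℝ} (ht : 0 < t) (x : Plane)
    (q : ℤ × ℤ) (θ : ℝ) :
    ∫ y in latticeCell Λ, K t (torusProj Λ x) (torusProj Λ y) * planeWave (dualVec u v q) θ y =
      Real.exp (-(‖dualVec u v q‖ ^ 2 * t)) * planeWave (dualVec u v q) θ x := by
  set ξ := dualVec u v q
  set X := torusProj Λ x
  set a : ℝ → ℝ := fun τ => ∫ y in latticeCell Λ, K τ X (torusProj Λ y) * planeWave ξ θ y with ha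
  have hw := continuous_planeWave ξ θ
  have hder : ∀ τ ∈ Ioi (0 : ℝ), HasDerivAt a (-‖ξ‖ ^ 2 * a τ) τ := fun τ hτ => by
    have h := hasDerivAt_setIntegral_latticeCell (Λ := Λ) (isOpen_Ioi (a := (0 : ℝ))) hτ
      (G := fun τ y => K τ X (torusProj Λ y) * planeWave ξ θ y)
      (G' := fun τ y => fderiv ℝ (fun q : ℝ × Plane => K q.1 X (torusProj Λ q.2)) (τ, y) (1, 0) *
        planeWave ξ θ y)
      (fun s hs y => (hK.hasDerivAt X hs y).mul_const _)
      (fun s hs => (hK.contDiff X hs).continuous.mul hw)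
      ((hK.continuousOn_deriv X).mul (hw.comp continuous_snd).continuousOn)
    refine h.congr_deriv ?_
    rw [ha, ← setIntegral_laplacian_mul hΛ (hK.contDiff X hτ)
      (LatticePeriodic.comp_torusProj (K τ X)) q θ]
    refine integral_congr_ae (Eventually.of_forall fun y => ?_)
    simp only
    rw [← (hK.hasDerivAt X hτ y).deriv, hK.heat_eq X τ hτ y]
  -- The coefficient solves a' = -|ξ|² a, so this product is constant; the initial condition
  -- identifies the constant.
  have hb : ∀ τ ∈ Ioi (0 : ℝ), HasDerivAt (fun τ => a τ * Real.exp (‖ξ‖ ^ 2 * τ)) 0 τ :=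
    fun τ hτ => by
      have h1 : HasDerivAt (fun τ => Real.exp (‖ξ‖ ^ 2 * τ))
          (Real.exp (‖ξ‖ ^ 2 * τ) * (‖ξ‖ ^ 2 * 1)) τ := ((hasDerivAt_id τ).const_mul _).exp
      exact ((hder τ hτ).mul h1).congr_deriv (by ring)
  obtain ⟨c, hc⟩ := isOpen_Ioi.exists_is_const_of_deriv_eq_zero isPreconnected_Ioi
    (fun τ hτ => (hb τ hτ).differentiableAt.differentiableWithinAt)
    (fun τ hτ => (hb τ hτ).deriv)
  have hlim : Tendsto a (𝓝[>] 0) (𝓝 (planeWave ξ θ x)) := by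
    have h := hK.initial X (torusWave hΛ q θ) (torusWave hΛ q θ).continuous
    rw [torusWave_torusProj] at h
    refine h.congr' ?_
    filter_upwards [self_mem_nhdsWithin] with τ hτ
    have hcont : Continuous (K τ X) := continuous_of_comp_torusProj (hK.contDiff X hτ).continuous
    rw [integral_torusVolume (f := fun y => K τ X y * torusWave hΛ q θ y)
      (hcont.mul (torusWave hΛ q θ).continuous)]
    simp only [torusWave_torusProj]
    rfl
  have hlim2 : Tendsto (fun τ => a τ * Real.exp (‖ξ‖ ^ 2 * τ)) (𝓝[>] 0)
      (𝓝 (planeWave ξ θ x * 1)) := by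
    refine hlim.mul ?_
    have : Tendsto (fun τ : ℝ => Real.exp (‖ξ‖ ^ 2 * τ)) (𝓝 0) (𝓝 (Real.exp (‖ξ‖ ^ 2 * 0))) :=
      (by fun_prop : Continuous fun τ : ℝ => Real.exp (‖ξ‖ ^ 2 * τ)).tendsto 0
    rw [mul_zero, Real.exp_zero] at this
    exact this.mono_left nhdsWithin_le_nhds
  have hlim3 : Tendsto (fun τ => a τ * Real.exp (‖ξ‖ ^ 2 * τ)) (𝓝[>] 0) (𝓝 c) := by
    refine tendsto_const_nhds.congr' ?_
    filter_upwards [self_mem_nhdsWithin] with τ hτ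
    exact (hc τ hτ).symm
  have h1 := tendsto_nhds_unique hlim2 hlim3
  have h2 := hc t ht
  rw [← h1, mul_one] at h2
  rw [← h2, mul_left_comm, ← Real.exp_add, neg_add_cancel, Real.exp_zero, mul_one]

/-- A heat kernel is given by the Fourier series. -/
theorem IsHeatKernel.eq_heatFn (hK : IsHeatKernel Λ K) {t : ℝ} (ht : 0 < t) (x y : Plane) :
    K t (torusProj Λ x) (torusProj Λ y) = heatFn Λ u v t (x - y) := by
  set D : Plane → ℝ := fun y => K t (torusProj Λ x) (torusProj Λ y) - heatFn Λ u v t (x - y)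
    with hDdef
  have hc1 : Continuous fun y => K t (torusProj Λ x) (torusProj Λ y) :=
    (hK.contDiff _ ht).continuous
  have hc2 : Continuous fun y => heatFn Λ u v t (x - y) :=
    (contDiff_heatFn hΛ 2 ht).continuous.comp (by fun_prop)
  have hc : Continuous D := hc1.sub hc2
  have hp : LatticePeriodic Λ D := fun y l hl => by
    have h1 := heatFn_periodic hΛ t (x - y) (-l) (neg_mem hl)
    simp only [hDdef, torusProj_add hl]
    rw [← h1]
    congr 2
    abel
  have hI : Integrable D (volume.restrict (latticeCell Λ)) := integrableOn_latticeCell hc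
  -- The difference D is orthogonal to all plane waves, hence to all continuous functions, in
  -- particular to itself.
  have hL := eq_zero_of_torusWave hΛ (pullbackIntegral hI (continuous_torusProj Λ)) (fun q θ => by
      rw [pullbackIntegral_apply]
      simp only [torusWave_torusProj, hDdef, sub_mul]
      have hw := continuous_planeWave (dualVec u v q) θ
      have h1 : IntegrableOn (fun y => K t (torusProj Λ x) (torusProj Λ y) *
        planeWave (dualVec u v q) θ y) (latticeCell Λ) := integrableOn_latticeCell (hc1.mul hw)
      have h2 : IntegrableOn (fun y => heatFn Λ u v t (x - y) * planeWave (dualVec u v q) θ y)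
        (latticeCell Λ) := integrableOn_latticeCell (hc2.mul hw)
      rw [integral_sub h1 h2, hK.setIntegral_mul hΛ ht, setIntegral_heatFn_mul hΛ ht, sub_self])
    ⟨onTorus Λ D, continuous_onTorus hp hc⟩
  rw [pullbackIntegral_apply] at hL
  simp only [ContinuousMap.coe_mk, onTorus_torusProj hp] at hL
  exact sub_eq_zero.1 (eq_zero_of_setIntegral_sq_eq_zero hp hc hL y)

end Uniqueness

section Existence

variable {Λ : Submodule ℤ Plane} [DiscreteTopology Λ] [IsZLattice ℝ Λ]
  {u v : Plane} (hΛ : Λ = Submodule.span ℤ {u, v})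
include hΛ

lemma hasDerivAt_heatFn {t : ℝ} (ht : 0 < t) (z : Plane) :
    HasDerivAt (fun τ => heatFn Λ u v τ z) (((volume : Measure Plane).real (latticeCell Λ))⁻¹ *
      trigSeries (fun p => ‖dualVec u v p‖ ^ 2) (fun p => innerSL ℝ (dualVec u v p))
        (fun p => -‖dualVec u v p‖ ^ 2 * 1) (fun _ => 0) (t, z)) t :=
  ((damped_dualVec (gramDet_pos hΛ)).hasDerivAt_time ht z).const_mul _

lemma laplacian_heatFn_sub {t : ℝ} (ht : 0 < t) (x z : Plane) :
    (Δ (fun y => heatFn Λ u v t (x - y))) z = deriv (fun τ => heatFn Λ u v τ (x - z)) t := by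
  have hD := damped_dualVec (gramDet_pos hΛ)
  set f := fun y => heatFn Λ u v t (x - y) with hfdef
  have hf : ContDiff ℝ 2 f := (contDiff_heatFn hΛ 2 ht).comp (by fun_prop)
  have hf1 : ContDiff ℝ 1 (fderiv ℝ f) := hf.fderiv_right (by norm_num)
  set V := (volume : Measure Plane).real (latticeCell Λ)
  set ξ := dualVec u v
  set lam : ℤ × ℤ → ℝ := fun p => ‖ξ p‖ ^ 2
  set om : ℤ × ℤ → Plane →L[ℝ] ℝ := fun p => innerSL ℝ (ξ p)
  have hline : ∀ e y : Plane, HasDerivAt (fun s : ℝ => y + s • e) e 0 := fun e y => by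
    simpa using ((hasDerivAt_id (0 : ℝ)).smul_const e).const_add y
  have hline' : ∀ e y : Plane, HasDerivAt (fun s : ℝ => x - (y + s • e)) (-e) 0 := fun e y =>
    (hline e y).const_sub x
  have key : ∀ e : Plane, fderiv ℝ (fderiv ℝ f) z e e =
      V⁻¹ * trigSeries lam om (fun p => om p (-e) * (om p (-e) * 1))
        (fun _ => 0 + π / 2 + π / 2) (t, x - z) :=
    fun e => by
      have d1 : ∀ y, fderiv ℝ f y e =
          V⁻¹ * trigSeries lam om (fun p => om p (-e) * 1) (fun _ => 0 + π / 2) (t, x - y) :=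
        fun y => by
          have h := (hf.differentiable (by norm_num) y).hasFDerivAt
          have h1 := HasFDerivAt.comp_hasDerivAt (0 : ℝ) (by simpa using h) (hline e y)
          have h2 := (hD.hasDerivAt_space (th := fun _ => 0) ht (hline' e y)).const_mul V⁻¹
          have := h1.unique h2
          simpa using this
      have h := (hf1.differentiable (by norm_num) z).hasFDerivAt
      have h1 := (HasFDerivAt.comp_hasDerivAt (0 : ℝ) (l := fderiv ℝ f)
        (by simpa using h) (hline e z)).clm_apply (hasDerivAt_const (0 : ℝ) e)
      have h2 := ((hD.space (-e)).hasDerivAt_space (th := fun _ => 0 + π / 2) ht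
        (hline' e z)).const_mul V⁻¹
      have h3 : HasDerivAt (fun s : ℝ => fderiv ℝ f (z + s • e) e) _ 0 := h1
      simp only [d1] at h3
      have := h3.unique h2
      simpa using this
  rw [(hasDerivAt_heatFn hΛ ht (x - z)).deriv]
  set b := stdOrthonormalBasis ℝ Plane with hb
  rw [InnerProductSpace.laplacian_eq_iteratedFDeriv_orthonormalBasis _ b]
  simp only [iteratedFDeriv_two_apply, Matrix.cons_val_zero, Matrix.cons_val_one, key]
  rw [← Finset.mul_sum]
  congr 1
  have hs := fun i => ((hD.space (-b i)).space (-b i)).summable_term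
    (th := fun _ => 0 + π / 2 + π / 2) ht (x - z)
  simp only [trigSeries]
  rw [← Summable.tsum_finsetSum fun i _ => hs i]
  refine tsum_congr fun p => ?_
  -- Two derivatives along each basis vector shift the phase by π, giving minus the squared
  -- component of ξ; by Parseval these sum to -|ξ|², the coefficient of the time derivative.
  have h := b.sum_sq_norm_inner_left (ξ p)
  rw [mul_one, ← Finset.smul_sum, zero_add, add_halves, Real.cos_add_pi, add_zero, mul_neg, neg_smul,
    smul_neg]
  congr 2
  refine Eq.trans ?_ h
  refine Finset.sum_congr rfl fun i _ => ?_
  rw [Real.norm_eq_abs, sq_abs]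
  simp only [om, innerSL_apply_apply, inner_neg_right]
  ring

-- The characteristic function of the Gaussian; the scale √(2t) gives the decay exp(-|ξ|² t) of the
-- heat equation without the factor 1/2.
omit hΛ [DiscreteTopology Λ] [IsZLattice ℝ Λ] in
lemma integral_planeWave_stdGaussian {t : ℝ} (ht : 0 < t) (ξ x : Plane) (θ : ℝ) :
    ∫ z, planeWave ξ θ (x + √(2 * t) • z) ∂(ProbabilityTheory.stdGaussian Plane) =
      Real.exp (-(‖ξ‖ ^ 2 * t)) * planeWave ξ θ x := by
  have h := ProbabilityTheory.charFun_stdGaussian (√(2 * t) • ξ)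
  rw [charFun_apply] at h
  have h1 : ∀ z : Plane, planeWave ξ θ (x + √(2 * t) • z) = RCLike.re
      (Complex.exp (⟪z, √(2 * t) • ξ⟫_ℝ * Complex.I) *
        Complex.exp ((⟪ξ, x⟫_ℝ + θ : ℝ) * Complex.I)) := fun z => by
    rw [← Complex.exp_add, ← add_mul, ← Complex.ofReal_add, RCLike.re_eq_complex_re,
      Complex.exp_ofReal_mul_I_re, planeWave, inner_add_right, real_inner_smul_right,
      real_inner_smul_right, real_inner_comm ξ z]
    congr 1; ring
  simp only [h1]
  rw [integral_re, integral_mul_const, h]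
  · have h2 : ‖√(2 * t) • ξ‖ ^ 2 = 2 * t * ‖ξ‖ ^ 2 := by
      rw [norm_smul, mul_pow, Real.norm_eq_abs, sq_abs, Real.sq_sqrt (by positivity)]
    have h3 : Complex.exp (-(‖√(2 * t) • ξ‖ : ℂ) ^ 2 / 2) =
        ((Real.exp (-(‖ξ‖ ^ 2 * t)) : ℝ) : ℂ) := by
      rw [← Complex.ofReal_pow, h2, Complex.ofReal_exp]
      congr 1
      push_cast
      ring
    rw [h3, RCLike.re_eq_complex_re, Complex.re_ofReal_mul, Complex.exp_ofReal_mul_I_re, planeWave]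
  · refine Integrable.of_bound (C := 1) (by fun_prop) (Eventually.of_forall fun z => ?_)
    rw [norm_mul, Complex.norm_exp_ofReal_mul_I, Complex.norm_exp_ofReal_mul_I, mul_one]

/-- The heat kernel integrates continuous functions like a Gaussian of variance `2 t`. -/
lemma setIntegral_heatFn_eq_gaussian {t : ℝ} (ht : 0 < t) (x : Plane) (f : C(FlatTorus Λ, ℝ)) :
    ∫ y in latticeCell Λ, heatFn Λ u v t (x - y) * f (torusProj Λ y) =
      ∫ z, f (torusProj Λ (x + √(2 * t) • z)) ∂(ProbabilityTheory.stdGaussian Plane) := by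
  have hc2 : Continuous fun y => heatFn Λ u v t (x - y) :=
    (contDiff_heatFn hΛ 2 ht).continuous.comp (by fun_prop)
  have hI : Integrable (fun y => heatFn Λ u v t (x - y)) (volume.restrict (latticeCell Λ)) :=
    integrableOn_latticeCell hc2
  have hφ : Continuous fun z : Plane => torusProj Λ (x + √(2 * t) • z) :=
    (continuous_torusProj Λ).comp (by fun_prop)
  -- Testing on plane waves suffices, so neither positivity of the kernel nor Poisson summation is
  -- needed.
  have h := eq_zero_of_torusWave hΛ
    (pullbackIntegral hI (continuous_torusProj Λ) - pullbackIntegral (ν := ProbabilityTheory.stdGaussian Plane)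
      (integrable_const (1 : ℝ)) hφ) (fun q θ => by
      rw [_root_.sub_apply, pullbackIntegral_apply, pullbackIntegral_apply]
      simp only [torusWave_torusProj, one_mul]
      rw [setIntegral_heatFn_mul hΛ ht, sub_eq_zero]
      exact (integral_planeWave_stdGaussian ht _ x θ).symm) f
  rw [_root_.sub_apply, pullbackIntegral_apply, pullbackIntegral_apply] at h
  simpa only [one_mul, sub_eq_zero] using h

/-- Periodicity makes the choice of representatives irrelevant. The initial condition follows from
the Gaussian form by dominated convergence as √(2t) tends to 0. -/
theorem isHeatKernel_heatFn :
    IsHeatKernel Λ fun t x y => heatFn Λ u v t (Quotient.out x - Quotient.out y) := by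
  have hout : ∀ (t : ℝ) (x : Plane) (q : Plane),
      heatFn Λ u v t (x - Quotient.out (torusProj Λ q)) = heatFn Λ u v t (x - q) := by
    intro t x q
    obtain ⟨l, hl, h⟩ := exists_out_torusProj (Λ := Λ) q
    rw [h, ← heatFn_periodic hΛ t (x - q) (-l) (neg_mem hl)]
    congr 1
    abel
  refine ⟨fun x => ?_, fun x t ht p => ?_, fun x f hf => ?_⟩
  · simp only [hout]
    exact (contDiffOn_heatFn hΛ 2).comp (f := fun q : ℝ × Plane => (q.1, Quotient.out x - q.2))
      (by fun_prop) fun z hz => ⟨hz.1, mem_univ _⟩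
  · simp only [hout]
    exact (laplacian_heatFn_sub hΛ ht _ p).symm
  · obtain ⟨x, rfl⟩ := torusProj_surjective x
    have hev : ∀ t ∈ Ioi (0 : ℝ), ∫ y, heatFn Λ u v t (Quotient.out (torusProj Λ x) -
        Quotient.out y) * f y ∂(torusVolume Λ) =
        ∫ z, f (torusProj Λ (Quotient.out (torusProj Λ x) + √(2 * t) • z))
          ∂(ProbabilityTheory.stdGaussian Plane) := fun t ht => by
      have hc : Continuous fun y : FlatTorus Λ =>
          heatFn Λ u v t (Quotient.out (torusProj Λ x) - Quotient.out y) :=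
        continuous_of_comp_torusProj (by
          simp only [hout]
          exact (contDiff_heatFn hΛ 2 ht).continuous.comp (by fun_prop))
      rw [integral_torusVolume (f := fun y => heatFn Λ u v t (Quotient.out (torusProj Λ x) -
        Quotient.out y) * f y) (hc.mul hf)]
      simp only [hout]
      exact setIntegral_heatFn_eq_gaussian hΛ ht _ ⟨f, hf⟩
    set w := Quotient.out (torusProj Λ x) with hw
    have hx : torusProj Λ w = torusProj Λ x := Quotient.out_eq _
    refine Tendsto.congr' (eventually_nhdsWithin_of_forall fun t ht => (hev t ht).symm) ?_
    have hcont := continuous_torusProj Λ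
    have hlim := tendsto_integral_filter_of_dominated_convergence (l := 𝓝[>] (0 : ℝ))
      (μ := ProbabilityTheory.stdGaussian Plane)
      (F := fun t z => f (torusProj Λ (w + √(2 * t) • z))) (f := fun _ => f (torusProj Λ x))
      (fun _ => ‖(⟨f, hf⟩ : C(FlatTorus Λ, ℝ))‖)
      (Eventually.of_forall fun t => (hf.comp (hcont.comp (by fun_prop))).aestronglyMeasurable)
      (Eventually.of_forall fun t => Eventually.of_forall fun z =>
        (⟨f, hf⟩ : C(FlatTorus Λ, ℝ)).norm_coe_le_norm _)
      (integrable_const _) (Eventually.of_forall fun z => by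
        have h : Continuous fun t : ℝ => f (torusProj Λ (w + √(2 * t) • z)) :=
          hf.comp (hcont.comp (by fun_prop))
        have h2 := h.tendsto 0
        simp only [mul_zero, Real.sqrt_zero, zero_smul, add_zero, hx] at h2
        exact h2.mono_left nhdsWithin_le_nhds)
    simpa using hlim

end Existence

/-! ### Minimal geodesics -/

section Geodesics

variable {Λ : Submodule ℤ Plane}

lemma le_dist_torusProj_iff {p q : Plane} {r : ℝ} :
    r ≤ dist (torusProj Λ p) (torusProj Λ q) ↔ ∀ l ∈ Λ, r ≤ ‖p - q + l‖ := by
  rw [dist_eq_norm]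
  have h : torusProj Λ p - torusProj Λ q = torusProj Λ (p - q) := rfl
  rw [h, QuotientAddGroup.le_norm_iff]
  constructor
  · exact fun H l hl => H _ (torusProj_add hl)
  · intro H m hm
    have h1 := H (m - (p - q)) (torusProj_eq_iff.1 (Eq.symm hm))
    rwa [add_sub_cancel] at h1

lemma dist_torusProj_le (p q : Plane) : dist (torusProj Λ p) (torusProj Λ q) ≤ ‖p - q‖ := by
  simpa using le_dist_torusProj_iff.1 le_rfl 0 Λ.zero_mem

/-- A vector at minimal distance from the origin among its translates projects to a minimal
geodesic. -/
lemma isMinimalGeodesic_of_norm_le {q : Plane} (hq : q ≠ 0) (h : ∀ l ∈ Λ, ‖q‖ ≤ ‖q + l‖) :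
    IsMinimalGeodesic Λ (fun s => torusProj Λ (s • q)) 1 := by
  refine ⟨0, q, hq, fun s _ => by rw [zero_add], ?_⟩
  simp only [zero_smul, one_smul, one_mul]
  rw [dist_comm]
  exact le_antisymm (by simpa using dist_torusProj_le (Λ := Λ) q 0)
    (le_dist_torusProj_iff.2 fun l hl => by simpa using h l hl)

lemma norm_le_of_dist_torusProj {p w : Plane}
    (h : dist (torusProj Λ p) (torusProj Λ (p + w)) = ‖w‖) (l : Plane) (hl : l ∈ Λ) :
    ‖w‖ ≤ ‖w + l‖ := by
  have h1 := le_dist_torusProj_iff.1 h.ge (-l) (neg_mem hl)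
  rwa [sub_add_cancel_left, ← neg_add, norm_neg] at h1

lemma two_mul_inner_le_of_norm_le {w l : Plane} (h : ‖w‖ ≤ ‖w + l‖) :
    -(2 * ⟪w, l⟫_ℝ) ≤ ‖l‖ ^ 2 := by
  have := pow_le_pow_left₀ (norm_nonneg w) h 2
  rw [norm_add_sq_real] at this
  linarith

lemma norm_le_of_two_mul_inner_le {w l : Plane} (h : -(2 * ⟪w, l⟫_ℝ) ≤ ‖l‖ ^ 2) :
    ‖w‖ ≤ ‖w + l‖ := by
  refine (sq_le_sq₀ (norm_nonneg _) (norm_nonneg _)).1 ?_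
  rw [norm_add_sq_real]
  linarith

end Geodesics

/-! ### Triangular lattices -/

section Triangular

variable {Λ : Submodule ℤ Plane} [DiscreteTopology Λ] [IsZLattice ℝ Λ] {u v : Plane}
  (hΛ : Λ = Submodule.span ℤ {u, v})
include hΛ

lemma heatFn_eq_hexTheta {L : ℝ} (hu : ‖u‖ = L) (hv : ‖v‖ = L) (huv : ⟪u, v⟫_ℝ = -L ^ 2 / 2)
    (t a b : ℝ) : heatFn Λ u v t (a • u + b • v) =
      ((volume : Measure Plane).real (latticeCell Λ))⁻¹ *
        hexTheta (16 * π ^ 2 / (3 * L ^ 2) * t) a b := by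
  have hD := gramDet_pos hΛ
  have hG : gramDet u v = 3 / 4 * L ^ 4 := by rw [gramDet, hu, hv, huv]; ring
  have hL : L ≠ 0 := by
    rintro rfl
    rw [hG] at hD
    norm_num at hD
  rw [heatFn_eq, hexTheta]
  congr 1
  refine tsum_congr fun p => ?_
  rw [norm_sq_dualVec hD, planeWave, inner_dualVec hD, hG, hu, hv, huv, add_zero]
  congr 2
  field_simp
  ring

lemma strictAntiOn_heatFn {L : ℝ} (hu : ‖u‖ = L) (hv : ‖v‖ = L) (huv : ⟪u, v⟫_ℝ = -L ^ 2 / 2)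
    {t : ℝ} (ht : 0 < t) {w : Plane} (hw : w ≠ 0) (hmin : ∀ l ∈ Λ, ‖w‖ ≤ ‖w + l‖) :
    StrictAntiOn (fun s : ℝ => heatFn Λ u v t (s • w)) (Icc 0 1) := by
  have hD := gramDet_pos hΛ
  have hL : 0 < L ^ 2 := by
    have h : L ≠ 0 := by
      rintro rfl
      rw [gramDet, hu, hv, huv] at hD
      norm_num at hD
    positivity
  obtain ⟨a, b, rfl⟩ := exists_coords hΛ w
  have hin : ∀ m n : ℤ, -(2 * (a * (m - n / 2) + b * (n - m / 2))) ≤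
      (m ^ 2 - m * n + n ^ 2 : ℝ) := fun m n => by
    have h := two_mul_inner_le_of_norm_le (hmin _ ((mem_lattice_iff hΛ).2 ⟨m, n, rfl⟩))
    rw [← real_inner_self_eq_norm_sq] at h
    simp only [inner_add_left, inner_add_right, real_inner_smul_left, real_inner_smul_right,
      real_inner_self_eq_norm_sq, real_inner_comm u v, huv, norm_smul, mul_pow, Real.norm_eq_abs,
      sq_abs, hu, hv] at h
    refine le_of_mul_le_mul_right ?_ hL
    linarith
  -- The lattice vectors ±u, ±v, ±(u + v), all of length L, give the six faces of the hexagonal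
  -- Voronoi cell.
  have h10 := hin 1 0
  have h10' := hin (-1) 0
  have h01 := hin 0 1
  have h01' := hin 0 (-1)
  have h11 := hin 1 1
  have h11' := hin (-1) (-1)
  push_cast at h10 h10' h01 h01' h11 h11'
  have hV := inv_pos.2 (volume_latticeCell_pos Λ)
  have hab : a ≠ 0 ∨ b ≠ 0 := by
    by_contra hcon
    push Not at hcon
    exact hw (by rw [hcon.1, hcon.2, zero_smul, zero_smul, add_zero])
  have key := hexTheta_strictAntiOn (τ := 16 * π ^ 2 / (3 * L ^ 2) * t) (by positivity) hab
    (abs_le.2 ⟨by linarith, by linarith⟩) (abs_le.2 ⟨by linarith, by linarith⟩)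
    (abs_le.2 ⟨by linarith, by linarith⟩)
  intro x hx y hy hxy
  simp only [smul_add, smul_smul]
  rw [heatFn_eq_hexTheta hΛ hu hv huv, heatFn_eq_hexTheta hΛ hu hv huv]
  exact mul_lt_mul_of_pos_left (key hx hy hxy) hV

end Triangular

theorem IsHeatKernel.strictlyGeodesicallyDecreasing {Λ : Submodule ℤ Plane} [DiscreteTopology Λ]
    [IsZLattice ℝ Λ] {K : ℝ → FlatTorus Λ → FlatTorus Λ → ℝ} (hK : IsHeatKernel Λ K)
    (hΛ : IsRegularTriangularLattice Λ) {t : ℝ} (ht : 0 < t) :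
    StrictlyGeodesicallyDecreasing Λ (K t) := by
  obtain ⟨u, v, -, huv, hang, hspan⟩ := hΛ
  have hin : ⟪u, v⟫_ℝ = -‖u‖ ^ 2 / 2 := by
    rw [← InnerProductGeometry.cos_angle_mul_norm_mul_norm, hang, ← huv,
      show 2 * π / 3 = π - π / 3 by ring, Real.cos_pi_sub, Real.cos_pi_div_three]
    ring
  rintro x γ s₀ ⟨p, w, hw, hγ, hdist⟩ rfl a ha b hb hab
  have hs₀ : 0 < s₀ := ha.1.trans_lt (hab.trans_le hb.2)
  have h0 : γ 0 = torusProj Λ p := by rw [hγ 0 ⟨le_rfl, hs₀.le⟩, zero_smul, add_zero]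
  have hnorm : ‖s₀ • w‖ = s₀ * ‖w‖ := by rw [norm_smul, Real.norm_of_nonneg hs₀.le]
  rw [h0, hγ s₀ ⟨hs₀.le, le_rfl⟩, ← hnorm] at hdist
  -- The sign appears because the kernel is a function of pole minus endpoint.
  have hmin : ∀ l ∈ Λ, ‖-(s₀ • w)‖ ≤ ‖-(s₀ • w) + l‖ := fun l hl => by
    have := norm_le_of_dist_torusProj hdist (-l) (neg_mem hl)
    rwa [norm_neg, ← norm_neg (-(s₀ • w) + l), neg_add, neg_neg]
  have hanti := strictAntiOn_heatFn hspan rfl huv.symm hin ht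
    (neg_ne_zero.2 (smul_ne_zero hs₀.ne' hw)) hmin
  have hval : ∀ s ∈ Icc 0 s₀, K t (γ 0) (γ s) = heatFn Λ u v t ((s / s₀) • -(s₀ • w)) :=
    fun s hs => by
      rw [h0, hγ s hs, hK.eq_heatFn hspan ht, sub_add_cancel_left, smul_neg, smul_smul,
        div_mul_cancel₀ _ hs₀.ne']
  simp only [hval a ha, hval b hb]
  exact hanti ⟨div_nonneg ha.1 hs₀.le, (div_le_one hs₀).2 ha.2⟩
    ⟨div_nonneg hb.1 hs₀.le, (div_le_one hs₀).2 hb.2⟩ ((div_lt_div_iff_of_pos_right hs₀).2 hab)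

/-! ### Reduced bases -/

section Reduced

variable (Λ : Submodule ℤ Plane) [DiscreteTopology Λ] [IsZLattice ℝ Λ]

lemma exists_eq_span_pair : ∃ u v : Plane, Λ = Submodule.span ℤ {u, v} := by
  have h2 : Module.finrank ℤ Λ = 2 := by
    rw [ZLattice.rank ℝ Λ]
    simp
  set b := Module.finBasisOfFinrankEq ℤ Λ h2
  refine ⟨b 0, b 1, ?_⟩
  have h := congrArg (Submodule.map Λ.subtype) b.span_eq
  rw [Submodule.map_span, Submodule.map_top, Submodule.range_subtype, ← range_comp] at h
  refine h.symm.trans (congrArg _ ?_)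
  ext x
  simp [eq_comm]

/-- Minimising the sum of squared lengths performs the whole reduction at once; only finitely many
bases lie below any given one. -/
lemma exists_isMinOn_span_pair : ∃ u v : Plane, Λ = Submodule.span ℤ {u, v} ∧
    ∀ u' v' : Plane, Λ = Submodule.span ℤ {u', v'} →
      ‖u‖ ^ 2 + ‖v‖ ^ 2 ≤ ‖u'‖ ^ 2 + ‖v'‖ ^ 2 := by
  obtain ⟨u₀, v₀, h₀⟩ := exists_eq_span_pair Λ
  set R := ‖u₀‖ + ‖v₀‖ with hR
  have hfin : (Metric.closedBall (0 : Plane) R ∩ (Λ : Set Plane)).Finite := by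
    have : DiscreteTopology Λ.toAddSubgroup := ‹DiscreteTopology Λ›
    exact Metric.finite_isBounded_inter_isClosed ⟨‹DiscreteTopology Λ›⟩ Metric.isBounded_closedBall
      (AddSubgroup.isClosed_of_discrete (H := Λ.toAddSubgroup))
  set S := {q : Plane × Plane | Λ = Submodule.span ℤ {q.1, q.2} ∧
    ‖q.1‖ ^ 2 + ‖q.2‖ ^ 2 ≤ ‖u₀‖ ^ 2 + ‖v₀‖ ^ 2} with hS
  have hSf : S.Finite := by
    refine (hfin.prod hfin).subset fun q hq => ?_
    have hle : ∀ r : ℝ, r ^ 2 ≤ ‖u₀‖ ^ 2 + ‖v₀‖ ^ 2 → r ≤ R := fun r hr => by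
      refine le_of_abs_le (abs_le_of_sq_le_sq (hr.trans ?_) (by positivity))
      rw [hR]
      nlinarith [mul_nonneg (norm_nonneg u₀) (norm_nonneg v₀)]
    refine ⟨⟨?_, ?_⟩, ⟨?_, ?_⟩⟩
    · rw [mem_closedBall_zero_iff]
      exact hle _ (by nlinarith [hq.2, sq_nonneg ‖q.2‖])
    · rw [hq.1]; exact Submodule.subset_span (by simp)
    · rw [mem_closedBall_zero_iff]
      exact hle _ (by nlinarith [hq.2, sq_nonneg ‖q.1‖])
    · rw [hq.1]; exact Submodule.subset_span (by simp)
  obtain ⟨⟨u, v⟩, huv, hmin⟩ := exists_min_image S (fun q => ‖q.1‖ ^ 2 + ‖q.2‖ ^ 2) hSf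
    ⟨(u₀, v₀), h₀, le_rfl⟩
  refine ⟨u, v, huv.1, fun u' v' h' => ?_⟩
  by_cases h : ‖u'‖ ^ 2 + ‖v'‖ ^ 2 ≤ ‖u₀‖ ^ 2 + ‖v₀‖ ^ 2
  · exact hmin (u', v') ⟨h', h⟩
  · exact huv.2.trans (not_le.1 h).le

lemma span_pair_add (u v : Plane) :
    Submodule.span ℤ {u + v, v} = Submodule.span ℤ ({u, v} : Set Plane) := by
  refine le_antisymm ?_ ?_ <;> rw [Submodule.span_le] <;> rintro x (rfl | rfl)
  · exact Submodule.mem_span_pair.2 ⟨1, 1, by simp⟩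
  · exact Submodule.mem_span_pair.2 ⟨0, 1, by simp⟩
  · exact Submodule.mem_span_pair.2 ⟨1, -1, by simp⟩
  · exact Submodule.mem_span_pair.2 ⟨0, 1, by simp⟩

lemma span_pair_neg (u v : Plane) :
    Submodule.span ℤ {u, -v} = Submodule.span ℤ ({u, v} : Set Plane) := by
  refine le_antisymm ?_ ?_ <;> rw [Submodule.span_le] <;> rintro x (rfl | rfl)
  · exact Submodule.mem_span_pair.2 ⟨1, 0, by simp⟩
  · exact Submodule.mem_span_pair.2 ⟨0, -1, by simp⟩
  · exact Submodule.mem_span_pair.2 ⟨1, 0, by simp⟩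
  · exact Submodule.mem_span_pair.2 ⟨0, -1, by simp⟩

/-- Every lattice has an obtuse reduced basis. -/
lemma exists_reduced_basis : ∃ u v : Plane, Λ = Submodule.span ℤ {u, v} ∧ ⟪u, v⟫_ℝ ≤ 0 ∧
    -(2 * ⟪u, v⟫_ℝ) ≤ ‖u‖ ^ 2 ∧ ‖u‖ ^ 2 ≤ ‖v‖ ^ 2 := by
  obtain ⟨u, v, hspan, hmin⟩ := exists_isMinOn_span_pair Λ
  wlog huv : ‖u‖ ^ 2 ≤ ‖v‖ ^ 2 generalizing u v
  · refine this v u (by rw [pair_comm]; exact hspan) (fun u' v' h => ?_) (not_le.1 huv).le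
    have := hmin u' v' h
    linarith
  wlog hneg : ⟪u, v⟫_ℝ ≤ 0 generalizing v
  · refine this (-v) (by rw [span_pair_neg]; exact hspan) (fun u' v' h => ?_) (by rwa [norm_neg]) ?_
    · rw [norm_neg]; exact hmin u' v' h
    · rw [inner_neg_right]; linarith
  -- Minimality against the basis u, u + v is exactly the reduction inequality.
  have h := hmin u (v + u) (by rw [pair_comm, span_pair_add, pair_comm]; exact hspan)
  rw [norm_add_sq_real, real_inner_comm] at h
  exact ⟨u, v, hspan, hneg, by linarith, huv⟩

end Reduced

/-! ### Large times -/

section LargeTime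

variable {Λ : Submodule ℤ Plane} [DiscreteTopology Λ] [IsZLattice ℝ Λ] {u v : Plane}
  (hΛ : Λ = Submodule.span ℤ {u, v})
include hΛ

open scoped Classical in
/-- For large times the heat kernel is governed by the smallest nonzero eigenvalue. -/
lemma tendsto_exp_mul_heatFn {μ : ℝ} (hμ : ∀ p ≠ 0, μ ≤ ‖dualVec u v p‖ ^ 2) {t : ℕ → ℝ}
    (ht : Tendsto t atTop atTop) (z : Plane) :
    Tendsto (fun k => Real.exp (μ * t k) *
        ((volume : Measure Plane).real (latticeCell Λ) * heatFn Λ u v (t k) z - 1)) atTop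
      (𝓝 (∑' p, if p ≠ 0 ∧ ‖dualVec u v p‖ ^ 2 = μ then planeWave (dualVec u v p) 0 z else 0)) := by
  have hD := damped_dualVec (gramDet_pos hΛ)
  have hV := (volume_latticeCell_pos Λ).ne'
  have hsum : ∀ τ : ℝ, 0 < τ → Summable fun p => Real.exp (-(‖dualVec u v p‖ ^ 2 * τ)) :=
    fun τ hτ => by simpa using hD.summable τ hτ
  -- For t ≥ 1 and nonzero p, the exponent (μ - |ξ|²) t is at most its value at t = 1, since μ is a
  -- lower bound for the eigenvalues.
  have hb : Summable fun p => Real.exp μ * Real.exp (-(‖dualVec u v p‖ ^ 2 * 1)) :=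
    (hsum 1 one_pos).mul_left _
  have key := tendsto_tsum_of_dominated_convergence hb (𝓕 := atTop)
    (f := fun k p => if p = 0 then 0 else
      Real.exp ((μ - ‖dualVec u v p‖ ^ 2) * t k) * planeWave (dualVec u v p) 0 z)
    (g := fun p => if p ≠ 0 ∧ ‖dualVec u v p‖ ^ 2 = μ then planeWave (dualVec u v p) 0 z else 0)
    (fun p => ?_) ?_
  · refine key.congr' ?_
    filter_upwards [ht.eventually_gt_atTop 0] with k hk
    have hs : Summable fun p => Real.exp (-(‖dualVec u v p‖ ^ 2 * t k)) *
        planeWave (dualVec u v p) 0 z := by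
      refine Summable.of_norm_bounded (hsum _ hk) fun p => ?_
      rw [norm_mul, Real.norm_of_nonneg (Real.exp_pos _).le, Real.norm_eq_abs]
      exact mul_le_of_le_one_right (Real.exp_pos _).le (abs_planeWave_le _ _ _)
    have h0 : dualVec u v 0 = 0 := by simp [dualVec]
    rw [heatFn_eq, mul_inv_cancel_left₀ hV, hs.tsum_eq_add_tsum_ite 0, h0]
    simp only [planeWave, inner_zero_left, norm_zero, add_zero, Real.cos_zero]
    norm_num
    rw [← tsum_mul_left]
    refine tsum_congr fun p => ?_
    split_ifs
    · rw [mul_zero]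
    · rw [← mul_assoc, ← Real.exp_add]
      congr 2
      ring
  · by_cases hp : p = 0
    · simp [hp]
    · simp only [hp, if_false, ne_eq, not_false_eq_true, true_and]
      split_ifs with h
      · simp only [h, sub_self, zero_mul, Real.exp_zero, one_mul]
        exact tendsto_const_nhds
      · have hlt : μ - ‖dualVec u v p‖ ^ 2 < 0 := sub_neg.2 (lt_of_le_of_ne (hμ p hp) (Ne.symm h))
        have := (Real.tendsto_exp_atBot.comp (ht.const_mul_atTop_of_neg hlt)).mul_const
          (planeWave (dualVec u v p) 0 z)
        rwa [zero_mul] at this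
  · filter_upwards [ht.eventually_ge_atTop 1] with k hk p
    split_ifs with hp
    · rw [norm_zero]; positivity
    · rw [norm_mul, Real.norm_of_nonneg (Real.exp_pos _).le, Real.norm_eq_abs, ← Real.exp_add]
      refine (mul_le_of_le_one_right (Real.exp_pos _).le (abs_planeWave_le _ _ _)).trans
        (Real.exp_le_exp.2 ?_)
      nlinarith [hμ p hp]

end LargeTime

/-! ### The first eigenfunction on the boundary of the Voronoi cell. -/

/-- The minimum of an obtuse reduced binary form on nonzero integer vectors. -/
lemma reduced_form_cases {A C α : ℝ} (hα : 0 < α) (hA : 2 * α ≤ A) (hAC : A ≤ C) (hC : 2 * α < C)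
    {p : ℤ × ℤ} (hp : p ≠ 0) :
    p ∈ ({(0, 1), (0, -1), (1, 0), (-1, 0)} : Finset (ℤ × ℤ)) ∨
      A < C * p.1 ^ 2 + 2 * α * p.1 * p.2 + A * p.2 ^ 2 := by
  obtain ⟨m, n⟩ := p
  have key : ∀ k : ℤ, k ≠ 0 → k ≠ 1 → k ≠ -1 → (4 : ℝ) ≤ (k : ℝ) ^ 2 := fun k h0 h1 h2 => by
    have : (4 : ℤ) ≤ k ^ 2 := by
      rcases (by omega : 2 ≤ k ∨ k ≤ -2) with h | h <;> nlinarith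
    exact_mod_cast this
  have one : ∀ k : ℤ, k ≠ 0 → (1 : ℝ) ≤ (k : ℝ) ^ 2 := fun k h0 => by
    have : (1 : ℤ) ≤ k ^ 2 := by
      rcases (by omega : 1 ≤ k ∨ k ≤ -1) with h | h <;> nlinarith
    exact_mod_cast this
  simp only [Finset.mem_insert, Finset.mem_singleton, Prod.mk.injEq]
  by_cases hm : m = 0
  · by_cases h1 : n = 1
    · exact Or.inl (Or.inl ⟨hm, h1⟩)
    by_cases h2 : n = -1
    · exact Or.inl (Or.inr (Or.inl ⟨hm, h2⟩))
    right
    have hn : n ≠ 0 := fun h => hp (by rw [hm, h]; rfl)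
    have := key n hn h1 h2
    simp only [hm, Int.cast_zero]
    nlinarith
  · by_cases hn : n = 0
    · by_cases h1 : m = 1
      · exact Or.inl (Or.inr (Or.inr (Or.inl ⟨h1, hn⟩)))
      by_cases h2 : m = -1
      · exact Or.inl (Or.inr (Or.inr (Or.inr ⟨h2, hn⟩)))
      right
      have := key m hm h1 h2
      simp only [hn, Int.cast_zero]
      nlinarith
    · right
      -- The form equals (C - α)m² + (A - α)n² + α(m + n)², at least A + C - 2α > A when m and n are
      -- both nonzero.
      have h1 := mul_le_mul_of_nonneg_left (one m hm) (by linarith : 0 ≤ C - α)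
      have h2 := mul_le_mul_of_nonneg_left (one n hn) (by linarith : 0 ≤ A - α)
      have h3 := mul_nonneg hα.le (sq_nonneg ((m : ℝ) + n))
      nlinarith

/-- For an obtuse reduced basis which is neither orthogonal nor of equal lengths at an angle of
`2π/3`, some vector minimises the distance to the origin along a point where the leading
eigenfunction increases. -/
lemma not_leading_decreasing {A C α c a : ℝ} (hα : 0 < α) (hA : 2 * α ≤ A) (hAC : A ≤ C)
    (hc1 : c ≤ 1) (ha : a = α / (4 * C))
    (hanti : AntitoneOn (fun s : ℝ => 2 * Real.cos (2 * π * (s * (1 / 2 + a * α / C))) +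
      c * (2 * Real.cos (2 * π * (s * a)))) (Icc 0 1)) : False := by
  have hC0 : 0 < C := by linarith
  have ha0 : 0 < a := by rw [ha]; positivity
  have ha8 : a ≤ 1 / 8 := by
    rw [ha, div_le_div_iff₀ (by positivity) (by norm_num)]
    linarith
  set b := 1 / 2 + a * α / C with hb
  have hd : ∀ x : ℝ, HasDerivAt (fun s : ℝ => 2 * Real.cos (2 * π * (s * x)))
      (-(4 * π * x * Real.sin (2 * π * x))) 1 := fun x => by
    have h1 : HasDerivAt (fun s : ℝ => 2 * π * (s * x)) (2 * π * (1 * x)) 1 :=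
      ((hasDerivAt_id (1 : ℝ)).mul_const x).const_mul _
    refine (h1.cos.const_mul 2).congr_deriv ?_
    rw [one_mul]; ring
  have h1 := ((hd b).add ((hd a).const_mul c)).hasDerivWithinAt (s := Icc 0 1)
  have h2 := h1.derivWithin (uniqueDiffOn_Icc one_pos 1 ⟨zero_le_one, le_rfl⟩)
  have h3 := hanti.derivWithin_nonpos (x := 1)
  have h4 : -(4 * π * b * Real.sin (2 * π * b)) + c * -(4 * π * a * Real.sin (2 * π * a)) ≤ 0 :=
    h2.symm.le.trans h3
  have hπ := Real.pi_pos
  have hs : Real.sin (2 * π * b) = -Real.sin (2 * π * (a * α / C)) := by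
    rw [hb, show 2 * π * (1 / 2 + a * α / C) = 2 * π * (a * α / C) + π by ring, Real.sin_add_pi]
  -- The choice a = α/(4C) makes the overshoot of b beyond 1/2 quadratic in a, so that gain and loss
  -- at s = 1 become comparable multiples of a².
  have hx : a * α / C = 4 * a ^ 2 := by rw [ha]; field_simp
  rw [hs, hx] at h4
  have hb2 : 1 / 2 ≤ b := by rw [hb, hx]; nlinarith
  have ha2 : a ^ 2 ≤ 1 / 64 := by nlinarith
  have h5 := Real.mul_le_sin (x := 2 * π * (4 * a ^ 2)) (by positivity) (by nlinarith)
  have h6 : 2 / π * (2 * π * (4 * a ^ 2)) = 16 * a ^ 2 := by field_simp; ring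
  rw [h6] at h5
  have h7 : Real.sin (2 * π * a) < 2 * π * a := Real.sin_lt (by positivity)
  have h8 : 0 ≤ Real.sin (2 * π * a) :=
    Real.sin_nonneg_of_nonneg_of_le_pi (by positivity) (by nlinarith)
  have h9 : b * Real.sin (2 * π * (4 * a ^ 2)) ≤ c * (a * Real.sin (2 * π * a)) := by
    have : 4 * π * (b * Real.sin (2 * π * (4 * a ^ 2))) ≤
      4 * π * (c * (a * Real.sin (2 * π * a))) := by nlinarith
    exact le_of_mul_le_mul_left this (by positivity)
  have h10 : 1 / 2 * (16 * a ^ 2) ≤ b * Real.sin (2 * π * (4 * a ^ 2)) := by gcongr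
  have h11 : c * (a * Real.sin (2 * π * a)) ≤ 1 * (a * (2 * π * a)) := by gcongr
  -- The gain is at least 8a² by Jordan's inequality and the loss at most 2πa², which contradicts π
  -- < 4.
  nlinarith [Real.pi_lt_four, sq_pos_of_pos ha0]

section LargeTime

variable {Λ : Submodule ℤ Plane} [DiscreteTopology Λ] [IsZLattice ℝ Λ] {u v : Plane}

lemma norm_sq_dualVec_eq (hD : 0 < gramDet u v) (p : ℤ × ℤ) : ‖dualVec u v p‖ ^ 2 =
    4 * π ^ 2 / gramDet u v *
      (‖v‖ ^ 2 * p.1 ^ 2 + 2 * -⟪u, v⟫_ℝ * p.1 * p.2 + ‖u‖ ^ 2 * p.2 ^ 2) := by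
  rw [norm_sq_dualVec hD]
  ring

variable (hD : 0 < gramDet u v) (h0 : ⟪u, v⟫_ℝ < 0) (hA : -(2 * ⟪u, v⟫_ℝ) ≤ ‖u‖ ^ 2)
  (hAC : ‖u‖ ^ 2 ≤ ‖v‖ ^ 2) (hC : -(2 * ⟪u, v⟫_ℝ) < ‖v‖ ^ 2)
include hD h0 hA hAC hC

lemma le_norm_sq_dualVec_of_reduced {p : ℤ × ℤ} (hp : p ≠ 0) :
    4 * π ^ 2 / gramDet u v * ‖u‖ ^ 2 ≤ ‖dualVec u v p‖ ^ 2 := by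
  rw [norm_sq_dualVec_eq hD]
  refine mul_le_mul_of_nonneg_left ?_ (by positivity)
  rcases reduced_form_cases (neg_pos.2 h0) (by linarith) hAC (by linarith) hp with h | h
  · simp only [Finset.mem_insert, Finset.mem_singleton] at h
    rcases h with rfl | rfl | rfl | rfl <;> norm_num <;> exact hAC
  · exact h.le

open scoped Classical in
/-- The leading eigenfunction of a reduced lattice. -/
lemma tsum_leading_of_reduced (x y : ℝ) :
    (∑' p, if p ≠ 0 ∧ ‖dualVec u v p‖ ^ 2 = 4 * π ^ 2 / gramDet u v * ‖u‖ ^ 2 then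
      planeWave (dualVec u v p) 0 (x • u + y • v) else 0) =
    2 * Real.cos (2 * π * y) + (if ‖v‖ ^ 2 = ‖u‖ ^ 2 then 1 else 0) *
      (2 * Real.cos (2 * π * x)) := by
  have hd : 4 * π ^ 2 / gramDet u v ≠ 0 := by positivity
  rw [tsum_eq_sum (s := ({(0, 1), (0, -1), (1, 0), (-1, 0)} : Finset (ℤ × ℤ)))]
  · simp only [norm_sq_dualVec_eq hD, mul_right_inj' hd, planeWave, inner_dualVec hD, add_zero]
    rw [Finset.sum_insert (by decide), Finset.sum_insert (by decide), Finset.sum_insert (by decide),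
      Finset.sum_singleton]
    simp only [ne_eq, Prod.mk_eq_zero, one_ne_zero, neg_eq_zero, and_false, false_and,
      not_false_eq_true, true_and, Int.cast_zero, Int.cast_one, Int.cast_neg, zero_mul, one_mul,
      neg_one_mul, mul_neg]
    norm_num
    split_ifs <;> ring
  · intro p hp
    refine if_neg fun h => ?_
    have h1 := h.2
    rw [norm_sq_dualVec_eq hD, mul_right_inj' hd] at h1
    rcases reduced_form_cases (neg_pos.2 h0) (by linarith) hAC (by linarith) h.1 with h2 | h2
    · exact hp h2
    · exact h2.ne' h1

omit hC in
/-- A point on the boundary of the Voronoi cell of a reduced lattice. -/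
lemma norm_le_norm_add_of_reduced (hΛ : Λ = Submodule.span ℤ {u, v}) {a : ℝ} (ha0 : 0 ≤ a)
    (ha : a ≤ 1 / 4) {l : Plane} (hl : l ∈ Λ) :
    ‖a • u + (1 / 2 + a * -⟪u, v⟫_ℝ / ‖v‖ ^ 2) • v‖ ≤
      ‖a • u + (1 / 2 + a * -⟪u, v⟫_ℝ / ‖v‖ ^ 2) • v + l‖ := by
  obtain ⟨m, n, rfl⟩ := (mem_lattice_iff hΛ).1 hl
  refine norm_le_of_two_mul_inner_le ?_
  have hC0 : 0 < ‖v‖ ^ 2 := by linarith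
  have e1 : (a * -⟪u, v⟫_ℝ / ‖v‖ ^ 2) * ‖v‖ ^ 2 = a * -⟪u, v⟫_ℝ := div_mul_cancel₀ _ hC0.ne'
  have e2 : 0 ≤ a * -⟪u, v⟫_ℝ / ‖v‖ ^ 2 := by
    have := neg_pos.2 h0
    positivity
  rw [← real_inner_self_eq_norm_sq ((m : ℝ) • u + (n : ℝ) • v)]
  simp only [inner_add_left, inner_add_right, real_inner_smul_left, real_inner_smul_right,
    real_inner_comm u v]
  simp only [real_inner_self_eq_norm_sq]
  generalize a * -⟪u, v⟫_ℝ / ‖v‖ ^ 2 = e at *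
  generalize ⟪u, v⟫_ℝ = i at *
  generalize ‖u‖ ^ 2 = A at *
  generalize ‖v‖ ^ 2 = C at *
  have sq_ge : ∀ k : ℤ, -(k : ℝ) ≤ (k : ℝ) ^ 2 := fun k => by
    have : -k ≤ k ^ 2 := by
      rcases (by omega : 0 ≤ k ∨ k ≤ -1) with h | h <;> nlinarith
    exact_mod_cast this
  -- Selling's decomposition |mu + nv|² = (A + i)m² + (C + i)n² - i(n - m)² has nonnegative
  -- coefficients. The inner product splits in the same way, and each piece is settled by -k ≤ k²
  -- for integers.
  have hη : 0 ≤ a * A + e * i := by nlinarith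
  have hη2 : 2 * (a * A + e * i) ≤ A + i := by nlinarith
  have hm : -(2 * (a * A + e * i) * m) ≤ (A + i) * m ^ 2 := by
    have h1 := sq_ge m
    rcases le_or_gt 0 (m : ℝ) with h | h
    · nlinarith [mul_nonneg hη h, mul_nonneg (by linarith : 0 ≤ A + i) (sq_nonneg (m : ℝ))]
    · nlinarith [mul_le_mul_of_nonneg_right hη2 (neg_nonneg.2 h.le)]
  have h1 := mul_le_mul_of_nonneg_left (sq_ge (n - m)) (by linarith : 0 ≤ -i)
  have h2 := mul_le_mul_of_nonneg_left (sq_ge n) (by linarith : 0 ≤ C + i)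
  push_cast at h1
  have e3 : n * (e * C) = n * (a * -i) := by rw [e1]
  linarith

end LargeTime

theorem IsHeatKernel.isRectangular_or_isRegularTriangular {Λ : Submodule ℤ Plane}
    [DiscreteTopology Λ] [IsZLattice ℝ Λ] {K : ℝ → FlatTorus Λ → FlatTorus Λ → ℝ}
    (hK : IsHeatKernel Λ K) {t : ℕ → ℝ} (ht0 : ∀ k, 0 < t k) (ht : Tendsto t atTop atTop)
    (hdec : ∀ k, GeodesicallyDecreasing Λ (K (t k))) :
    IsRectangularLattice Λ ∨ IsRegularTriangularLattice Λ := by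
  obtain ⟨u, v, hΛ, hneg, hA, hAC⟩ := exists_reduced_basis Λ
  have hD := gramDet_pos hΛ
  have hu : u ≠ 0 := by rintro rfl; simp [gramDet] at hD
  have hv : v ≠ 0 := by rintro rfl; simp [gramDet] at hD
  rcases hneg.eq_or_lt with h0 | h0
  · exact Or.inl ⟨u, v, hu, hv, h0, hΛ⟩
  right
  rcases lt_or_ge (-(2 * ⟪u, v⟫_ℝ)) (‖v‖ ^ 2) with hC | hC
  · exfalso
    have hC0 : 0 < ‖v‖ ^ 2 := by positivity
    -- The point q = au + bv lies on the face ⟨q, v⟩ = |v|²/2 of the Voronoi cell, slightly off its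
    -- midpoint.
    set a := -⟪u, v⟫_ℝ / (4 * ‖v‖ ^ 2) with ha
    have ha0 : 0 ≤ a := div_nonneg (by linarith) (by positivity)
    have ha4 : a ≤ 1 / 4 := by
      rw [ha, div_le_div_iff₀ (by positivity) (by norm_num)]
      linarith
    set b := 1 / 2 + a * -⟪u, v⟫_ℝ / ‖v‖ ^ 2 with hb
    set q := a • u + b • v with hq
    have hq0 : q ≠ 0 := fun h => by
      have h1 : ⟪q, v⟫_ℝ = 0 := by rw [h, inner_zero_left]
      rw [hq, inner_add_left, real_inner_smul_left, real_inner_smul_left,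
        real_inner_self_eq_norm_sq, hb, add_mul, div_mul_cancel₀ _ hC0.ne'] at h1
      linarith
    have hgeo := isMinimalGeodesic_of_norm_le hq0 fun l hl =>
      norm_le_norm_add_of_reduced hD h0 hA hAC hΛ ha0 ha4 hl
    have hlim := fun z => tendsto_exp_mul_heatFn hΛ
      (fun p hp => le_norm_sq_dualVec_of_reduced hD h0 hA hAC hC hp) ht z
    refine not_leading_decreasing (c := if ‖v‖ ^ 2 = ‖u‖ ^ 2 then 1 else 0) (neg_pos.2 h0)
      (by linarith) hAC (by split_ifs <;> norm_num) ha ?_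
    have hF : ∀ s : ℝ, Tendsto (fun k => Real.exp (4 * π ^ 2 / gramDet u v * ‖u‖ ^ 2 * t k) *
        ((volume : Measure Plane).real (latticeCell Λ) *
          K (t k) (torusProj Λ ((0 : ℝ) • q)) (torusProj Λ (s • q)) - 1)) atTop
        (𝓝 (2 * Real.cos (2 * π * (s * b)) + (if ‖v‖ ^ 2 = ‖u‖ ^ 2 then 1 else 0) *
          (2 * Real.cos (2 * π * (s * a))))) := fun s => by
      have h1 := hlim ((-(s * a)) • u + (-(s * b)) • v)
      rw [tsum_leading_of_reduced hD h0 hA hAC hC, mul_neg, mul_neg, Real.cos_neg,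
        Real.cos_neg] at h1
      refine h1.congr fun k => ?_
      rw [hK.eq_heatFn hΛ (ht0 k)]
      congr 4
      rw [hq]
      module
    -- Rescaling by positive factors and subtracting the mean preserves monotonicity along the
    -- geodesic, and so does the limit.
    intro s hs s' hs' hss
    refine le_of_tendsto_of_tendsto' (hF s') (hF s) fun k => ?_
    have h1 := hdec k _ _ _ hgeo rfl hs hs' hss
    have hV := volume_latticeCell_pos Λ
    gcongr
  -- All reduction inequalities are equalities here, which is the triangular case.
  · have hvu : ‖u‖ ^ 2 = ‖v‖ ^ 2 := le_antisymm hAC (hC.trans hA)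
    have hn : ‖u‖ = ‖v‖ := (sq_eq_sq₀ (norm_nonneg _) (norm_nonneg _)).1 hvu
    have hin : ⟪u, v⟫_ℝ = -(‖u‖ ^ 2) / 2 := by linarith
    refine ⟨u, v, hu, hn, ?_, hΛ⟩
    have hu2 : ‖u‖ ^ 2 ≠ 0 := by positivity
    rw [InnerProductGeometry.angle, hin, ← hn, ← sq, div_div, mul_comm 2, ← div_div, neg_div,
      div_self hu2, show 2 * π / 3 = π - π / 3 by ring,
      show (-1 : ℝ) / 2 = Real.cos (π - π / 3) by
        rw [Real.cos_pi_sub, Real.cos_pi_div_three]; norm_num,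
      Real.arccos_cos (by linarith [Real.pi_pos]) (by linarith [Real.pi_pos])]
theorem mainTheorem1 (Λ : Submodule ℤ Plane) [DiscreteTopology Λ] [IsZLattice ℝ Λ] :
    (∃ K : ℝ → FlatTorus Λ → FlatTorus Λ → ℝ, IsHeatKernel Λ K) ∧
    ∀ K : ℝ → FlatTorus Λ → FlatTorus Λ → ℝ, IsHeatKernel Λ K →
      (IsRegularTriangularLattice Λ →
        ∀ t : ℝ, 0 < t → StrictlyGeodesicallyDecreasing Λ (K t)) ∧
      ((∃ t : ℕ → ℝ, (∀ k, 0 < t k) ∧ Tendsto t atTop atTop ∧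
          ∀ k, GeodesicallyDecreasing Λ (K (t k))) →
        IsRectangularLattice Λ ∨ IsRegularTriangularLattice Λ) := by
  refine ⟨?_, fun K hK => ⟨fun h t ht => hK.strictlyGeodesicallyDecreasing h ht, ?_⟩⟩
  · obtain ⟨u, v, hΛ⟩ := exists_eq_span_pair Λ
    exact ⟨_, isHeatKernel_heatFn hΛ⟩
  · rintro ⟨t, ht0, ht, hdec⟩
    exact hK.isRectangular_or_isRegularTriangular ht0 ht hdec
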